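/- **Theorem 1.2.** Let $n>m\ge 0$ be even integers, $\alpha:=\frac{n-m}{2}$, and let $$Qu=\sum_{j=0}^{n}q_j(x)u^{(j)},\qquad Ph=h^{(m)}+\sum_{j=0}^{m-1}p_j(x)h^{(j)}$$ be differential operators with smooth complex-valued coefficients on $\mathbb R$, where $|q_n(x)|\ge c>0$ for all $x\in\mathbb R$. Assume that the space of solutions of $Qu=0$ on $\mathbb R$ that lie in $L^2(-\infty,0)$ has dimension exactly $\frac n2$, and that the space of solutions that lie in $L^2(0,\infty)$ also has dimension exactly $\frac n2$. Let $R(x,y)$ be a locally integrable kernel on $\mathbb R^2$ with $R(x,y)=\overline{R(y,x)}$, such that $R\varphi:=\int_{\mathbb R}R(\cdot,y)\varphi(y)\,dy\in L^2(\mathbb R)$ for each $\varphi\in C_0^\infty(\mathbb R)$ and $$QR=P\delta(x-y),$$ that is, $Q(R\varphi)=P\varphi$ in the sense of distributions for each $\varphi\in C_0^\infty(\mathbb R)$. Write $(u,v)=\int_{\mathbb R}u\bar v\,dx$, let $\|\cdot\|_s$ be the norm of $H^s(\mathbb R)$, and let $Q^*\varphi=\sum_{j=0}^n(-1)^j(\overline{q_j}\varphi)^{(j)}$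 be the formal adjoint of $Q$. Assume that there are positive constants $c_3,c_4,c_5,c_6$ such that for all (complex-valued) $\varphi\in C_0^\infty(\mathbb R)$ $$c_3\|\varphi\|_{-\alpha+n}\le\|Q^*\varphi\|_{-\alpha}\le c_4\|\varphi\|_{-\alpha+n},$$ $$c_5\|\varphi\|^2_{\frac{n+m}{2}}\le \operatorname{Re}(PQ^*\varphi,\varphi)\le c_6\|\varphi\|^2_{\frac{n+m}{2}}.$$ Then: 1. there are constants $c_1,c_2>0$ such that for all $\varphi\in C_0^\infty(\mathbb R)$ the number $(R\varphi,\varphi)$ is real and $$c_1\|\varphi\|_{-\alpha}^2\le (R\varphi,\varphi)\le c_2\|\varphi\|_{-\alpha}^2;$$ 2. for each $L>0$ the integral operator $(Rh)(x)=\int_0^L R(x,y)h(y)\,dy$, $h\in L^2(0,L)$, extends to an isomorphism (a linear homeomorphism) of $\dot H^{-\alpha}(0,L)$ onto $H^\alpha(0,L)$. Here $H^\alpha(0,L)=W^{\alpha,2}(0,L)$, and $\dot H^{-\alpha}(0,L)$ is its dual with respect to the $L^2(0,L)$ inner product, with $h\in L^2(0,L)$ identified with the functional $g\mapsto\int_0^L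 h\bar g\,dx$. -/

import Mathlib

open MeasureTheory Set
open scoped ContDiff FourierTransform ComplexConjugate

noncomputable section

namespace RammEstimation

/-- Complex-valued test functions on the real line, the class `C_0^∞(ℝ)`. -/
def IsTest (φ : ℝ → ℂ) : Prop :=
  ContDiff ℝ ∞ φ ∧ HasCompactSupport φ

/-- The differential expression `u ↦ ∑_{j ≤ k} a_j(x) u^{(j)}(x)` of order at most `k`. -/
def diffOp {k : ℕ} (a : Fin (k + 1) → ℝ → ℂ) (u : ℝ → ℂ) (x : ℝ) : ℂ :=
  ∑ j : Fin (k + 1), a j x * iteratedDeriv (j : ℕ) u x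

/-- The formally adjoint expression `u ↦ ∑_{j ≤ k} (-1)^j (d/dx)^j (conj (a_j) u)`. -/
def formalAdjoint {k : ℕ} (a : Fin (k + 1) → ℝ → ℂ) (u : ℝ → ℂ) (x : ℝ) : ℂ :=
  ∑ j : Fin (k + 1), (-1 : ℂ) ^ (j : ℕ) * iteratedDeriv (j : ℕ) (fun t => conj (a j t) * u t) x

/-- The inner product `(u, v) = ∫ u(x) conj (v(x)) dx` of `L²(ℝ)`. -/
def pairing (u v : ℝ → ℂ) : ℂ :=
  ∫ x, u x * conj (v x)

/-- The norm of `H^s(ℝ)` (used on test functions): the square root of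
`∫ (1 + (2πξ)²)^s |φ̂(ξ)|² dξ`, where `φ̂(ξ) = ∫ e^{-2πixξ} φ(x) dx`. -/
def sobolevNorm (s : ℝ) (φ : ℝ → ℂ) : ℝ :=
  Real.sqrt (∫ ξ : ℝ, (1 + (2 * Real.pi * ξ) ^ 2) ^ s * ‖𝓕 φ ξ‖ ^ 2)

/-- The integral operator `(Rφ)(x) = ∫ R(x,y) φ(y) dy` on the line. -/
def kernelOp (R : ℝ → ℝ → ℂ) (φ : ℝ → ℂ) (x : ℝ) : ℂ :=
  ∫ y, R x y * φ y

/-- `QR = Pδ(x - y)` in the sense of distributions, where `Q` and `P` (with coefficients `q` and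
`p`) act on the variable `x`: for each test function `φ`, the function `Rφ` solves `Q(Rφ) = Pφ`
weakly, that is, `(Rφ, Q^*χ) = (Pφ, χ)` for each test function `χ`. -/
def KernelEquation {n m : ℕ} (q : Fin (n + 1) → ℝ → ℂ) (p : Fin (m + 1) → ℝ → ℂ)
    (R : ℝ → ℝ → ℂ) : Prop :=
  ∀ φ χ : ℝ → ℂ, IsTest φ → IsTest χ →
    pairing (kernelOp R φ) (formalAdjoint q χ) = pairing (diffOp p φ) χ

/-- The complex vector space of smooth solutions on `ℝ` of `∑ a_j u^{(j)} = 0` that are square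
integrable on the set `S`. -/
def l2Solutions {k : ℕ} (a : Fin (k + 1) → ℝ → ℂ) (S : Set ℝ) : Submodule ℂ (ℝ → ℂ) where
  carrier := {u | ContDiff ℝ ∞ u ∧ (∀ x, diffOp a u x = 0) ∧ MemLp u 2 (volume.restrict S)}
  zero_mem' := by
    refine ⟨contDiff_const, fun x => ?_, MemLp.zero⟩
    simp only [diffOp]
    refine Finset.sum_eq_zero fun j _ => ?_
    have : (0 : ℝ → ℂ) = fun _ => (0 : ℂ) := rfl
    rw [this, iteratedDeriv_const]
    simp
  add_mem' := by
    rintro u v ⟨hu, hu0, hu2⟩ ⟨hv, hv0, hv2⟩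
    refine ⟨hu.add hv, fun x => ?_, hu2.add hv2⟩
    have h : diffOp a (u + v) x = diffOp a u x + diffOp a v x := by
      simp only [diffOp, ← Finset.sum_add_distrib]
      refine Finset.sum_congr rfl fun j _ => ?_
      rw [iteratedDeriv_add (hu.of_le (by exact_mod_cast le_top)).contDiffAt
        (hv.of_le (by exact_mod_cast le_top)).contDiffAt, mul_add]
    rw [h, hu0, hv0, add_zero]
  smul_mem' := by
    rintro c u ⟨hu, hu0, hu2⟩
    refine ⟨contDiff_const.smul hu, fun x => ?_, hu2.const_smul c⟩
    have h : diffOp a (c • u) x = c * diffOp a u x := by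
      simp only [diffOp, Finset.mul_sum]
      refine Finset.sum_congr rfl fun j _ => ?_
      rw [iteratedDeriv_const_smul (hu.of_le (by exact_mod_cast le_top)).contDiffAt c, smul_eq_mul]
      ring
    rw [h, hu0, mul_zero]

/-- The Hilbert space `L²(0,L)`. -/
abbrev L2Interval (L : ℝ) : Type :=
  Lp ℂ 2 (volume.restrict (Ioo (0 : ℝ) L))

/-- The Sobolev space `H^k(0,L) = W^{k,2}(0,L)`. A function `u` is represented by the tuple
`(u, u', …, u^{(k)})` of its weak derivatives in `L²(0,L)`, which `u` determines; the inner product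
is `∑_{j ≤ k} (u^{(j)}, v^{(j)})_{L²(0,L)}`. -/
def SobolevInterval (k : ℕ) (L : ℝ) :
    Submodule ℂ (PiLp 2 (fun _ : Fin (k + 1) => L2Interval L)) where
  carrier := {u | ∀ (j : Fin (k + 1)) (φ : ℝ → ℂ), IsTest φ → tsupport φ ⊆ Ioo 0 L →
    ∫ x in Ioo 0 L, (u 0 : ℝ → ℂ) x * iteratedDeriv (j : ℕ) φ x =
      (-1 : ℂ) ^ (j : ℕ) * ∫ x in Ioo 0 L, (u j : ℝ → ℂ) x * φ x}
  zero_mem' := by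
    intro j φ _ _
    have h0 (i : Fin (k + 1)) (ψ : ℝ → ℂ) :
        ∫ x in Ioo 0 L, ((0 : PiLp 2 (fun _ : Fin (k + 1) => L2Interval L)) i : ℝ → ℂ) x * ψ x
          = 0 := by
      refine integral_eq_zero_of_ae ?_
      filter_upwards [Lp.coeFn_zero ℂ 2 (volume.restrict (Ioo (0 : ℝ) L))] with x hx
      rw [PiLp.zero_apply, hx]
      simp
    rw [h0, h0, mul_zero]
  add_mem' := by
    intro u v hu hv j φ hφ hs
    have hint (w : L2Interval L) (i : ℕ) :
        Integrable (fun x => (w : ℝ → ℂ) x * iteratedDeriv i φ x)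
          (volume.restrict (Ioo 0 L)) := by
      have hc : Continuous (iteratedDeriv i φ) :=
        hφ.1.continuous_iteratedDeriv i (by exact_mod_cast le_top)
      have hk : HasCompactSupport (iteratedDeriv i φ) := by
        induction i with
        | zero => simpa using hφ.2
        | succ l ih =>
          rw [iteratedDeriv_succ]
          exact (ih (hφ.1.continuous_iteratedDeriv l (by exact_mod_cast le_top))).deriv
      have hm : MemLp (iteratedDeriv i φ) 2 (volume.restrict (Ioo 0 L)) :=
        hc.memLp_of_hasCompactSupport hk
      exact (Lp.memLp w).integrable_mul hm
    have hadd (i : Fin (k + 1)) (l : ℕ) :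
        ∫ x in Ioo 0 L, ((u + v) i : ℝ → ℂ) x * iteratedDeriv l φ x =
          (∫ x in Ioo 0 L, (u i : ℝ → ℂ) x * iteratedDeriv l φ x) +
            ∫ x in Ioo 0 L, (v i : ℝ → ℂ) x * iteratedDeriv l φ x := by
      rw [← integral_add (hint _ _) (hint _ _)]
      refine integral_congr_ae ?_
      filter_upwards [Lp.coeFn_add (u i) (v i)] with x hx
      have : ((u + v) i : ℝ → ℂ) x = (u i : ℝ → ℂ) x + (v i : ℝ → ℂ) x := by
        simpa using hx
      rw [this, add_mul]
    have hj := hadd j 0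
    simp only [iteratedDeriv_zero] at hj
    rw [hadd, hj, hu j φ hφ hs, hv j φ hφ hs, mul_add]
  smul_mem' := by
    intro c u hu j φ hφ hs
    have hsmul (i : Fin (k + 1)) (ψ : ℝ → ℂ) :
        ∫ x in Ioo 0 L, ((c • u) i : ℝ → ℂ) x * ψ x =
          c * ∫ x in Ioo 0 L, (u i : ℝ → ℂ) x * ψ x := by
      rw [← integral_const_mul]
      refine integral_congr_ae ?_
      filter_upwards [Lp.coeFn_smul c (u i)] with x hx
      have : ((c • u) i : ℝ → ℂ) x = c * (u i : ℝ → ℂ) x := by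
        simpa using hx
      rw [this, mul_assoc]
    rw [hsmul, hsmul, hu j φ hφ hs]
    ring

/-- The element of `L²(0,L)` underlying an element of `H^k(0,L)`. -/
def SobolevInterval.toL2 (k : ℕ) (L : ℝ) : SobolevInterval k L →L[ℂ] L2Interval L :=
  (PiLp.proj 2 (fun _ : Fin (k + 1) => L2Interval L) 0).comp (SobolevInterval k L).subtypeL

/-- The space `Ḣ^{-k}(0,L)`: the dual of `H^k(0,L)` with respect to the inner product of `L²(0,L)`,
that is, the bounded antilinear functionals `g ↦ (h, g)` on `H^k(0,L)`, with the norm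
`sup_g |(h, g)| / ‖g‖`. -/
abbrev SobolevDual (k : ℕ) (L : ℝ) : Type :=
  SobolevInterval k L →L⋆[ℂ] ℂ

/-- The (dense) inclusion of `L²(0,L)` in `Ḣ^{-k}(0,L)`: the function `h` acts as
`g ↦ (h, g) = ∫_0^L h conj g`. -/
def SobolevDual.ofL2 (k : ℕ) (L : ℝ) (h : L2Interval L) : SobolevDual k L :=
  ((innerSL ℂ).flip h).comp (SobolevInterval.toL2 k L)

/-- The integral operator with kernel `R`, `(Rh)(x) = ∫_0^L R(x,y) h(y) dy` for `h ∈ L²(0,L)`,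
is (by continuous extension from the dense subspace `L²(0,L)`) an isomorphism of `Ḣ^{-k}(0,L)`
onto `H^k(0,L)`: a linear homeomorphism. -/
def IsSobolevIsomorphism (R : ℝ → ℝ → ℂ) (k : ℕ) (L : ℝ) : Prop :=
  ∃ T : SobolevDual k L ≃L[ℂ] SobolevInterval k L,
    ∀ h : L2Interval L, ∀ᵐ x ∂(volume.restrict (Ioo 0 L)),
      IntegrableOn (fun y => R x y * (h : ℝ → ℂ) y) (Ioo 0 L) ∧
      (SobolevInterval.toL2 k L (T (SobolevDual.ofL2 k L h)) : ℝ → ℂ) x =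
        ∫ y in Ioo 0 L, R x y * (h : ℝ → ℂ) y

end RammEstimation

end

/-! On functions of the form Q^*φ the two-sided estimate is immediate: QR = Pδ gives (RQ^*φ, Q^*φ) =
(PQ^*φ, φ). This is comparable to the squared norm of φ in H^{(n+m)/2}, and since (n+m)/2 = n - α,
also to the squared norm of Q^*φ in H^{-α}. It remains to show that these functions are dense in
H^{-α}(ℝ), that R really is the continuous extension, and to pass to (0,L).

Density (`denseRange_besselTest_adjointOp`) follows by duality once Qu = 0 has no nonzero solution
in L²(ℝ), and this is where the dimensions n/2 enter (`l2Solutions_inf_eq_bot`). Let S₋, S₊ be the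
solutions in L² of the two half-lines. If S₋ ∩ S₊ ≠ 0, then S₋ + S₊ has dimension less than n, and
some test function f on (0,1) annihilates S₋ + S₊ but not a further solution u₀. Such an f is a
limit in H^{-α} of Q^*φ with φ supported in (0,∞), and also of Q^*ψ with ψ supported in (-∞,1). The
lower estimate for Q^* forces φ - ψ → 0, while the pairing of Q^*φ with a cut-off of u₀ depends only
on φ - ψ to the right of 1. So f annihilates u₀ after all.

The form then extends to a bounded selfadjoint coercive operator A on H^{-α}(ℝ), modelled on L² by a
weighted Fourier transform. Since L² weak solutions of Qu = 0 vanish, Rψ is given by A for every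
test function ψ (`exists_operator_of_kernel`).

Let r be the restriction H^α(ℝ) → H^α(0,L). It is onto (`restriction_surjective`), so rAr^* inherits
coercivity and is an isomorphism (`exists_equiv_of_coercive`). Since α ≥ 1, L¹ embeds in H^{-α},
hence R is essentially bounded (`ae_norm_kernel_le`). The integral over (0,L) thus converges for h
in L²(0,L), and Fubini identifies it with the abstract operator. -/

namespace RammEstimation

open Filter Topology
open scoped BoundedContinuousFunction ENNReal NNReal

noncomputable section

/-! ### Global existence and uniqueness for ordinary differential equations. -/

section ODE

variable {E : Type*} [NormedAddCommGroup E] [NormedSpace ℝ E]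

/-- If `m` is continuous, `∫ m cosh(∫ m)` is dominated by `cosh (∫ m)`. -/
lemma abs_integral_mul_cosh_le {m : ℝ → ℝ} (hm : Continuous m) (t₀ t : ℝ) :
    |∫ s in t₀..t, m s * Real.cosh (∫ r in t₀..s, m r)| ≤ Real.cosh (∫ r in t₀..t, m r) := by
  have hd (s : ℝ) : HasDerivAt (fun s => ∫ r in t₀..s, m r) (m s) s :=
    intervalIntegral.integral_hasDerivAt_right (hm.intervalIntegrable _ _)
      (hm.stronglyMeasurableAtFilter _ _) hm.continuousAt
  have hM : Continuous fun s => ∫ r in t₀..s, m r :=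
    continuous_iff_continuousAt.2 fun s => (hd s).continuousAt
  have hc : Continuous fun s => m s * Real.cosh (∫ r in t₀..s, m r) :=
    hm.mul (Real.continuous_cosh.comp hM)
  have := intervalIntegral.integral_eq_sub_of_hasDerivAt (a := t₀) (b := t)
    (f := fun s => Real.sinh (∫ r in t₀..s, m r)) (fun s _ => (hd s).sinh)
    ((hc.congr fun s => mul_comm _ _).intervalIntegrable _ _)
  simp only [mul_comm (Real.cosh _)] at this
  rw [this, intervalIntegral.integral_same, Real.sinh_zero, sub_zero, abs_le]
  rw [Real.sinh_eq, Real.cosh_eq]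
  have h1 := Real.exp_pos (∫ r in t₀..t, m r)
  have h2 := Real.exp_pos (-∫ r in t₀..t, m r)
  constructor <;> linarith

/-- Global existence for the initial value problem `y' = f(t, y)` when `f` is Lipschitz in `y` with
a constant that depends continuously on `t`. -/
theorem exists_global_solution [CompleteSpace E] {f : ℝ → E → E} {K : ℝ → ℝ}
    (hf : Continuous (Function.uncurry f)) (hK : Continuous K)
    (hK0 : ∀ t, 0 ≤ K t) (hfK : ∀ t x y, ‖f t x - f t y‖ ≤ K t * ‖x - y‖) (t₀ : ℝ) (y₀ : E) :
    ∃ y : ℝ → E, y t₀ = y₀ ∧ ∀ t, HasDerivAt y (f t (y t)) t := by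
  -- One contraction yields the solution on all of ℝ: write y = w • z with z bounded and w = cosh(∫
  -- m). The summand 2K of m makes the Lipschitz constant 1/2, and ‖f t 0‖ keeps the image bounded.
  -- As cosh is even, one weight serves both sides of t₀.
  set m : ℝ → ℝ := fun t => 2 * K t + ‖f t 0‖ with hm
  have hf0 : Continuous fun t => f t 0 := hf.comp (continuous_id.prodMk continuous_const)
  have hmc : Continuous m := (continuous_const.mul hK).add hf0.norm
  have hm0 (t) : 0 ≤ m t := add_nonneg (mul_nonneg two_pos.le (hK0 t)) (norm_nonneg _)
  set w : ℝ → ℝ := fun t => Real.cosh (∫ r in t₀..t, m r) with hw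
  have hwc : Continuous w := Real.continuous_cosh.comp <| by
    exact intervalIntegral.continuous_primitive (fun a b => hmc.intervalIntegrable a b) t₀
  have hw1 (t) : 1 ≤ w t := Real.one_le_cosh _
  have hw0 (t) : 0 < w t := one_pos.trans_le (hw1 t)
  have hmw : Continuous fun s => m s * w s := hmc.mul hwc
  have hg (z : ℝ →ᵇ E) : Continuous fun s => f s (w s • z s) :=
    hf.comp (continuous_id.prodMk (hwc.smul z.continuous))
  have hbd {g : ℝ → E} {C : ℝ} (hC : 0 ≤ C) (hgb : ∀ s, ‖g s‖ ≤ C * (m s * w s)) (t : ℝ) :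
      ‖∫ s in t₀..t, g s‖ ≤ C * w t := by
    calc ‖∫ s in t₀..t, g s‖ ≤ |∫ s in t₀..t, C * (m s * w s)| :=
          intervalIntegral.norm_integral_le_abs_of_norm_le (Eventually.of_forall hgb)
            ((continuous_const.mul hmw).intervalIntegrable _ _)
      _ = C * |∫ s in t₀..t, m s * w s| := by
          rw [intervalIntegral.integral_const_mul, abs_mul, abs_of_nonneg hC]
      _ ≤ C * w t := mul_le_mul_of_nonneg_left (abs_integral_mul_cosh_le hmc t₀ t) hC
  have hgrow (z : ℝ →ᵇ E) (s : ℝ) : ‖f s (w s • z s)‖ ≤ (1 + ‖z‖) * (m s * w s) := by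
    have h1 : ‖f s (w s • z s)‖ ≤ K s * (w s * ‖z‖) + ‖f s 0‖ := by
      have := hfK s (w s • z s) 0
      rw [sub_zero, norm_smul, Real.norm_of_nonneg (hw0 s).le] at this
      have h2 := norm_sub_norm_le (f s (w s • z s)) (f s 0)
      have h3 : K s * (w s * ‖z s‖) ≤ K s * (w s * ‖z‖) :=
        mul_le_mul_of_nonneg_left (mul_le_mul_of_nonneg_left (z.norm_coe_le_norm s) (hw0 s).le)
          (hK0 s)
      linarith
    have h4 : ‖f s 0‖ ≤ ‖f s 0‖ * w s := le_mul_of_one_le_right (norm_nonneg _) (hw1 s)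
    have h5 : 0 ≤ K s * w s := mul_nonneg (hK0 s) (hw0 s).le
    have h6 : 0 ≤ ‖f s 0‖ * w s := mul_nonneg (norm_nonneg _) (hw0 s).le
    have h7 := norm_nonneg z
    simp only [hm]
    nlinarith [mul_nonneg h5 h7, mul_nonneg h6 h7]
  have hpc (z : ℝ →ᵇ E) : Continuous fun t => ∫ s in t₀..t, f s (w s • z s) :=
    intervalIntegral.continuous_primitive (fun a b => (hg z).intervalIntegrable a b) t₀
  let Φ (z : ℝ →ᵇ E) : ℝ →ᵇ E := BoundedContinuousFunction.ofNormedAddCommGroup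
    (fun t => (w t)⁻¹ • (y₀ + ∫ s in t₀..t, f s (w s • z s)))
    ((hwc.inv₀ fun t => (hw0 t).ne').smul (continuous_const.add (hpc z)))
    (‖y₀‖ + (1 + ‖z‖)) <| by
      intro t
      rw [norm_smul, norm_inv, Real.norm_of_nonneg (hw0 t).le, inv_mul_le_iff₀ (hw0 t)]
      have h1 := norm_add_le y₀ (∫ s in t₀..t, f s (w s • z s))
      have h2 := hbd (add_nonneg one_pos.le (norm_nonneg z)) (hgrow z) t
      nlinarith [norm_nonneg y₀, hw1 t]
  have hΦ : ContractingWith (1 / 2) Φ := by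
    refine ⟨by rw [← NNReal.coe_lt_coe]; norm_num, LipschitzWith.of_dist_le_mul fun z z' => ?_⟩
    rw [BoundedContinuousFunction.dist_le (by positivity)]
    intro t
    have he : Φ z t - Φ z' t =
        (w t)⁻¹ • ∫ s in t₀..t, (f s (w s • z s) - f s (w s • z' s)) := by
      simp only [Φ, BoundedContinuousFunction.coe_ofNormedAddCommGroup]
      rw [← smul_sub, intervalIntegral.integral_sub ((hg z).intervalIntegrable _ _)
        ((hg z').intervalIntegrable _ _)]
      congr 1
      abel
    rw [dist_eq_norm, he, norm_smul, norm_inv, Real.norm_of_nonneg (hw0 t).le,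
      inv_mul_le_iff₀ (hw0 t), mul_comm (w t)]
    refine hbd (by positivity) (fun s => (hfK s _ _).trans ?_) t
    rw [← smul_sub, norm_smul, Real.norm_of_nonneg (hw0 s).le]
    have h1 : ‖z s - z' s‖ ≤ dist z z' := by
      rw [← dist_eq_norm]; exact BoundedContinuousFunction.dist_coe_le_dist s
    have h2 : K s * (w s * ‖z s - z' s‖) ≤ K s * (w s * dist z z') :=
      mul_le_mul_of_nonneg_left (mul_le_mul_of_nonneg_left h1 (hw0 s).le) (hK0 s)
    have h3 : (0 : ℝ) ≤ ‖f s 0‖ * w s * dist z z' :=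
      mul_nonneg (mul_nonneg (norm_nonneg _) (hw0 s).le) dist_nonneg
    simp only [hm, NNReal.coe_div, NNReal.coe_one, NNReal.coe_ofNat]
    nlinarith
  obtain ⟨z, hz⟩ : ∃ z, Φ z = z := ⟨_, hΦ.fixedPoint_isFixedPt⟩
  have hy (t : ℝ) : w t • z t = y₀ + ∫ s in t₀..t, f s (w s • z s) := by
    have : z t = (w t)⁻¹ • (y₀ + ∫ s in t₀..t, f s (w s • z s)) := by
      conv_lhs => rw [← hz]
      rfl
    rw [this, smul_inv_smul₀ (hw0 t).ne']
  refine ⟨fun t => w t • z t, (hy t₀).trans (by simp), fun t => ?_⟩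
  have hd := (intervalIntegral.integral_hasDerivAt_right ((hg z).intervalIntegrable t₀ t)
      ((hg z).stronglyMeasurableAtFilter _ _) (hg z).continuousAt).const_add y₀
  exact hd.congr_of_eventuallyEq (Eventually.of_forall fun s => hy s)

/-- Two solutions of `y' = f(t, y)` on `(a, b)` with the same value at `t₀` agree. -/
theorem solution_unique {f : ℝ → E → E} {K : ℝ → ℝ} (hK : Continuous K)
    (hfK : ∀ t x y, ‖f t x - f t y‖ ≤ K t * ‖x - y‖) {a b t₀ : ℝ} (ht₀ : t₀ ∈ Ioo a b)
    {y z : ℝ → E} (hy : ∀ t ∈ Ioo a b, HasDerivAt y (f t (y t)) t)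
    (hz : ∀ t ∈ Ioo a b, HasDerivAt z (f t (z t)) t) (h : y t₀ = z t₀) :
    EqOn y z (Ioo a b) := by
  obtain ⟨C, hC⟩ := (isCompact_Icc (a := a) (b := b)).exists_bound_of_continuousOn hK.continuousOn
  refine ODE_solution_unique_of_mem_Ioo (K := C.toNNReal) (v := f) (s := fun _ => univ)
    (fun t ht => LipschitzWith.lipschitzOnWith (LipschitzWith.of_dist_le_mul fun x x' => ?_)) ht₀
    (fun t ht => ⟨hy t ht, mem_univ _⟩) (fun t ht => ⟨hz t ht, mem_univ _⟩) h
  rw [dist_eq_norm, dist_eq_norm]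
  refine (hfK t x x').trans (mul_le_mul_of_nonneg_right ?_ (norm_nonneg _))
  exact (le_abs_self _).trans ((hC t (Ioo_subset_Icc_self ht)).trans (Real.le_coe_toNNReal C))

end ODE

/-! ### Linear systems with smooth coefficients. -/

section System

variable {N : ℕ} {A : Fin N → Fin N → ℝ → ℂ} {F : Fin N → ℝ → ℂ}

/-- The right-hand side of the linear system `y_i' = ∑_j A_{ij} y_j + F_i`. -/
def systemRHS (A : Fin N → Fin N → ℝ → ℂ) (F : Fin N → ℝ → ℂ) (t : ℝ) (y : Fin N → ℂ) :
    Fin N → ℂ :=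
  fun i => ∑ j, A i j t * y j + F i t

lemma systemRHS_lipschitz (A : Fin N → Fin N → ℝ → ℂ) (F : Fin N → ℝ → ℂ) (t : ℝ)
    (x y : Fin N → ℂ) :
    ‖systemRHS A F t x - systemRHS A F t y‖ ≤ (∑ i, ∑ j, ‖A i j t‖) * ‖x - y‖ := by
  refine (pi_norm_le_iff_of_nonneg (by positivity)).2 fun i => ?_
  have : (systemRHS A F t x - systemRHS A F t y) i = ∑ j, A i j t * (x - y) j := by
    simp only [systemRHS, Pi.sub_apply, mul_sub, Finset.sum_sub_distrib]
    ring
  rw [this]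
  calc ‖∑ j, A i j t * (x - y) j‖ ≤ ∑ j, ‖A i j t‖ * ‖x - y‖ :=
        norm_sum_le_of_le _ fun j _ => by
          rw [norm_mul]
          exact mul_le_mul_of_nonneg_left (norm_le_pi_norm (x - y) j) (norm_nonneg _)
    _ = (∑ j, ‖A i j t‖) * ‖x - y‖ := by rw [Finset.sum_mul]
    _ ≤ _ := by
        refine mul_le_mul_of_nonneg_right ?_ (norm_nonneg _)
        exact Finset.single_le_sum (f := fun i => ∑ j, ‖A i j t‖)
          (fun i _ => Finset.sum_nonneg fun j _ => norm_nonneg _) (Finset.mem_univ i)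

/-- A linear system with smooth coefficients has a smooth solution with any initial data. -/
theorem exists_system_solution (hA : ∀ i j, ContDiff ℝ ∞ (A i j)) (hF : ∀ i, ContDiff ℝ ∞ (F i))
    (t₀ : ℝ) (c : Fin N → ℂ) :
    ∃ y : Fin N → ℝ → ℂ, (∀ i, ContDiff ℝ ∞ (y i)) ∧ (∀ i, y i t₀ = c i) ∧
      ∀ i t, deriv (y i) t = ∑ j, A i j t * y j t + F i t := by
  have hcont : Continuous (Function.uncurry (systemRHS A F)) := by
    refine continuous_pi fun i => ?_
    refine (continuous_finsetSum _ fun j _ => ?_).add ((hF i).continuous.comp continuous_fst)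
    exact ((hA i j).continuous.comp continuous_fst).mul
      ((continuous_apply j).comp continuous_snd)
  have hKc : Continuous fun t => ∑ i, ∑ j, ‖A i j t‖ :=
    continuous_finsetSum _ fun i _ => continuous_finsetSum _ fun j _ => (hA i j).continuous.norm
  obtain ⟨y, hy0, hy⟩ := exists_global_solution hcont hKc (fun t => by positivity)
    (systemRHS_lipschitz A F) t₀ c
  have hd (i : Fin N) (t : ℝ) :
      HasDerivAt (fun s => y s i) (∑ j, A i j t * y t j + F i t) t := hasDerivAt_pi.1 (hy t) i
  refine ⟨fun i t => y t i, ?_, fun i => congrFun hy0 i, fun i t => (hd i t).deriv⟩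
  have key (k : ℕ) : ∀ i, ContDiff ℝ k fun t => y t i := by
    induction k with
    | zero =>
      intro i
      exact contDiff_zero.2 (continuous_iff_continuousAt.2 fun t => (hd i t).continuousAt)
    | succ k ih =>
      intro i
      rw [show ((k + 1 : ℕ) : WithTop ℕ∞) = (k : WithTop ℕ∞) + 1 by push_cast; rfl,
        contDiff_succ_iff_deriv]
      refine ⟨fun t => (hd i t).differentiableAt, by simp, ?_⟩
      rw [show deriv (fun t => y t i) = fun t => ∑ j, A i j t * y t j + F i t from
        funext fun t => (hd i t).deriv]
      refine (ContDiff.sum fun j _ => ?_).add ((hF i).of_le (by exact_mod_cast le_top))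
      exact ((hA i j).of_le (by exact_mod_cast le_top)).mul (ih j)
  exact fun i => contDiff_infty.2 fun k => key k i

/-- Uniqueness for homogeneous linear systems. -/
theorem system_solution_eq_zero (hA : ∀ i j, Continuous (A i j)) {a b t₀ : ℝ}
    (ht₀ : t₀ ∈ Ioo a b) {y : Fin N → ℝ → ℂ} (hy0 : ∀ i, y i t₀ = 0)
    (hyd : ∀ i, Differentiable ℝ (y i))
    (hy : ∀ i, ∀ t ∈ Ioo a b, deriv (y i) t = ∑ j, A i j t * y j t) :
    ∀ i, ∀ t ∈ Ioo a b, y i t = 0 := by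
  have hKc : Continuous fun t => ∑ i, ∑ j, ‖A i j t‖ :=
    continuous_finsetSum _ fun i _ => continuous_finsetSum _ fun j _ => (hA i j).norm
  have h := solution_unique (f := systemRHS A fun _ _ => 0) (y := fun t i => y i t)
    (z := fun _ _ => 0) hKc
    (systemRHS_lipschitz A _) ht₀ (fun t ht => hasDerivAt_pi.2 fun i => by
      have := (hyd i t).hasDerivAt
      rw [hy i t ht] at this
      simpa [systemRHS] using this) (fun t ht => by
      have : systemRHS A (fun _ _ => 0) t (fun _ => 0) = 0 := by
        ext i; simp [systemRHS]
      rw [this]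
      exact hasDerivAt_const t _) (funext hy0)
  exact fun i t ht => congrFun (h ht) i

end System

/-! ### Test functions, formal adjoints and integration by parts. -/

section Basic

lemma contDiff_iteratedDeriv {u : ℝ → ℂ} (hu : ContDiff ℝ ∞ u) (j : ℕ) :
    ContDiff ℝ ∞ (iteratedDeriv j u) := by
  rw [iteratedDeriv_eq_iterate]
  exact ContDiff.iterate_deriv j hu

lemma contDiff_conj {u : ℝ → ℂ} (hu : ContDiff ℝ ∞ u) : ContDiff ℝ ∞ fun x => conj (u x) :=
  Complex.conjCLE.contDiff.comp hu

lemma contDiff_ofReal {g : ℝ → ℝ} (hg : ContDiff ℝ ∞ g) : ContDiff ℝ ∞ fun x => (g x : ℂ) :=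
  Complex.ofRealCLM.contDiff.comp hg

lemma iteratedDeriv_conj (u : ℝ → ℂ) (j : ℕ) :
    iteratedDeriv j (fun x => conj (u x)) = fun x => conj (iteratedDeriv j u x) := by
  induction j with
  | zero => simp
  | succ j ih =>
    rw [iteratedDeriv_succ, iteratedDeriv_succ, ih]
    exact deriv.star'

lemma iteratedDeriv_of_eqOn_isOpen {u v : ℝ → ℂ} {U : Set ℝ} (hU : IsOpen U) (h : EqOn u v U)
    (j : ℕ) : EqOn (iteratedDeriv j u) (iteratedDeriv j v) U := fun _ hx =>
  (EventuallyEq.iteratedDeriv_eq j (h.eventuallyEq_of_mem (hU.mem_nhds hx)))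

lemma tsupport_iteratedDeriv_subset (u : ℝ → ℂ) (j : ℕ) :
    tsupport (iteratedDeriv j u) ⊆ tsupport u := by
  induction j with
  | zero => simp
  | succ j ih =>
    rw [iteratedDeriv_succ]
    exact (tsupport_deriv_subset).trans ih

lemma diffOp_congr_of_eqOn {k : ℕ} (a : Fin (k + 1) → ℝ → ℂ) {u v : ℝ → ℂ} {U : Set ℝ}
    (hU : IsOpen U) (h : EqOn u v U) : EqOn (diffOp a u) (diffOp a v) U := fun x hx => by
  simp only [diffOp]
  exact Finset.sum_congr rfl fun j _ => by rw [iteratedDeriv_of_eqOn_isOpen hU h j hx]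

lemma formalAdjoint_congr_of_eqOn {k : ℕ} (a : Fin (k + 1) → ℝ → ℂ) {u v : ℝ → ℂ} {U : Set ℝ}
    (hU : IsOpen U) (h : EqOn u v U) : EqOn (formalAdjoint a u) (formalAdjoint a v) U := by
  intro x hx
  simp only [formalAdjoint]
  refine Finset.sum_congr rfl fun j _ => ?_
  rw [iteratedDeriv_of_eqOn_isOpen hU (v := fun t => conj (a j t) * v t)
    (fun t ht => by simp only [h ht]) j hx]

lemma contDiff_diffOp {k : ℕ} {a : Fin (k + 1) → ℝ → ℂ} (ha : ∀ j, ContDiff ℝ ∞ (a j))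
    {u : ℝ → ℂ} (hu : ContDiff ℝ ∞ u) : ContDiff ℝ ∞ (diffOp a u) :=
  ContDiff.sum fun j _ => (ha j).mul (contDiff_iteratedDeriv hu j)

lemma contDiff_formalAdjoint {k : ℕ} {a : Fin (k + 1) → ℝ → ℂ} (ha : ∀ j, ContDiff ℝ ∞ (a j))
    {u : ℝ → ℂ} (hu : ContDiff ℝ ∞ u) : ContDiff ℝ ∞ (formalAdjoint a u) :=
  ContDiff.sum fun j _ => contDiff_const.mul
    (contDiff_iteratedDeriv ((contDiff_conj (ha j)).mul hu) j)

lemma tsupport_subset_of_eq_zero {u v : ℝ → ℂ}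
    (h : ∀ x, x ∉ tsupport v → u x = 0) : tsupport u ⊆ tsupport v :=
  closure_minimal (fun x hx => by_contra fun hn => hx (h x hn)) (isClosed_tsupport v)

lemma formalAdjoint_zero {k : ℕ} (a : Fin (k + 1) → ℝ → ℂ) :
    formalAdjoint a (fun _ => 0) = fun _ => 0 := by
  funext x
  simp [formalAdjoint]

lemma diffOp_zero {k : ℕ} (a : Fin (k + 1) → ℝ → ℂ) : diffOp a (fun _ => 0) = fun _ => 0 := by
  funext x
  simp [diffOp]

lemma tsupport_formalAdjoint_subset {k : ℕ} (a : Fin (k + 1) → ℝ → ℂ) (u : ℝ → ℂ) :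
    tsupport (formalAdjoint a u) ⊆ tsupport u :=
  tsupport_subset_of_eq_zero fun x hx => by
    rw [formalAdjoint_congr_of_eqOn a (isClosed_tsupport u).isOpen_compl (v := fun _ => 0)
      (fun t ht => image_eq_zero_of_notMem_tsupport ht) hx, formalAdjoint_zero]

lemma tsupport_diffOp_subset {k : ℕ} (a : Fin (k + 1) → ℝ → ℂ) (u : ℝ → ℂ) :
    tsupport (diffOp a u) ⊆ tsupport u :=
  tsupport_subset_of_eq_zero fun x hx => by
    rw [diffOp_congr_of_eqOn a (isClosed_tsupport u).isOpen_compl (v := fun _ => 0)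
      (fun t ht => image_eq_zero_of_notMem_tsupport ht) hx, diffOp_zero]

namespace IsTest

variable {φ ψ : ℝ → ℂ}

lemma iteratedDeriv (hφ : IsTest φ) (j : ℕ) : IsTest (iteratedDeriv j φ) :=
  ⟨contDiff_iteratedDeriv hφ.1 j, hφ.2.mono' ((subset_tsupport _).trans
    (tsupport_iteratedDeriv_subset φ j))⟩

lemma conjugate (hφ : IsTest φ) : IsTest fun x => conj (φ x) :=
  ⟨contDiff_conj hφ.1, hφ.2.mono' fun x hx => subset_tsupport _ fun h => hx (by simp [h])⟩

lemma formalAdjoint {k : ℕ} {a : Fin (k + 1) → ℝ → ℂ} (hφ : IsTest φ)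
    (ha : ∀ j, ContDiff ℝ ∞ (a j)) : IsTest (formalAdjoint a φ) :=
  ⟨contDiff_formalAdjoint ha hφ.1, hφ.2.mono' ((subset_tsupport _).trans
    (tsupport_formalAdjoint_subset a φ))⟩

lemma diffOp {k : ℕ} {a : Fin (k + 1) → ℝ → ℂ} (hφ : IsTest φ)
    (ha : ∀ j, ContDiff ℝ ∞ (a j)) : IsTest (diffOp a φ) :=
  ⟨contDiff_diffOp ha hφ.1, hφ.2.mono' ((subset_tsupport _).trans (tsupport_diffOp_subset a φ))⟩

lemma mul_left (hφ : IsTest φ) (hψ : ContDiff ℝ ∞ ψ) : IsTest fun x => ψ x * φ x :=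
  ⟨hψ.mul hφ.1, hφ.2.mul_left⟩

lemma mul_right (hφ : IsTest φ) (hψ : ContDiff ℝ ∞ ψ) : IsTest fun x => φ x * ψ x :=
  ⟨hφ.1.mul hψ, hφ.2.mul_right⟩

lemma continuous (hφ : IsTest φ) : Continuous φ := hφ.1.continuous

lemma ofReal {g : ℝ → ℝ} (hg : ContDiff ℝ ∞ g) (hs : HasCompactSupport g) :
    IsTest fun x => (g x : ℂ) :=
  ⟨contDiff_ofReal hg, hs.comp_left (g := ((↑) : ℝ → ℂ)) Complex.ofReal_zero⟩

end IsTest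

/-- The test functions with support in `I`. -/
def testSpace (I : Set ℝ) : Submodule ℂ (ℝ → ℂ) where
  carrier := {φ | IsTest φ ∧ tsupport φ ⊆ I}
  zero_mem' := ⟨⟨contDiff_const, HasCompactSupport.zero⟩, by
    rw [show (0 : ℝ → ℂ) = fun _ => 0 from rfl]; simp [tsupport, Function.support]⟩
  add_mem' := fun h h' => ⟨⟨h.1.1.add h'.1.1, h.1.2.add h'.1.2⟩,
    (tsupport_add _ _).trans (union_subset h.2 h'.2)⟩
  smul_mem' := fun c _ h => ⟨⟨contDiff_const.smul h.1.1, h.1.2.smul_left (f := fun _ => c)⟩,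
    (tsupport_smul_subset_right (fun _ => c) _).trans h.2⟩

lemma conj_mem_testSpace {I : Set ℝ} {φ : ℝ → ℂ} (h : φ ∈ testSpace I) :
    (fun x => conj (φ x)) ∈ testSpace I :=
  ⟨h.1.conjugate, (tsupport_subset_of_eq_zero fun x hx => by
    simp [image_eq_zero_of_notMem_tsupport hx]).trans h.2⟩

lemma formalAdjoint_mem_testSpace {k : ℕ} {a : Fin (k + 1) → ℝ → ℂ}
    (ha : ∀ j, ContDiff ℝ ∞ (a j)) {I : Set ℝ} {φ : ℝ → ℂ} (h : φ ∈ testSpace I) :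
    formalAdjoint a φ ∈ testSpace I :=
  ⟨h.1.formalAdjoint ha, (tsupport_formalAdjoint_subset a φ).trans h.2⟩

lemma formalAdjoint_add {k : ℕ} {a : Fin (k + 1) → ℝ → ℂ} (ha : ∀ j, ContDiff ℝ ∞ (a j))
    {u v : ℝ → ℂ} (hu : ContDiff ℝ ∞ u) (hv : ContDiff ℝ ∞ v) :
    formalAdjoint a (u + v) = formalAdjoint a u + formalAdjoint a v := by
  funext x
  simp only [formalAdjoint, Pi.add_apply, ← Finset.sum_add_distrib, mul_add]
  refine Finset.sum_congr rfl fun j _ => ?_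
  have h (w : ℝ → ℂ) (hw : ContDiff ℝ ∞ w) :
      ContDiffAt ℝ (j : ℕ) (fun t => conj (a j t) * w t) x :=
    (((contDiff_conj (ha j)).mul hw).of_le (by exact_mod_cast le_top)).contDiffAt
  rw [← mul_add]
  congr 1
  exact iteratedDeriv_add (h u hu) (h v hv)

lemma formalAdjoint_smul {k : ℕ} (a : Fin (k + 1) → ℝ → ℂ) (c : ℂ) (u : ℝ → ℂ) :
    formalAdjoint a (c • u) = c • formalAdjoint a u := by
  funext x
  simp only [formalAdjoint, Pi.smul_apply, smul_eq_mul, Finset.mul_sum]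
  refine Finset.sum_congr rfl fun j _ => ?_
  rw [show (fun t => conj (a j t) * (c * u t)) = fun t => c * (conj (a j t) * u t) by
    funext t; ring, iteratedDeriv_const_mul_field]
  ring

/-- A compact subset of an order-connected set lies in a closed interval inside that set. -/
lemma exists_Icc_of_isCompact {K I : Set ℝ} (hK : IsCompact K) (hKI : K ⊆ I)
    (hI : I.Nonempty) : ∃ a ∈ I, ∃ b ∈ I, K ⊆ Icc a b := by
  rcases K.eq_empty_or_nonempty with rfl | hne
  · obtain ⟨x, hx⟩ := hI
    exact ⟨x, hx, x, hx, empty_subset _⟩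
  · obtain ⟨a, ha, haK⟩ := hK.exists_isLeast hne
    obtain ⟨b, hb, hbK⟩ := hK.exists_isGreatest hne
    exact ⟨a, hKI ha, b, hKI hb, fun x hx => ⟨haK hx, hbK hx⟩⟩

/-- A test function that equals `1` on a given closed interval. -/
lemma exists_isTest_eq_one (a b : ℝ) :
    ∃ θ : ℝ → ℂ, IsTest θ ∧ ∀ x ∈ Icc a b, θ x = 1 := by
  let B : ContDiffBump (0 : ℝ) := ⟨|a| + |b| + 1, |a| + |b| + 2, by positivity, by linarith⟩
  refine ⟨fun x => (B x : ℂ), IsTest.ofReal B.contDiff B.hasCompactSupport, fun x hx => ?_⟩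
  change (B x : ℂ) = 1
  rw [B.one_of_mem_closedBall, Complex.ofReal_one]
  rw [mem_closedBall_zero_iff, Real.norm_eq_abs]
  change |x| ≤ |a| + |b| + 1
  rw [abs_le]
  constructor <;> linarith [neg_abs_le a, le_abs_self b, abs_nonneg a, abs_nonneg b, hx.1, hx.2]

lemma ae_eq_zero_of_integral_mul_testSpace_eq_zero {I : Set ℝ} (hI : IsOpen I) {g : ℝ → ℂ}
    (hg : LocallyIntegrableOn g I) (h : ∀ f ∈ testSpace I, ∫ x, g x * f x = 0) :
    ∀ᵐ x, x ∈ I → g x = 0 :=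
  hI.ae_eq_zero_of_integral_contDiff_smul_eq_zero hg fun f hf hfc hfI => by
    rw [← h (fun x => (f x : ℂ)) ⟨IsTest.ofReal hf hfc, (tsupport_subset_of_eq_zero
      (v := fun x => (f x : ℂ)) fun x hx => image_eq_zero_of_notMem_tsupport hx).trans
      ((tsupport_comp_subset Complex.ofReal_zero f).trans hfI)⟩]
    congr with x
    rw [Complex.real_smul, mul_comm]

lemma eq_of_ae_eq_on_isOpen {I : Set ℝ} (hI : IsOpen I) {u v : ℝ → ℂ} (hu : Continuous u)
    (hv : Continuous v) (h : ∀ᵐ x, x ∈ I → u x = v x) : EqOn u v I :=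
  Measure.eqOn_open_of_ae_eq ((ae_restrict_iff' hI.measurableSet).2 h) hI hu.continuousOn
    hv.continuousOn

/-- Integration by parts against a test function. -/
lemma integral_iteratedDeriv_mul {g χ : ℝ → ℂ} (hg : ContDiff ℝ ∞ g) (hχ : IsTest χ) (j : ℕ) :
    ∫ x, iteratedDeriv j g x * χ x = (-1) ^ j * ∫ x, g x * iteratedDeriv j χ x := by
  have hstep {g χ : ℝ → ℂ} (hg : ContDiff ℝ ∞ g) (hχ : IsTest χ) :
      ∫ x, deriv g x * χ x = - ∫ x, g x * deriv χ x := by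
    have hg' := contDiff_iteratedDeriv hg 1
    have hχ' := hχ.iteratedDeriv 1
    rw [iteratedDeriv_one] at hg' hχ'
    rw [integral_mul_deriv_eq_deriv_mul_of_integrable (u := g) (u' := deriv g) (v := χ)
      (v' := deriv χ), neg_neg]
    · exact fun x _ => ((hg.differentiable (by simp)) x).hasDerivAt
    · exact fun x _ => ((hχ.1.differentiable (by simp)) x).hasDerivAt
    · exact (hg.continuous.mul hχ'.continuous).integrable_of_hasCompactSupport hχ'.2.mul_left
    · exact (hg'.continuous.mul hχ.continuous).integrable_of_hasCompactSupport hχ.2.mul_left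
    · exact (hg.continuous.mul hχ.continuous).integrable_of_hasCompactSupport hχ.2.mul_left
  induction j generalizing χ with
  | zero => simp
  | succ j ih =>
    have h1 := hstep (contDiff_iteratedDeriv hg j) hχ
    have hχ' := hχ.iteratedDeriv 1
    rw [iteratedDeriv_one] at hχ'
    rw [iteratedDeriv_succ, h1, ih hχ', iteratedDeriv_succ']
    ring

/-- The defining property of the formal adjoint. -/
lemma integral_formalAdjoint_mul_conj {k : ℕ} {a : Fin (k + 1) → ℝ → ℂ}
    (ha : ∀ j, ContDiff ℝ ∞ (a j)) {φ χ : ℝ → ℂ} (hφ : ContDiff ℝ ∞ φ) (hχ : IsTest χ) :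
    ∫ x, formalAdjoint a φ x * conj (χ x) = ∫ x, φ x * conj (diffOp a χ x) := by
  have hs (j : Fin (k + 1)) : ContDiff ℝ ∞ fun t => conj (a j t) * φ t :=
    (contDiff_conj (ha j)).mul hφ
  simp only [formalAdjoint, diffOp, Finset.sum_mul, map_sum, Finset.mul_sum]
  rw [integral_finsetSum, integral_finsetSum]
  · refine Finset.sum_congr rfl fun j _ => ?_
    have h := integral_iteratedDeriv_mul (hs j) hχ.conjugate j
    simp only [mul_assoc]
    rw [integral_const_mul, h, ← mul_assoc, ← mul_pow]
    simp only [neg_mul_neg, one_mul, one_pow, iteratedDeriv_conj, map_mul]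
    congr with x
    ring
  · intro j _
    refine Continuous.integrable_of_hasCompactSupport ?_ ?_
    · exact hφ.continuous.mul (Complex.continuous_conj.comp
        ((ha j).continuous.mul (hχ.iteratedDeriv j).continuous))
    · exact ((hχ.iteratedDeriv j).mul_left (ha j)).conjugate.2.mul_left
  · intro j _
    refine Continuous.integrable_of_hasCompactSupport ?_ hχ.conjugate.2.mul_left
    exact (continuous_const.mul (contDiff_iteratedDeriv (hs j) j).continuous).mul
      hχ.conjugate.continuous

end Basic

/-! ### Scalar equations Qv = h and Q^*φ = f. -/

section ScalarODE

lemma contDiff_div {u v : ℝ → ℂ} (hu : ContDiff ℝ ∞ u) (hv : ContDiff ℝ ∞ v)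
    (hv0 : ∀ x, v x ≠ 0) : ContDiff ℝ ∞ fun x => u x / v x := by
  simp only [div_eq_mul_inv]
  exact hu.mul (hv.inv hv0)

variable {n : ℕ} {q : Fin (n + 1) → ℝ → ℂ}

/-- The companion matrix of the equation `∑ q_j u^{(j)} = 0`. -/
def companion (q : Fin (n + 1) → ℝ → ℂ) (i j : Fin n) (t : ℝ) : ℂ :=
  if (i : ℕ) + 1 < n then (if (j : ℕ) = i + 1 then 1 else 0)
  else -(q j.castSucc t / q (Fin.last n) t)

lemma contDiff_companion (hq : ∀ j, ContDiff ℝ ∞ (q j)) (hq0 : ∀ x, q (Fin.last n) x ≠ 0)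
    (i j : Fin n) : ContDiff ℝ ∞ (companion q i j) := by
  unfold companion
  by_cases h : (i : ℕ) + 1 < n
  · simp only [h, if_true]
    exact contDiff_const
  · simp only [h, if_false]
    exact (contDiff_div (hq _) (hq _) hq0).neg

lemma sum_companion_of_lt {i : Fin n} (hi : (i : ℕ) + 1 < n) (y : Fin n → ℂ) (t : ℝ) :
    ∑ j, companion q i j t * y j = y ⟨i + 1, hi⟩ := by
  rw [Finset.sum_eq_single ⟨i + 1, hi⟩]
  · simp [companion, hi]
  · intro j _ hj
    have : (j : ℕ) ≠ i + 1 := fun h => hj (Fin.ext h)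
    simp [companion, hi, this]
  · simp

lemma sum_companion_of_not_lt {i : Fin n} (hi : ¬(i : ℕ) + 1 < n) (y : Fin n → ℂ) (t : ℝ) :
    ∑ j, companion q i j t * y j = -((∑ j : Fin n, q j.castSucc t * y j) / q (Fin.last n) t) := by
  simp only [companion, hi, if_false, Finset.sum_div, ← Finset.sum_neg_distrib]
  exact Finset.sum_congr rfl fun j _ => by ring

/-- The initial value problem for `∑ q_j v^{(j)} = h`. -/
theorem exists_diffOp_solution (hn : 0 < n) (hq : ∀ j, ContDiff ℝ ∞ (q j))
    (hq0 : ∀ x, q (Fin.last n) x ≠ 0) {h : ℝ → ℂ} (hh : ContDiff ℝ ∞ h) (t₀ : ℝ)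
    (c : Fin n → ℂ) :
    ∃ v : ℝ → ℂ, ContDiff ℝ ∞ v ∧ (∀ x, diffOp q v x = h x) ∧
      ∀ j : Fin n, iteratedDeriv j v t₀ = c j := by
  obtain ⟨y, hy, hy0, hyd⟩ := exists_system_solution (A := companion q)
    (F := fun i t => if (i : ℕ) + 1 < n then 0 else h t / q (Fin.last n) t)
    (contDiff_companion hq hq0) (fun i => by
      by_cases hi : (i : ℕ) + 1 < n
      · simp only [hi, if_true]; exact contDiff_const
      · simp only [hi, if_false]; exact contDiff_div hh (hq _) hq0) t₀ c
  have hit (j : ℕ) (hj : j < n) : iteratedDeriv j (y ⟨0, hn⟩) = y ⟨j, hj⟩ := by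
    induction j with
    | zero => simp
    | succ j ih =>
      rw [iteratedDeriv_succ, ih (by omega)]
      funext t
      rw [hyd, sum_companion_of_lt (i := ⟨j, by omega⟩) hj]
      simp [hj]
  refine ⟨y ⟨0, hn⟩, hy _, fun x => ?_, fun j => by rw [hit j j.2, hy0]⟩
  have hlast : iteratedDeriv n (y ⟨0, hn⟩) x =
      (h x - ∑ j : Fin n, q j.castSucc x * y j x) / q (Fin.last n) x := by
    obtain ⟨k, rfl⟩ : ∃ k, n = k + 1 := ⟨n - 1, by omega⟩
    rw [iteratedDeriv_succ, hit k (by omega), hyd, sum_companion_of_not_lt (by simp)]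
    simp
    ring
  simp only [diffOp, Fin.sum_univ_castSucc, Fin.val_castSucc, Fin.val_last, hlast]
  rw [mul_div_cancel₀ _ (hq0 x), Finset.sum_congr rfl fun (j : Fin n) _ => by rw [hit j j.2]]
  simp

/-- Uniqueness for the initial value problem of `∑ q_j v^{(j)} = 0`. -/
theorem diffOp_solution_eq_zero (hq : ∀ j, ContDiff ℝ ∞ (q j))
    (hq0 : ∀ x, q (Fin.last n) x ≠ 0) (hn : 0 < n) {v : ℝ → ℂ} (hv : ContDiff ℝ ∞ v) {a b t₀ : ℝ}
    (ht₀ : t₀ ∈ Ioo a b) (hv0 : ∀ j : Fin n, iteratedDeriv j v t₀ = 0)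
    (hqv : ∀ x ∈ Ioo a b, diffOp q v x = 0) : ∀ x ∈ Ioo a b, v x = 0 := by
  have := system_solution_eq_zero (A := companion q) (y := fun i => iteratedDeriv i v)
    (fun i j => (contDiff_companion hq hq0 i j).continuous) ht₀ hv0
    (fun i => (contDiff_iteratedDeriv hv i).differentiable (by simp)) (fun i t ht => by
      rw [← iteratedDeriv_succ]
      by_cases hi : (i : ℕ) + 1 < n
      · rw [sum_companion_of_lt hi (fun j => iteratedDeriv j v t)]
      · rw [sum_companion_of_not_lt hi (fun j => iteratedDeriv j v t)]
        have h := hqv t ht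
        simp only [diffOp, Fin.sum_univ_castSucc, Fin.val_castSucc, Fin.val_last] at h
        rw [show (i : ℕ) + 1 = n by omega, eq_comm, neg_eq_iff_eq_neg, div_eq_iff (hq0 t)]
        linear_combination h)
  simpa using this ⟨0, hn⟩

/-- The equation `Q^* φ = f` has a solution that vanishes to the left of the support of `f`. -/
theorem exists_formalAdjoint_solution (hn : 0 < n) (hq : ∀ j, ContDiff ℝ ∞ (q j))
    (hq0 : ∀ x, q (Fin.last n) x ≠ 0) {f : ℝ → ℂ} (hf : ContDiff ℝ ∞ f) {a : ℝ}
    (hfa : ∀ x < a, f x = 0) :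
    ∃ φ : ℝ → ℂ, ContDiff ℝ ∞ φ ∧ formalAdjoint q φ = f ∧ ∀ x < a, φ x = 0 := by
  let last : Fin n := ⟨n - 1, by omega⟩
  -- The adjoint equation becomes a first-order system without expanding any product: put z_0 = f,
  -- z_n = conj(q_n) φ, and require conj(q_i) φ = z_i + z_{i+1}' for i < n. The unknown y_i is
  -- z_{i+1}.
  let A (i j : Fin n) (t : ℝ) : ℂ :=
    (if j = last then conj (q i.castSucc t) / conj (q (Fin.last n) t) else 0) -
      if (j : ℕ) + 1 = i then 1 else 0
  have hc0 (x) : conj (q (Fin.last n) x) ≠ 0 := (map_ne_zero _).2 (hq0 x)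
  have hA (i j) : ContDiff ℝ ∞ (A i j) := by
    refine ContDiff.sub ?_ contDiff_const
    by_cases h : j = last
    · simp only [h, if_true]; exact contDiff_div (contDiff_conj (hq _)) (contDiff_conj (hq _)) hc0
    · simp only [h, if_false]; exact contDiff_const
  obtain ⟨y, hy, hy0, hyd⟩ := exists_system_solution (A := A)
    (F := fun i t => if (i : ℕ) = 0 then -f t else 0) hA (fun i => by
      by_cases hi : (i : ℕ) = 0
      · simp only [hi, if_true]; exact hf.neg
      · simp only [hi, if_false]; exact contDiff_const) (a - 1) 0
  have hya : ∀ i, ∀ x < a, y i x = 0 := fun i x hx =>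
    system_solution_eq_zero (a := min x (a - 1) - 1) (b := a) (fun i j => (hA i j).continuous)
      (by constructor <;> linarith [min_le_right x (a - 1)]) hy0
      (fun i => (hy i).differentiable (by simp))
      (fun i t ht => by rw [hyd]; simp [hfa t ht.2]) i x
      (by constructor <;> linarith [min_le_left x (a - 1)])
  let φ : ℝ → ℂ := fun t => y last t / conj (q (Fin.last n) t)
  have hφ : ContDiff ℝ ∞ φ := contDiff_div (hy _) (contDiff_conj (hq _)) hc0
  -- The default branch is there for k = 0, where the value f closes the recursion; indices above n
  -- play no role.
  let z (k : ℕ) : ℝ → ℂ := if h : 0 < k ∧ k ≤ n then y ⟨k - 1, by omega⟩ else f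
  have hz (k : ℕ) : ContDiff ℝ ∞ (z k) := by
    by_cases h : 0 < k ∧ k ≤ n
    · simp only [z, h]; exact hy _
    · simp only [z, h]; exact hf
  have hzs (k : ℕ) (hk : k < n) : z (k + 1) = y ⟨k, hk⟩ := by
    have : 0 < k + 1 ∧ k + 1 ≤ n := by omega
    simp [z, hk]
  have hrel (i : Fin n) :
      (fun t => conj (q i.castSucc t) * φ t) = z i + deriv (z (i + 1)) := by
    funext t
    have hsum : ∑ j, A i j t * y j t = conj (q i.castSucc t) * φ t -
        if (i : ℕ) = 0 then 0 else z i t := by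
      simp only [A, sub_mul, Finset.sum_sub_distrib, ite_mul, zero_mul, one_mul,
        Finset.sum_ite_eq', Finset.mem_univ, if_true, φ]
      congr 1
      · ring
      · obtain ⟨i, hi⟩ := i
        cases i with
        | zero => simp
        | succ i =>
          rw [Finset.sum_eq_single ⟨i, by omega⟩]
          · simp [hzs i (by omega)]
          · intro j _ hj
            have : (j : ℕ) ≠ i := fun h => hj (Fin.ext h)
            simp [this]
          · simp
    rw [Pi.add_apply, hzs i i.2, hyd, hsum]
    by_cases hi : (i : ℕ) = 0
    · simp [hi, z]
    · simp [hi]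
  have hrel' : (fun t => conj (q (Fin.last n) t) * φ t) = z n := by
    funext t
    obtain ⟨k, rfl⟩ : ∃ k, n = k + 1 := ⟨n - 1, by omega⟩
    rw [hzs k (by omega)]
    simp only [φ, last]
    rw [mul_div_cancel₀ _ (hc0 t)]
    simp
  refine ⟨φ, hφ, ?_, fun x hx => by simp [φ, hya _ x hx]⟩
  funext x
  simp only [formalAdjoint, Fin.sum_univ_castSucc, Fin.val_castSucc, Fin.val_last, hrel, hrel']
  -- Each term of Q^*φ with i < n is T i - T (i + 1) and the top one is T n, so the sum telescopes
  -- to T 0 = f.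
  let T (k : ℕ) : ℂ := (-1) ^ k * iteratedDeriv k (z k) x
  have hT (i : Fin n) : (-1 : ℂ) ^ (i : ℕ) * iteratedDeriv i (z i + deriv (z (i + 1))) x =
      T i - T (i + 1) := by
    have h1 := hz (i + 1)
    have h2 : ContDiff ℝ ∞ (deriv (z (i + 1))) := by
      simpa using contDiff_iteratedDeriv h1 1
    rw [iteratedDeriv_add ((hz i).of_le (by exact_mod_cast le_top)).contDiffAt
      (h2.of_le (by exact_mod_cast le_top)).contDiffAt, ← iteratedDeriv_succ']
    simp only [T]
    ring
  rw [Finset.sum_congr rfl fun i _ => hT i, Fin.sum_univ_eq_sum_range (fun i => T i - T (i + 1)),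
    Finset.sum_range_sub']
  simp [T, z]

/-- Integrability over the empty set is vacuous, so `l2Solutions q ∅` serves as the space of all
smooth solutions on ℝ. -/
lemma mem_l2Solutions_empty {u : ℝ → ℂ} :
    u ∈ l2Solutions q ∅ ↔ ContDiff ℝ ∞ u ∧ ∀ x, diffOp q u x = 0 :=
  ⟨fun h => ⟨h.1, h.2.1⟩, fun h => ⟨h.1, h.2, by simp⟩⟩

/-- The Cauchy data at `t₀` of the smooth solutions of `Qu = 0`. -/
def cauchyData (q : Fin (n + 1) → ℝ → ℂ) (t₀ : ℝ) : l2Solutions q ∅ →ₗ[ℂ] (Fin n → ℂ) where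
  toFun u j := iteratedDeriv j (u : ℝ → ℂ) t₀
  map_add' u v := by
    funext j
    exact iteratedDeriv_add ((u.2.1.of_le (by exact_mod_cast le_top)).contDiffAt)
      ((v.2.1.of_le (by exact_mod_cast le_top)).contDiffAt)
  map_smul' c u := by
    funext j
    exact iteratedDeriv_const_smul ((u.2.1.of_le (by exact_mod_cast le_top)).contDiffAt) c

theorem cauchyData_bijective (hn : 0 < n) (hq : ∀ j, ContDiff ℝ ∞ (q j))
    (hq0 : ∀ x, q (Fin.last n) x ≠ 0) (t₀ : ℝ) : Function.Bijective (cauchyData q t₀) := by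
  constructor
  · rw [injective_iff_map_eq_zero]
    intro u hu
    ext x
    exact diffOp_solution_eq_zero hq hq0 hn u.2.1 (a := min x t₀ - 1) (b := max x t₀ + 1)
      (by constructor <;> linarith [min_le_right x t₀, le_max_right x t₀]) (fun j => congrFun hu j)
      (fun t _ => u.2.2.1 t) x
      (by constructor <;> linarith [min_le_left x t₀, le_max_left x t₀])
  · intro c
    obtain ⟨v, hv, hqv, hvc⟩ := exists_diffOp_solution hn hq hq0 (h := fun _ => 0) contDiff_const
      t₀ c
    exact ⟨⟨v, mem_l2Solutions_empty.2 ⟨hv, hqv⟩⟩, funext hvc⟩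

/-- The Cauchy data as a linear equivalence. -/
def cauchyEquiv (hn : 0 < n) (hq : ∀ j, ContDiff ℝ ∞ (q j))
    (hq0 : ∀ x, q (Fin.last n) x ≠ 0) (t₀ : ℝ) : l2Solutions q ∅ ≃ₗ[ℂ] (Fin n → ℂ) :=
  LinearEquiv.ofBijective _ (cauchyData_bijective hn hq hq0 t₀)

lemma finiteDimensional_solutions (hn : 0 < n) (hq : ∀ j, ContDiff ℝ ∞ (q j))
    (hq0 : ∀ x, q (Fin.last n) x ≠ 0) : FiniteDimensional ℂ (l2Solutions q ∅) :=
  (cauchyEquiv hn hq hq0 0).symm.finiteDimensional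

lemma finrank_solutions (hn : 0 < n) (hq : ∀ j, ContDiff ℝ ∞ (q j))
    (hq0 : ∀ x, q (Fin.last n) x ≠ 0) : Module.finrank ℂ (l2Solutions q ∅) = n := by
  rw [(cauchyEquiv hn hq hq0 0).finrank_eq]
  simp

/-- A solution that vanishes on an interval vanishes identically. -/
lemma solution_eq_zero_of_eqOn_Ioo (hn : 0 < n) (hq : ∀ j, ContDiff ℝ ∞ (q j))
    (hq0 : ∀ x, q (Fin.last n) x ≠ 0) {u : ℝ → ℂ} (hu : u ∈ l2Solutions q ∅) {a b : ℝ}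
    (hab : a < b) (h : ∀ x ∈ Ioo a b, u x = 0) : u = 0 := by
  have hm : (a + b) / 2 ∈ Ioo a b := by constructor <;> linarith
  have : cauchyData q ((a + b) / 2) ⟨u, hu⟩ = 0 := by
    funext j
    change iteratedDeriv j u ((a + b) / 2) = 0
    rw [iteratedDeriv_of_eqOn_isOpen isOpen_Ioo (v := fun _ => 0) h j hm]
    simp
  have := (cauchyData_bijective hn hq hq0 _).1 (this.trans (map_zero _).symm)
  exact congrArg Subtype.val this

/-- Solvability of `Q^* φ = f` in test functions: `f` has to be orthogonal to the solutions of
`Qu = 0`. -/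
theorem exists_testSpace_formalAdjoint_eq (hn : 0 < n) (hq : ∀ j, ContDiff ℝ ∞ (q j))
    (hq0 : ∀ x, q (Fin.last n) x ≠ 0) {I : Set ℝ} (hI : I.OrdConnected) (hIne : I.Nonempty)
    {f : ℝ → ℂ} (hf : f ∈ testSpace I)
    (hfS : ∀ u ∈ l2Solutions q ∅, ∫ x, f x * conj (u x) = 0) :
    ∃ φ ∈ testSpace I, formalAdjoint q φ = f := by
  obtain ⟨a, haI, b, hbI, hab⟩ := exists_Icc_of_isCompact hf.1.2 hf.2 hIne
  have hf0 (x) (hx : x ∉ Icc a b) : f x = 0 :=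
    image_eq_zero_of_notMem_tsupport fun h => hx (hab h)
  obtain ⟨φ, hφ, hqφ, hφa⟩ := exists_formalAdjoint_solution hn hq hq0 hf.1.1
    fun x (hx : x < a) => hf0 x fun h => hx.not_ge h.1
  -- Vanishing to the right of b is where the orthogonality is used. Given h supported in (b,∞),
  -- solve Qv = h with v = 0 to the right of supp h. To the left of supp h, in particular on supp f,
  -- v coincides with a global solution u. Then (φ, h) = (φ, Qv) = (Q^*φ, v) = (f, u) = 0.
  have hφb : ∀ x ∈ Ioi b, φ x = 0 := by
    refine eq_of_ae_eq_on_isOpen isOpen_Ioi hφ.continuous continuous_const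
      (ae_eq_zero_of_integral_mul_testSpace_eq_zero isOpen_Ioi
        (hφ.continuous.locallyIntegrable.locallyIntegrableOn _) fun h' hh' => ?_)
    have hh := conj_mem_testSpace hh'
    set h : ℝ → ℂ := fun x => conj (h' x) with hdef
    obtain ⟨b', hb', c, -, hbc⟩ := exists_Icc_of_isCompact hh.1.2 hh.2 nonempty_Ioi
    have hh0 (x) (hx : x ∉ Icc b' c) : h x = 0 :=
      image_eq_zero_of_notMem_tsupport fun h => hx (hbc h)
    obtain ⟨v, hv, hqv, hvc⟩ := exists_diffOp_solution hn hq hq0 hh.1.1 (c + 1) 0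
    have hv0 (x) (hx : c < x) : v x = 0 :=
      diffOp_solution_eq_zero hq hq0 hn hv (a := c) (b := max x (c + 1) + 1) (t₀ := c + 1)
        (by constructor <;> linarith [le_max_right x (c + 1)]) hvc
        (fun t ht => by rw [hqv, hh0 t fun h => ht.1.not_ge h.2]) x
        ⟨hx, by linarith [le_max_left x (c + 1)]⟩
    obtain ⟨u, hu⟩ := (cauchyData_bijective hn hq hq0 (b' - 1)).2
      fun j => iteratedDeriv j v (b' - 1)
    have huv (x) (hx : x < b') : u.1 x = v x := by
      have hd (t : ℝ) (j : ℕ) : iteratedDeriv j (u.1 - v) t =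
          iteratedDeriv j u.1 t - iteratedDeriv j v t :=
        iteratedDeriv_sub ((u.2.1.of_le (by exact_mod_cast le_top)).contDiffAt)
          ((hv.of_le (by exact_mod_cast le_top)).contDiffAt)
      refine sub_eq_zero.1 (diffOp_solution_eq_zero hq hq0 hn (v := u.1 - v) (u.2.1.sub hv)
        (a := min x (b' - 1) - 1) (b := b') (t₀ := b' - 1)
        (by constructor <;> linarith [min_le_right x (b' - 1)]) (fun j => ?_) (fun t ht => ?_) x
        ⟨by linarith [min_le_left x (b' - 1)], hx⟩)
      · rw [hd, ← congrFun hu j]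
        exact sub_self _
      · have h1 : diffOp q (u.1 - v) t = diffOp q u.1 t - diffOp q v t := by
          simp only [diffOp, hd, mul_sub, Finset.sum_sub_distrib]
        rw [h1, u.2.2.1, hqv, hh0 t fun h => ht.2.not_ge h.1, sub_zero]
    -- On the left v need not vanish, but φ does; the cutoff makes v a test function and leaves it
    -- unchanged on (a - 1, ∞).
    obtain ⟨θ, hθ, hθ1⟩ := exists_isTest_eq_one (a - 1) (c + 1)
    have hθv : EqOn (fun x => θ x * v x) v (Ioi (a - 1)) := by
      intro x hx
      rcases le_or_gt x (c + 1) with h | h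
      · simp [hθ1 x ⟨le_of_lt hx, h⟩]
      · simp [hv0 x (by linarith)]
    calc ∫ x, φ x * h' x = ∫ x, φ x * conj (diffOp q (fun x => θ x * v x) x) := by
          congr with x
          rcases lt_or_ge x a with hx | hx
          · simp [hφa x hx]
          · rw [diffOp_congr_of_eqOn q isOpen_Ioi hθv (by simp; linarith), hqv, hdef,
              Complex.conj_conj]
      _ = ∫ x, formalAdjoint q φ x * conj (θ x * v x) :=
          (integral_formalAdjoint_mul_conj hq hφ (hθ.mul_right hv)).symm
      _ = ∫ x, f x * conj (u.1 x) := by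
          congr with x
          rw [hqφ]
          by_cases hx : x ∈ Icc a b
          · have := hθv (show x ∈ Ioi (a - 1) by simp; linarith [hx.1])
            simp only at this
            rw [this, huv x (hx.2.trans_lt hb')]
          · simp [hf0 x hx]
      _ = 0 := hfS u.1 u.2
  have hsub : tsupport φ ⊆ Icc a b :=
    closure_minimal (fun x hx => ⟨not_lt.1 fun h => hx (hφa x h), not_lt.1 fun h => hx (hφb x h)⟩)
      isClosed_Icc
  exact ⟨φ, ⟨⟨hφ, isCompact_Icc.of_isClosed_subset (isClosed_tsupport φ) hsub⟩,
    hsub.trans (hI.out haI hbI)⟩, hqφ⟩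

end ScalarODE

/-! ### Annihilators of solution spaces and regularity of weak solutions. -/

section Annihilator

lemma LocallyIntegrable.integrable_mul_isTest {g φ : ℝ → ℂ} (hg : LocallyIntegrable g)
    (hφ : IsTest φ) : Integrable fun x => g x * φ x := by
  have := hg.integrable_smul_left_of_hasCompactSupport hφ.continuous hφ.2
  simpa [mul_comm] using this

/-- If every test function in `I` that annihilates the finite-dimensional space `W` also
annihilates `g`, then `g` agrees on `I` with an element of `W`. -/
theorem exists_mem_ae_eq_of_annihilator {W : Submodule ℂ (ℝ → ℂ)} [FiniteDimensional ℂ W]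
    (hW : ∀ u ∈ W, Continuous u) {g : ℝ → ℂ} (hg : LocallyIntegrable g) {I : Set ℝ}
    (hI : IsOpen I)
    (h : ∀ f ∈ testSpace I, (∀ u ∈ W, ∫ x, u x * f x = 0) → ∫ x, g x * f x = 0) :
    ∃ u ∈ W, ∀ᵐ x, x ∈ I → g x = u x := by
  let ℓ (g : ℝ → ℂ) (hg : LocallyIntegrable g) : testSpace I →ₗ[ℂ] ℂ :=
    { toFun := fun f => ∫ x, g x * (f : ℝ → ℂ) x
      map_add' := fun f f' => by
        rw [← integral_add (LocallyIntegrable.integrable_mul_isTest hg f.2.1)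
          (LocallyIntegrable.integrable_mul_isTest hg f'.2.1)]
        simp [mul_add]
      map_smul' := fun c f => by
        rw [RingHom.id_apply, smul_eq_mul, ← integral_const_mul]
        simp [mul_left_comm] }
  let B := Module.finBasis ℂ W
  have hli (u : W) : LocallyIntegrable (u : ℝ → ℂ) := (hW u u.2).locallyIntegrable
  -- A functional that vanishes on the common kernel of finitely many functionals is a linear
  -- combination of them; here these are given by a basis of W.
  have hmem : ℓ g hg ∈ Submodule.span ℂ (range fun i => ℓ (B i : ℝ → ℂ) (hli (B i))) := by
    refine mem_span_of_iInf_ker_le_ker fun f hf => ?_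
    simp only [Submodule.mem_iInf, LinearMap.mem_ker] at hf ⊢
    refine h f f.2 fun u hu => ?_
    have hrep := B.sum_repr ⟨u, hu⟩
    have hu' : u = ∑ i, B.repr ⟨u, hu⟩ i • (B i : ℝ → ℂ) := by
      have := congrArg W.subtype hrep
      rw [map_sum] at this
      exact this.symm
    rw [hu']
    simp only [Finset.sum_apply, Pi.smul_apply, smul_eq_mul, Finset.sum_mul, mul_assoc]
    rw [integral_finsetSum _ fun i _ =>
      (LocallyIntegrable.integrable_mul_isTest (hli (B i)) f.2.1).const_mul _]
    refine Finset.sum_eq_zero fun i _ => ?_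
    rw [integral_const_mul]
    exact mul_eq_zero_of_right _ (hf i)
  obtain ⟨c, hc⟩ := (Submodule.mem_span_range_iff_exists_fun ℂ).1 hmem
  refine ⟨∑ i, c i • (B i : ℝ → ℂ), Submodule.sum_mem _ fun i _ => W.smul_mem _ (B i).2, ?_⟩
  set u : ℝ → ℂ := ∑ i, c i • (B i : ℝ → ℂ) with hu
  have huc : LocallyIntegrable u :=
    (hW u (Submodule.sum_mem _ fun i _ => W.smul_mem _ (B i).2)).locallyIntegrable
  have h0 := ae_eq_zero_of_integral_mul_testSpace_eq_zero hI (g := g - u)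
    ((hg.sub huc).locallyIntegrableOn _) fun f hf => ?_
  · filter_upwards [h0] with x hx hxI
    exact sub_eq_zero.1 (hx hxI)
  · simp only [Pi.sub_apply, sub_mul]
    rw [integral_sub (LocallyIntegrable.integrable_mul_isTest hg hf.1)
      (LocallyIntegrable.integrable_mul_isTest huc hf.1), sub_eq_zero]
    have := LinearMap.congr_fun hc ⟨f, hf⟩
    simp only [LinearMap.sum_apply, LinearMap.smul_apply, smul_eq_mul] at this
    change _ = ∫ x, g x * f x at this
    rw [← this, hu]
    simp only [Finset.sum_apply, Pi.smul_apply, smul_eq_mul, Finset.sum_mul, mul_assoc]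
    rw [integral_finsetSum _ fun i _ =>
      (LocallyIntegrable.integrable_mul_isTest (hli (B i)) hf.1).const_mul _]
    exact Finset.sum_congr rfl fun i _ => (integral_const_mul _ _).symm

/-- Weak solutions of `Qu = 0` on an interval are restrictions of smooth solutions on `ℝ`. -/
theorem exists_solution_ae_eq {n : ℕ} {q : Fin (n + 1) → ℝ → ℂ} (hn : 0 < n)
    (hq : ∀ j, ContDiff ℝ ∞ (q j)) (hq0 : ∀ x, q (Fin.last n) x ≠ 0) {I : Set ℝ} (hIo : IsOpen I)
    (hI : I.OrdConnected) (hIne : I.Nonempty) {g : ℝ → ℂ} (hg : LocallyIntegrable g)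
    (h : ∀ φ ∈ testSpace I, ∫ x, g x * conj (formalAdjoint q φ x) = 0) :
    ∃ u ∈ l2Solutions q ∅, ∀ᵐ x, x ∈ I → g x = u x := by
  have := finiteDimensional_solutions hn hq hq0
  -- A test function that annihilates all solutions is the conjugate of some Q^*φ with φ supported
  -- in I, so it annihilates g by hypothesis.
  refine exists_mem_ae_eq_of_annihilator (fun u hu =>
    (mem_l2Solutions_empty.1 hu).1.continuous) hg hIo fun f hf hfS => ?_
  obtain ⟨φ, hφ, hqφ⟩ := exists_testSpace_formalAdjoint_eq hn hq hq0 hI hIne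
    (conj_mem_testSpace hf) fun u hu => by
      have := congrArg conj (hfS u hu)
      rw [← integral_conj, map_zero] at this
      simpa [mul_comm] using this
  have := h φ hφ
  simpa [hqφ] using this

end Annihilator

/-! ### The weights (1 + (2πξ)²)^{s/2}. -/

section Weight

/-- The Hilbert space `L²(ℝ)`. -/
abbrev L2Line : Type := Lp ℂ 2 (volume : Measure ℝ)

/-- The weight `(1 + (2πξ)²)^{s/2}`. -/
def weight (s ξ : ℝ) : ℝ := (1 + (2 * Real.pi * ξ) ^ 2) ^ (s / 2)

lemma weight_pos (s ξ : ℝ) : 0 < weight s ξ := Real.rpow_pos_of_pos (by positivity) _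

lemma weight_mul (s t ξ : ℝ) : weight s ξ * weight t ξ = weight (s + t) ξ := by
  rw [weight, weight, weight, ← Real.rpow_add (by positivity), add_div]

lemma weight_sq (s ξ : ℝ) : weight s ξ ^ 2 = (1 + (2 * Real.pi * ξ) ^ 2) ^ s := by
  rw [weight, ← Real.rpow_natCast, ← Real.rpow_mul (by positivity)]
  norm_num

lemma weight_zero (ξ : ℝ) : weight 0 ξ = 1 := by simp [weight]

lemma weight_neg_mul_self (s ξ : ℝ) : weight (-s) ξ * weight s ξ = 1 := by
  rw [weight_mul, neg_add_cancel, weight_zero]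

lemma abs_pow_le_weight (j : ℕ) (ξ : ℝ) : |2 * Real.pi * ξ| ^ j ≤ weight j ξ := by
  have h : weight j ξ = (1 + (2 * Real.pi * ξ) ^ 2).sqrt ^ j := by
    rw [weight, Real.sqrt_eq_rpow, ← Real.rpow_mul_natCast (by positivity)]
    congr 1
    ring
  rw [h]
  refine pow_le_pow_left₀ (abs_nonneg _) ?_ j
  rw [← Real.sqrt_sq_eq_abs]
  exact Real.sqrt_le_sqrt (by linarith)

lemma weight_mono {s t : ℝ} (h : s ≤ t) (ξ : ℝ) : weight s ξ ≤ weight t ξ :=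
  Real.rpow_le_rpow_of_exponent_le (by nlinarith [sq_nonneg (2 * Real.pi * ξ)]) (by linarith)

lemma continuous_weight (s : ℝ) : Continuous (weight s) :=
  Continuous.rpow_const (by fun_prop) fun x => Or.inl (by positivity)

lemma hasTemperateGrowth_weight (s : ℝ) :
    (fun ξ => (weight s ξ : ℂ)).HasTemperateGrowth := by
  have h1 := (Function.hasTemperateGrowth_one_add_norm_sq_rpow ℝ (s / 2)).comp
    ((2 * Real.pi) • ContinuousLinearMap.id ℝ ℝ).hasTemperateGrowth
  have h2 := Function.Complex.hasTemperateGrowth_ofReal.comp h1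
  have h3 : (fun ξ : ℝ => (weight s ξ : ℂ)) = Complex.ofReal ∘ (fun x : ℝ => (1 + ‖x‖ ^ 2) ^ (s / 2)) ∘
      ⇑((2 * Real.pi) • ContinuousLinearMap.id ℝ ℝ) := by
    funext ξ
    simp [weight]
  rw [h3]
  exact h2

end Weight

/-! ### Test functions in H^s(ℝ), modelled in L² by the weighted Fourier transform. -/

section BesselTest

/-- The Schwartz function given by a test function. -/
def testSchwartz (φ : testSpace univ) : SchwartzMap ℝ ℂ := φ.2.1.2.toSchwartzMap φ.2.1.1

lemma testSchwartz_apply (φ : testSpace univ) (x : ℝ) :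
    testSchwartz φ x = (φ : ℝ → ℂ) x := rfl

/-- The class in `L²(ℝ)` of a test function. -/
def testL2 : testSpace univ →ₗ[ℂ] L2Line where
  toFun φ := (testSchwartz φ).toLp 2
  map_add' φ ψ := map_add (SchwartzMap.toLpCLM ℂ ℂ 2 volume) (testSchwartz φ) (testSchwartz ψ)
  map_smul' c φ := map_smul (SchwartzMap.toLpCLM ℂ ℂ 2 volume) c (testSchwartz φ)

lemma coeFn_testL2 (φ : testSpace univ) : testL2 φ =ᵐ[volume] (φ : ℝ → ℂ) :=
  (testSchwartz φ).coeFn_toLp 2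

/-- The Schwartz function `(1 + (2πξ)²)^{s/2} φ̂`. -/
def besselSchwartz (s : ℝ) (φ : testSpace univ) : SchwartzMap ℝ ℂ :=
  SchwartzMap.smulLeftCLM ℂ (fun ξ : ℝ => (weight s ξ : ℂ)) (𝓕 (testSchwartz φ))

/-- The map `φ ↦ (1 + (2πξ)²)^{s/2} φ̂`, an isometry for the norm of `H^s(ℝ)`. -/
def besselTest (s : ℝ) : testSpace univ →ₗ[ℂ] L2Line where
  toFun φ := (besselSchwartz s φ).toLp 2
  map_add' φ ψ := by
    rw [besselSchwartz, show testSchwartz (φ + ψ) = testSchwartz φ + testSchwartz ψ from rfl,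
      FourierTransform.fourier_add, map_add]
    exact map_add (SchwartzMap.toLpCLM ℂ ℂ 2 volume) _ _
  map_smul' c φ := by
    rw [besselSchwartz, show testSchwartz (c • φ) = c • testSchwartz φ from rfl,
      FourierTransform.fourier_smul, map_smul]
    exact map_smul (SchwartzMap.toLpCLM ℂ ℂ 2 volume) c _

lemma coeFn_besselTest (s : ℝ) (φ : testSpace univ) :
    besselTest s φ =ᵐ[volume] fun ξ => (weight s ξ : ℂ) * 𝓕 (φ : ℝ → ℂ) ξ := by
  refine ((besselSchwartz s φ).coeFn_toLp 2).trans (Eventually.of_forall fun ξ => ?_)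
  rw [besselSchwartz, SchwartzMap.smulLeftCLM_apply_apply (hasTemperateGrowth_weight s), smul_eq_mul]
  rfl

lemma besselTest_zero (φ : testSpace univ) : besselTest 0 φ = 𝓕 (testL2 φ) := by
  rw [show testL2 φ = (testSchwartz φ).toLp 2 from rfl, SchwartzMap.toLp_fourier_eq]
  refine Lp.ext ((coeFn_besselTest 0 φ).trans ?_)
  filter_upwards [(𝓕 (testSchwartz φ)).coeFn_toLp 2] with ξ hξ
  rw [hξ, weight_zero, Complex.ofReal_one, one_mul]
  rfl

lemma norm_L2_eq_sqrt {μ : Measure ℝ} (f : Lp ℂ 2 μ) : ‖f‖ = Real.sqrt (∫ x, ‖f x‖ ^ 2 ∂μ) := by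
  have h := L2.inner_def (𝕜 := ℂ) f f
  rw [inner_self_eq_norm_sq_to_K] at h
  have h2 : (∫ x, inner ℂ (f x) (f x) ∂μ) = ((∫ x, ‖f x‖ ^ 2 ∂μ : ℝ) : ℂ) := by
    rw [← integral_complex_ofReal]
    congr with x
    rw [inner_self_eq_norm_sq_to_K]
    simp
  rw [h2] at h
  have h3 : ‖f‖ ^ 2 = ∫ x, ‖f x‖ ^ 2 ∂μ := Complex.ofReal_injective (by
    rw [← h, Complex.ofReal_pow]
    rfl)
  rw [← h3, Real.sqrt_sq (norm_nonneg _)]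

lemma norm_besselTest (s : ℝ) (φ : testSpace univ) : ‖besselTest s φ‖ = sobolevNorm s φ := by
  rw [norm_L2_eq_sqrt, sobolevNorm]
  congr 1
  refine integral_congr_ae ?_
  filter_upwards [coeFn_besselTest s φ] with ξ hξ
  rw [hξ, norm_mul, mul_pow, Complex.norm_real, Real.norm_of_nonneg (weight_pos _ _).le, weight_sq]

/-- `inner ℂ` is antilinear in its first argument and (u, v) in its second; this accounts for the
reversed order here and below. -/
lemma integral_mul_conj_eq_inner (u : L2Line) (ψ : testSpace univ) :
    ∫ x, u x * conj ((ψ : ℝ → ℂ) x) = inner ℂ (testL2 ψ) u := by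
  rw [L2.inner_def]
  refine integral_congr_ae ?_
  filter_upwards [coeFn_testL2 ψ] with x hx
  rw [hx, RCLike.inner_apply]

lemma pairing_eq_inner (φ ψ : testSpace univ) :
    pairing φ ψ = inner ℂ (testL2 ψ) (testL2 φ) := by
  rw [← integral_mul_conj_eq_inner, pairing]
  refine integral_congr_ae ?_
  filter_upwards [coeFn_testL2 φ] with x hx
  rw [hx]

/-- The duality of `H^s(ℝ)` and `H^{-s}(ℝ)`. -/
lemma inner_besselTest_neg (s : ℝ) (φ ψ : testSpace univ) :
    inner ℂ (besselTest (-s) ψ) (besselTest s φ) = inner ℂ (testL2 ψ) (testL2 φ) := by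
  rw [← Lp.inner_fourier_eq (testL2 ψ), ← besselTest_zero, ← besselTest_zero, L2.inner_def, L2.inner_def]
  refine integral_congr_ae ?_
  filter_upwards [coeFn_besselTest s φ, coeFn_besselTest (-s) ψ, coeFn_besselTest 0 φ,
    coeFn_besselTest 0 ψ] with ξ h1 h2 h3 h4
  rw [h1, h2, h3, h4]
  simp only [RCLike.inner_apply, map_mul, Complex.conj_ofReal, weight_zero, Complex.ofReal_one,
    one_mul]
  have : ((weight (-s) ξ : ℝ) : ℂ) * weight s ξ = 1 := by
    rw [← Complex.ofReal_mul, weight_neg_mul_self, Complex.ofReal_one]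
  linear_combination (𝓕 (φ : ℝ → ℂ) ξ * conj (𝓕 (ψ : ℝ → ℂ) ξ)) * this

lemma norm_besselTest_mono {s t : ℝ} (h : s ≤ t) (φ : testSpace univ) :
    ‖besselTest s φ‖ ≤ ‖besselTest t φ‖ := by
  refine Lp.norm_le_norm_of_ae_le ?_
  filter_upwards [coeFn_besselTest s φ, coeFn_besselTest t φ] with ξ h1 h2
  rw [h1, h2, norm_mul, norm_mul, Complex.norm_real, Complex.norm_real,
    Real.norm_of_nonneg (weight_pos _ _).le, Real.norm_of_nonneg (weight_pos _ _).le]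
  exact mul_le_mul_of_nonneg_right (weight_mono h ξ) (norm_nonneg _)

lemma norm_testL2_le {s : ℝ} (hs : 0 ≤ s) (φ : testSpace univ) :
    ‖testL2 φ‖ ≤ ‖besselTest s φ‖ := by
  rw [← Lp.norm_fourier_eq, ← besselTest_zero]
  exact norm_besselTest_mono hs φ

/-- The `j`-th derivative of a test function. -/
def testDeriv (j : ℕ) (φ : testSpace univ) : testSpace univ :=
  ⟨iteratedDeriv j φ, φ.2.1.iteratedDeriv j, subset_univ _⟩

lemma coeFn_besselTest_testDeriv (s : ℝ) (j : ℕ) (φ : testSpace univ) :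
    besselTest s (testDeriv j φ) =ᵐ[volume]
      fun ξ => (weight s ξ : ℂ) * ((2 * Real.pi * Complex.I * ξ) ^ j * 𝓕 (φ : ℝ → ℂ) ξ) := by
  refine (coeFn_besselTest s _).trans (Eventually.of_forall fun ξ => ?_)
  have h := Real.fourier_iteratedDeriv (f := (φ : ℝ → ℂ)) (N := (⊤ : ℕ∞)) (n := j)
    (by exact_mod_cast φ.2.1.1) (fun k _ => (φ.2.1.iteratedDeriv k).continuous.integrable_of_hasCompactSupport
      (φ.2.1.iteratedDeriv k).2) le_top
  change (weight s ξ : ℂ) * 𝓕 (iteratedDeriv j (φ : ℝ → ℂ)) ξ = _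
  simp only [h, smul_eq_mul]

/-- `L¹` is continuously embedded in `H^{-k}(ℝ)` for `k ≥ 1`. -/
lemma exists_norm_besselTest_neg_le_integral {k : ℕ} (hk : 1 ≤ k) :
    ∃ C, 0 ≤ C ∧ ∀ φ : testSpace univ, ‖besselTest (-k) φ‖ ≤ C * ∫ x, ‖(φ : ℝ → ℂ) x‖ := by
  -- The transform of φ is bounded by the L¹ norm of φ, so only the integrability of the squared
  -- weight (1 + (2πξ)²)^{-k} is needed; it holds because k ≥ 1.
  have hint : Integrable fun ξ => weight (-k) ξ ^ 2 := by
    refine integrable_inv_one_add_sq.mono' ((continuous_weight _).pow 2).aestronglyMeasurable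
      (Eventually.of_forall fun ξ => ?_)
    rw [Real.norm_of_nonneg (by positivity), weight_sq, Real.rpow_neg (by positivity)]
    refine inv_anti₀ (by positivity) ?_
    have hπ : 1 ≤ 2 * Real.pi := by linarith [Real.pi_gt_three]
    have h1 : 1 + ξ ^ 2 ≤ 1 + (2 * Real.pi * ξ) ^ 2 := by
      have h2 : (1 : ℝ) ≤ (2 * Real.pi) ^ 2 := one_le_pow₀ hπ
      rw [mul_pow]
      nlinarith [mul_le_mul_of_nonneg_right h2 (sq_nonneg ξ)]
    calc 1 + ξ ^ 2 ≤ (1 + (2 * Real.pi * ξ) ^ 2) ^ (1 : ℝ) := by rwa [Real.rpow_one]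
      _ ≤ _ := Real.rpow_le_rpow_of_exponent_le (by nlinarith [sq_nonneg (2 * Real.pi * ξ)])
        (by exact_mod_cast hk)
  refine ⟨Real.sqrt (∫ ξ, weight (-k) ξ ^ 2), Real.sqrt_nonneg _, fun φ => ?_⟩
  have h0 : 0 ≤ ∫ x, ‖(φ : ℝ → ℂ) x‖ := integral_nonneg fun _ => norm_nonneg _
  rw [norm_besselTest, sobolevNorm, ← Real.sqrt_sq h0, ← Real.sqrt_mul
    (integral_nonneg fun _ => sq_nonneg _), ← integral_mul_const]
  refine Real.sqrt_le_sqrt (integral_mono_of_nonneg (Eventually.of_forall fun ξ => by positivity)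
    (hint.mul_const _) (Eventually.of_forall fun ξ => ?_))
  simp only [weight_sq]
  refine mul_le_mul_of_nonneg_left ?_ (by positivity)
  exact pow_le_pow_left₀ (norm_nonneg _) (VectorFourier.norm_fourierIntegral_le_integral_norm
    _ _ _ _ _) 2

end BesselTest

/-! ### Fourier multipliers and the derivatives of elements of H^k(ℝ). -/

section Multiplier

lemma memLp_boundedContinuous_mul (m : ℝ →ᵇ ℂ) (f : L2Line) :
    MemLp (fun x => m x * f x) 2 volume :=
  (Lp.memLp f).of_le_mul (c := ‖m‖)
    (m.continuous.aestronglyMeasurable.mul (Lp.aestronglyMeasurable f))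
    (Eventually.of_forall fun x => by
      rw [norm_mul]
      exact mul_le_mul_of_nonneg_right (m.norm_coe_le_norm x) (norm_nonneg _))

/-- Multiplication by a bounded continuous function as an operator on `L²(ℝ)`. -/
def mulOp (m : ℝ →ᵇ ℂ) : L2Line →L[ℂ] L2Line :=
  have hm := memLp_boundedContinuous_mul m
  LinearMap.mkContinuous
    { toFun := fun f => (hm f).toLp _
      map_add' := fun f g => by
        refine Lp.ext ?_
        filter_upwards [(hm (f + g)).coeFn_toLp, (hm f).coeFn_toLp, (hm g).coeFn_toLp,
          Lp.coeFn_add f g, Lp.coeFn_add ((hm f).toLp _) ((hm g).toLp _)] with x h1 h2 h3 h4 h5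
        rw [h1, h5, Pi.add_apply, h2, h3, h4, Pi.add_apply, mul_add]
      map_smul' := fun c f => by
        refine Lp.ext ?_
        filter_upwards [(hm (c • f)).coeFn_toLp, (hm f).coeFn_toLp,
          Lp.coeFn_smul c f, Lp.coeFn_smul c ((hm f).toLp _)] with x h1 h2 h3 h4
        rw [h1, RingHom.id_apply, h4, Pi.smul_apply, h2, h3, Pi.smul_apply, smul_eq_mul,
          smul_eq_mul, mul_left_comm] }
    ‖m‖ fun f => by
      refine Lp.norm_le_mul_norm_of_ae_le_mul ?_
      filter_upwards [(hm f).coeFn_toLp] with x hx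
      change ‖(hm f).toLp _ x‖ ≤ _
      rw [hx, norm_mul]
      exact mul_le_mul_of_nonneg_right (m.norm_coe_le_norm x) (norm_nonneg _)

lemma coeFn_mulOp (m : ℝ →ᵇ ℂ) (f : L2Line) : mulOp m f =ᵐ[volume] fun x => m x * f x :=
  (memLp_boundedContinuous_mul m f).coeFn_toLp

/-- The bounded symbol `(2πiξ)^j (1 + (2πξ)²)^{-k/2}`, `j ≤ k`. -/
def symbol (k : ℕ) (j : Fin (k + 1)) : ℝ →ᵇ ℂ :=
  BoundedContinuousFunction.ofNormedAddCommGroup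
    (fun ξ => (2 * Real.pi * Complex.I * ξ) ^ (j : ℕ) * (weight (-k) ξ : ℂ))
    ((by fun_prop : Continuous fun ξ : ℝ => (2 * Real.pi * Complex.I * ξ) ^ (j : ℕ)).mul
      (Complex.continuous_ofReal.comp (continuous_weight _))) 1 fun ξ => by
      have h1 : ‖(2 * Real.pi * Complex.I * ξ : ℂ)‖ = |2 * Real.pi * ξ| := by
        simp [abs_mul]
      rw [norm_mul, norm_pow, h1, Complex.norm_real, Real.norm_of_nonneg (weight_pos _ _).le]
      have h2 := (abs_pow_le_weight j ξ).trans
        (weight_mono (show ((j : ℕ) : ℝ) ≤ k by exact_mod_cast Nat.lt_succ_iff.1 j.2) ξ)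
      have h3 := mul_le_mul_of_nonneg_right h2 (weight_pos (-k) ξ).le
      rwa [mul_comm (weight k ξ), weight_neg_mul_self] at h3

lemma symbol_apply (k : ℕ) (j : Fin (k + 1)) (ξ : ℝ) :
    symbol k j ξ = (2 * Real.pi * Complex.I * ξ) ^ (j : ℕ) * (weight (-k) ξ : ℂ) := rfl

/-- The `j`-th derivative of the element of `H^k(ℝ)` with weighted Fourier transform
`G = (1 + (2πξ)²)^{k/2} ĝ`. -/
def sobolevDeriv (k : ℕ) (j : Fin (k + 1)) : L2Line →L[ℂ] L2Line :=
  ((Lp.fourierTransformₗᵢ ℝ ℂ).symm : L2Line →L[ℂ] L2Line).comp (mulOp (symbol k j))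

lemma fourier_sobolevDeriv (k : ℕ) (j : Fin (k + 1)) (G : L2Line) :
    𝓕 (sobolevDeriv k j G) = mulOp (symbol k j) G :=
  (Lp.fourierTransformₗᵢ ℝ ℂ).apply_symm_apply _

/-- By Plancherel the multiplier moves to ψ, and conjugating 2πiξ produces the sign. Together with
`integral_sobolevDeriv_zero_mul_conj` this shows that `sobolevDeriv k j G` is the j-th
distributional derivative of `sobolevDeriv k 0 G`. -/
lemma inner_sobolevDeriv (k : ℕ) (j : Fin (k + 1)) (G : L2Line) (ψ : testSpace univ) :
    inner ℂ (testL2 ψ) (sobolevDeriv k j G) =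
      (-1) ^ (j : ℕ) * inner ℂ (besselTest (-k) (testDeriv j ψ)) G := by
  rw [← Lp.inner_fourier_eq, fourier_sobolevDeriv, ← besselTest_zero, L2.inner_def, L2.inner_def,
    ← integral_const_mul]
  refine integral_congr_ae ?_
  filter_upwards [coeFn_besselTest 0 ψ, coeFn_besselTest_testDeriv (-k) j ψ,
    coeFn_mulOp (symbol k j) G] with ξ h1 h2 h3
  rw [h1, h2, h3, symbol_apply]
  simp only [RCLike.inner_apply, map_mul, Complex.conj_ofReal, weight_zero, Complex.ofReal_one,
    one_mul, map_pow, Complex.conj_I, Complex.conj_ofNat]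
  rw [show (2 * Real.pi * -Complex.I * ξ : ℂ) = (-1) * (2 * Real.pi * Complex.I * ξ) by ring,
    mul_pow (-1 : ℂ)]
  have : ((-1 : ℂ) ^ (j : ℕ)) * (-1) ^ (j : ℕ) = 1 := by
    rw [← mul_pow]; simp
  generalize (2 * Real.pi * Complex.I * ξ : ℂ) ^ (j : ℕ) = z
  linear_combination (-z * (weight (-k) ξ : ℂ) * G ξ *
    conj (𝓕 (ψ : ℝ → ℂ) ξ)) * this

/-- Pairing of a test function with an element of `H^k(ℝ)`. -/
lemma integral_sobolevDeriv_zero_mul_conj (k : ℕ) (G : L2Line) (ψ : testSpace univ) :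
    ∫ x, sobolevDeriv k 0 G x * conj ((ψ : ℝ → ℂ) x) = inner ℂ (besselTest (-k) ψ) G := by
  rw [integral_mul_conj_eq_inner, inner_sobolevDeriv]
  have : testDeriv 0 ψ = ψ := by ext; simp [testDeriv]
  simp [this]

lemma sobolevDeriv_zero_injective (k : ℕ) : Function.Injective (sobolevDeriv k 0) := by
  rw [injective_iff_map_eq_zero]
  intro G hG
  have h := fourier_sobolevDeriv k 0 G
  rw [hG] at h
  have h0 : (𝓕 (0 : L2Line)) = 0 := map_zero (Lp.fourierTransformₗᵢ ℝ ℂ)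
  rw [h0] at h
  refine Lp.ext ?_
  filter_upwards [coeFn_mulOp (symbol k 0) G, Lp.coeFn_zero ℂ 2 (volume : Measure ℝ)] with ξ h1 h2
  rw [← h, h2] at h1
  rw [h2]
  have h3 : (symbol k 0 ξ) ≠ 0 := by
    rw [symbol_apply]
    simpa using (weight_pos (-k) ξ).ne'
  simpa [h3] using h1.symm

end Multiplier

/-! ### No solution of Qu = 0 in L²(ℝ); density of the range of Q^*. -/

section HalfLineSolutions

variable {n : ℕ} {q : Fin (n + 1) → ℝ → ℂ}

/-- The formal adjoint as a linear operator on test functions. -/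
def adjointOp (q : Fin (n + 1) → ℝ → ℂ) (hq : ∀ j, ContDiff ℝ ∞ (q j)) :
    testSpace univ →ₗ[ℂ] testSpace univ where
  toFun φ := ⟨formalAdjoint q φ, formalAdjoint_mem_testSpace hq φ.2⟩
  map_add' φ ψ := Subtype.ext (formalAdjoint_add hq φ.2.1.1 ψ.2.1.1)
  map_smul' c φ := Subtype.ext (formalAdjoint_smul q c φ)

lemma adjointOp_apply (hq : ∀ j, ContDiff ℝ ∞ (q j)) (φ : testSpace univ) :
    (adjointOp q hq φ : ℝ → ℂ) = formalAdjoint q φ := rfl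

lemma l2Solutions_anti {S T : Set ℝ} (h : S ⊆ T) : l2Solutions q T ≤ l2Solutions q S :=
  fun _ hu => ⟨hu.1, hu.2.1, hu.2.2.mono_measure (Measure.restrict_mono h le_rfl)⟩

lemma coe_mem_testSpace_univ {I : Set ℝ} {φ : ℝ → ℂ} (h : φ ∈ testSpace I) : φ ∈ testSpace univ :=
  ⟨h.1, subset_univ _⟩

lemma locallyIntegrable_L2Line (g : L2Line) : LocallyIntegrable g :=
  (Lp.memLp g).locallyIntegrable (by norm_num)

/-- A test function in `I` that is orthogonal to the solutions of `Qu = 0` in `L²(I)` is a limit in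
`H^{-k}(ℝ)` of functions `Q^* φ` with `φ` supported in `I`. -/
theorem mem_closure_range_adjointOp (hn : 0 < n) (hq : ∀ j, ContDiff ℝ ∞ (q j))
    (hq0 : ∀ x, q (Fin.last n) x ≠ 0) (k : ℕ) {I : Set ℝ} (hIo : IsOpen I) (hI : I.OrdConnected)
    (hIne : I.Nonempty) (f : testSpace univ) (hf : (f : ℝ → ℂ) ∈ testSpace I)
    (hfS : ∀ u ∈ l2Solutions q I, ∫ x, (f : ℝ → ℂ) x * conj (u x) = 0) {ε : ℝ} (hε : 0 < ε) :
    ∃ φ : testSpace univ, (φ : ℝ → ℂ) ∈ testSpace I ∧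
      ‖besselTest (-k) f - besselTest (-k) (adjointOp q hq φ)‖ < ε := by
  let X : Submodule ℂ (testSpace univ) := (testSpace I).comap (testSpace univ).subtype
  let V : Submodule ℂ L2Line := X.map ((besselTest (-k)).comp (adjointOp q hq))
  -- The closure of V is its double orthogonal complement. If G is orthogonal to V, the H^k function
  -- g represented by G solves Qg = 0 weakly on I. So g is on I a smooth solution that lies in
  -- L²(I), and f is orthogonal to it.
  have hmem : besselTest (-k) f ∈ V.topologicalClosure := by
    rw [← Submodule.orthogonal_orthogonal_eq_closure, Submodule.mem_orthogonal]
    intro G hG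
    rw [Submodule.mem_orthogonal] at hG
    obtain ⟨u, hu, hgu⟩ := exists_solution_ae_eq hn hq hq0 hIo hI hIne
      (locallyIntegrable_L2Line (sobolevDeriv k 0 G)) fun φ hφ => by
        have := hG _ (Submodule.mem_map_of_mem
          (show (⟨φ, coe_mem_testSpace_univ hφ⟩ : testSpace univ) ∈ X from hφ))
        rw [LinearMap.comp_apply, ← integral_sobolevDeriv_zero_mul_conj] at this
        exact this
    have hu' : u ∈ l2Solutions q I := by
      refine ⟨hu.1, hu.2.1, ?_⟩
      refine MemLp.ae_eq ?_ ((Lp.memLp (sobolevDeriv k 0 G)).restrict I)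
      exact (ae_restrict_iff' hIo.measurableSet).2 hgu
    rw [← inner_conj_symm, ← integral_sobolevDeriv_zero_mul_conj, ← integral_conj]
    refine Eq.trans (integral_congr_ae ?_) (hfS u hu')
    filter_upwards [hgu] with x hx
    by_cases hxI : x ∈ I
    · simp only [hx hxI, map_mul, Complex.conj_conj, mul_comm]
    · rw [image_eq_zero_of_notMem_tsupport fun h => hxI (hf.2 h)]
      simp
  rw [← SetLike.mem_coe, Submodule.topologicalClosure_coe, Metric.mem_closure_iff] at hmem
  obtain ⟨_, ⟨φ, hφ, rfl⟩, hd⟩ := hmem ε hε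
  exact ⟨φ, hφ, by rwa [dist_eq_norm] at hd⟩

/-- If the lower estimate for `Q^*` holds and the equation `Qu = 0` has exactly `n/2` independent
solutions in `L²` of each half-line, then no solution `u ≠ 0` is in `L²(ℝ)`. -/
theorem l2Solutions_inf_eq_bot (hn : 0 < n) (hne : Even n) (hq : ∀ j, ContDiff ℝ ∞ (q j))
    (hq0 : ∀ x, q (Fin.last n) x ≠ 0)
    (hneg : Module.finrank ℂ (l2Solutions q (Iio 0)) = n / 2)
    (hpos : Module.finrank ℂ (l2Solutions q (Ioi 0)) = n / 2)
    {k : ℕ} {s c₃ : ℝ} (hs : 0 ≤ s) (hc₃ : 0 < c₃)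
    (hQ : ∀ φ, c₃ * ‖besselTest s φ‖ ≤ ‖besselTest (-k) (adjointOp q hq φ)‖) :
    l2Solutions q (Iio 0) ⊓ l2Solutions q (Ioi 0) = ⊥ := by
  have hfin := finiteDimensional_solutions hn hq hq0
  set Sm := l2Solutions q (Iio 0) with hSm
  set Sp := l2Solutions q (Ioi 0) with hSp
  have hmS : Sm ≤ l2Solutions q ∅ := l2Solutions_anti (empty_subset _)
  have hpS : Sp ≤ l2Solutions q ∅ := l2Solutions_anti (empty_subset _)
  have := Submodule.finiteDimensional_of_le hmS
  have := Submodule.finiteDimensional_of_le hpS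
  by_contra hbot
  have hWS : Sm ⊔ Sp ≤ l2Solutions q ∅ := sup_le hmS hpS
  -- Dimension count: dim(S₋ + S₊) = n - dim(S₋ ∩ S₊) < n.
  have hlt : ¬ l2Solutions q ∅ ≤ Sm ⊔ Sp := by
    intro hle
    have h1 := Submodule.finrank_sup_add_finrank_inf_eq Sm Sp
    have h2 := Submodule.finrank_mono hle
    rw [finrank_solutions hn hq hq0] at h2
    have h3 : 0 < Module.finrank ℂ ↥(Sm ⊓ Sp) := by
      rw [Nat.pos_iff_ne_zero]
      exact fun h => hbot (Submodule.finrank_eq_zero.1 h)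
    obtain ⟨r, hr⟩ := hne
    omega
  obtain ⟨u₀, hu₀, hu₀W⟩ := SetLike.not_le_iff_exists.1 hlt
  have hu₀c : ContDiff ℝ ∞ u₀ := (mem_l2Solutions_empty.1 hu₀).1
  -- If no such f existed, u₀ would agree on (0,1), hence everywhere, with an element of S₋ + S₊.
  have hsep : ∃ f ∈ testSpace (Ioo (0 : ℝ) 1), (∀ u ∈ Sm ⊔ Sp, ∫ x, u x * f x = 0) ∧
      ∫ x, u₀ x * f x ≠ 0 := by
    by_contra! hcon
    obtain ⟨w, hw, hwu⟩ := exists_mem_ae_eq_of_annihilator (W := Sm ⊔ Sp)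
      (fun u hu => (mem_l2Solutions_empty.1 (hWS hu)).1.continuous)
      (hu₀c.continuous.locallyIntegrable) isOpen_Ioo hcon
    have heq := eq_of_ae_eq_on_isOpen isOpen_Ioo hu₀c.continuous
      (mem_l2Solutions_empty.1 (hWS hw)).1.continuous hwu
    have := solution_eq_zero_of_eqOn_Ioo hn hq hq0 (Submodule.sub_mem _ hu₀ (hWS hw)) one_pos
      fun x hx => sub_eq_zero.2 (heq hx)
    exact hu₀W (sub_eq_zero.1 this ▸ hw)
  obtain ⟨f', hf', hfW', hfu'⟩ := hsep
  let f : testSpace univ := ⟨fun x => conj (f' x), coe_mem_testSpace_univ (conj_mem_testSpace hf')⟩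
  have hf : (f : ℝ → ℂ) ∈ testSpace (Ioo (0 : ℝ) 1) := conj_mem_testSpace hf'
  have hconj (u : ℝ → ℂ) : ∫ x, (f : ℝ → ℂ) x * conj (u x) = conj (∫ x, u x * f' x) := by
    rw [← integral_conj]
    congr with x
    simp [f, mul_comm]
  have hf0 (x : ℝ) (hx : x ∉ Ioo (0 : ℝ) 1) : (f : ℝ → ℂ) x = 0 :=
    image_eq_zero_of_notMem_tsupport fun h => hx (hf.2 h)
  obtain ⟨θ, hθ, hθ1⟩ := exists_isTest_eq_one (-1) 2
  let v : testSpace univ := ⟨fun x => θ x * u₀ x, hθ.mul_right hu₀c, subset_univ _⟩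
  have hD0 (x : ℝ) (hx : x ∈ Ioo (-1 : ℝ) 2) : diffOp q v x = 0 := by
    rw [diffOp_congr_of_eqOn q isOpen_Ioo (v := u₀) (fun t ht => by
      simp [v, hθ1 t (Ioo_subset_Icc_self ht)]) hx, (mem_l2Solutions_empty.1 hu₀).2]
  -- Qv vanishes on (-1,2), φ will be supported in (0,∞) and ψ will vanish on (1,∞). Hence (φ, Qv) =
  -- (φ - ψ, D): only the part of Qv beyond 1 counts, and there φ may be replaced by φ - ψ.
  have hDm : MemLp ((Ioi (1 : ℝ)).indicator (diffOp q v)) 2 volume :=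
    ((v.2.1.diffOp hq).continuous.memLp_of_hasCompactSupport (v.2.1.diffOp hq).2).indicator
      measurableSet_Ioi
  set D := hDm.toLp with hD
  have hfv : ∫ x, (f : ℝ → ℂ) x * conj (u₀ x) =
      inner ℂ (besselTest k v) (besselTest (-k) f) := by
    have := inner_besselTest_neg (-k) f v
    rw [neg_neg] at this
    rw [this, ← pairing_eq_inner, pairing]
    congr with x
    by_cases hx : x ∈ Ioo (0 : ℝ) 1
    · simp [v, hθ1 x ⟨by linarith [hx.1], by linarith [hx.2]⟩]
    · simp [hf0 x hx]
  have hbound (ε : ℝ) (hε : 0 < ε) : ‖∫ x, (f : ℝ → ℂ) x * conj (u₀ x)‖ ≤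
      (‖besselTest k v‖ + ‖D‖ * (2 / c₃)) * ε := by
    obtain ⟨φ, hφ, hφε⟩ := mem_closure_range_adjointOp hn hq hq0 k (isOpen_Ioi (a := (0 : ℝ)))
      ordConnected_Ioi nonempty_Ioi f ⟨hf.1, hf.2.trans Ioo_subset_Ioi_self⟩
      (fun u hu => by rw [hconj, hfW' u ((le_sup_right : Sp ≤ _) hu), map_zero]) hε
    -- The half-line ends at 1 rather than 0 so that it contains the support of f; its L² solutions
    -- still belong to S₋.
    obtain ⟨ψ, hψ, hψε⟩ := mem_closure_range_adjointOp hn hq hq0 k (isOpen_Iio (a := (1 : ℝ)))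
      ordConnected_Iio nonempty_Iio f ⟨hf.1, hf.2.trans Ioo_subset_Iio_self⟩
      (fun u hu => by
        rw [hconj, hfW' u ((le_sup_left : Sm ≤ _) (l2Solutions_anti
          (Iio_subset_Iio zero_le_one) hu)), map_zero]) hε
    -- Q^*φ and Q^*ψ are both within ε of f, so the lower estimate for Q^* controls φ - ψ.
    have hφψ : ‖testL2 (φ - ψ)‖ ≤ 2 / c₃ * ε := by
      have h1 := hQ (φ - ψ)
      have h2 : ‖besselTest (-k) (adjointOp q hq (φ - ψ))‖ ≤ 2 * ε := by
        rw [map_sub, map_sub, ← sub_sub_sub_cancel_left _ _ (besselTest (-k) f)]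
        exact (norm_sub_le _ _).trans (by linarith)
      have h3 := norm_testL2_le hs (φ - ψ)
      rw [div_mul_eq_mul_div, le_div_iff₀ hc₃]
      nlinarith
    have h1 : inner ℂ (besselTest k v) (besselTest (-k) (adjointOp q hq φ)) =
        inner ℂ D (testL2 (φ - ψ)) := by
      have := inner_besselTest_neg (-k) (adjointOp q hq φ) v
      rw [neg_neg] at this
      rw [this, ← pairing_eq_inner, pairing, adjointOp_apply,
        integral_formalAdjoint_mul_conj hq φ.2.1.1 v.2.1, L2.inner_def]
      refine integral_congr_ae ?_
      filter_upwards [hDm.coeFn_toLp, coeFn_testL2 (φ - ψ)] with x hx1 hx2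
      rw [hD, hx1, hx2, RCLike.inner_apply]
      change _ = ((φ : ℝ → ℂ) x - (ψ : ℝ → ℂ) x) * _
      by_cases hx : 1 < x
      · rw [indicator_of_mem (show x ∈ Ioi 1 from hx), image_eq_zero_of_notMem_tsupport
          (f := (ψ : ℝ → ℂ)) fun h => (hψ.2 h).not_gt hx, sub_zero]
      · rw [indicator_of_notMem (show x ∉ Ioi 1 from hx), map_zero, mul_zero]
        by_cases hx0 : 0 < x
        · rw [hD0 x ⟨by linarith, by linarith⟩, map_zero, mul_zero]
        · rw [image_eq_zero_of_notMem_tsupport (f := (φ : ℝ → ℂ)) fun h => hx0 (hφ.2 h), zero_mul]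
    have h2 : inner ℂ (besselTest k v) (besselTest (-k) f) =
        inner ℂ (besselTest k v) (besselTest (-k) f - besselTest (-k) (adjointOp q hq φ)) +
          inner ℂ D (testL2 (φ - ψ)) := by
      rw [← h1, ← inner_add_right, sub_add_cancel]
    rw [hfv, h2]
    have h3 := norm_inner_le_norm (𝕜 := ℂ) (besselTest k v)
      (besselTest (-k) f - besselTest (-k) (adjointOp q hq φ))
    have h4 := norm_inner_le_norm (𝕜 := ℂ) D (testL2 (φ - ψ))
    have h5 := mul_le_mul_of_nonneg_left hφε.le (norm_nonneg (besselTest k v))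
    have h6 := mul_le_mul_of_nonneg_left hφψ (norm_nonneg D)
    exact (norm_add_le _ _).trans (by linarith)
  refine hfu' ?_
  have hzero : ∫ x, (f : ℝ → ℂ) x * conj (u₀ x) = 0 := by
    rw [← norm_le_zero_iff]
    refine le_of_forall_pos_le_add fun δ hδ => ?_
    set M := ‖besselTest k v‖ + ‖D‖ * (2 / c₃) with hM
    have hM0 : 0 ≤ M := by positivity
    refine (hbound (δ / (M + 1)) (by positivity)).trans ?_
    rw [zero_add, mul_div_assoc', div_le_iff₀ (by positivity)]
    nlinarith
  rw [hconj] at hzero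
  exact (map_eq_zero _).1 hzero

/-- Weak solutions of `Qu = 0` in `L²(ℝ)` vanish. -/
theorem ae_eq_zero_of_weak_solution (hn : 0 < n) (hq : ∀ j, ContDiff ℝ ∞ (q j))
    (hq0 : ∀ x, q (Fin.last n) x ≠ 0)
    (hbot : l2Solutions q (Iio 0) ⊓ l2Solutions q (Ioi 0) = ⊥) {g : ℝ → ℂ}
    (hg : MemLp g 2 volume) (h : ∀ φ, IsTest φ → ∫ x, g x * conj (formalAdjoint q φ x) = 0) :
    g =ᵐ[volume] 0 := by
  obtain ⟨u, hu, hgu⟩ := exists_solution_ae_eq hn hq hq0 isOpen_univ ordConnected_univ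
    univ_nonempty (hg.locallyIntegrable (by norm_num)) fun φ hφ => h φ hφ.1
  have hgu' : g =ᵐ[volume] u := by filter_upwards [hgu] with x hx using hx (mem_univ x)
  have hu2 : MemLp u 2 volume := hg.ae_eq hgu'
  have : u ∈ l2Solutions q (Iio 0) ⊓ l2Solutions q (Ioi 0) :=
    ⟨⟨hu.1, hu.2.1, hu2.restrict _⟩, ⟨hu.1, hu.2.1, hu2.restrict _⟩⟩
  rw [hbot, Submodule.mem_bot] at this
  rwa [this] at hgu'

/-- The range of `Q^*` on test functions is dense in `H^{-k}(ℝ)`. -/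
theorem denseRange_besselTest_adjointOp (hn : 0 < n) (hq : ∀ j, ContDiff ℝ ∞ (q j))
    (hq0 : ∀ x, q (Fin.last n) x ≠ 0)
    (hbot : l2Solutions q (Iio 0) ⊓ l2Solutions q (Ioi 0) = ⊥) (k : ℕ) :
    DenseRange ((besselTest (-k)).comp (adjointOp q hq)) := by
  set V := LinearMap.range ((besselTest (-k)).comp (adjointOp q hq)) with hV
  have : V.topologicalClosure = ⊤ := by
    rw [Submodule.topologicalClosure_eq_top_iff, Submodule.eq_bot_iff]
    intro G hG
    rw [Submodule.mem_orthogonal] at hG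
    -- A vector orthogonal to the range represents a weak solution of Qg = 0 in L²(ℝ), which
    -- vanishes.
    have h0 := ae_eq_zero_of_weak_solution hn hq hq0 hbot (Lp.memLp (sobolevDeriv k 0 G))
      fun φ hφ => by
        have := hG _ (LinearMap.mem_range_self _ (⟨φ, hφ, subset_univ _⟩ : testSpace univ))
        rwa [LinearMap.comp_apply, ← integral_sobolevDeriv_zero_mul_conj] at this
    refine sobolevDeriv_zero_injective k ?_
    rw [map_zero]
    exact Lp.ext (h0.trans (Lp.coeFn_zero ℂ 2 volume).symm)
  have h2 : Dense (V : Set L2Line) := by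
    rw [dense_iff_closure_eq, ← Submodule.topologicalClosure_coe, this, Submodule.top_coe]
  rwa [hV, LinearMap.coe_range] at h2

end HalfLineSolutions

/-! ### From a coercive Hermitian form to an operator. -/

section Form

lemma eq_of_inner_denseRange {X H : Type*} [NormedAddCommGroup H] [InnerProductSpace ℂ H]
    {e : X → H} (he : DenseRange e) {a b : H}
    (h : ∀ x, inner ℂ a (e x) = inner ℂ b (e x)) : a = b := by
  have : (fun y => inner ℂ a y) = fun y => inner ℂ b y :=
    he.equalizer (by fun_prop) (by fun_prop) (funext h)
  exact ext_inner_right ℂ fun y => congrFun this y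

variable {X H : Type*} [AddCommGroup X] [Module ℂ X] [NormedAddCommGroup H]
  [InnerProductSpace ℂ H]

/-- A positive Hermitian form that is comparable to the square of a Hilbert norm is given by a
bounded selfadjoint coercive operator on the completion. -/
theorem exists_operator_of_form [CompleteSpace H] (B : PreInnerProductSpace.Core ℂ X)
    (e : X →ₗ[ℂ] H) (he : DenseRange e) {c C : ℝ} (hC : 0 ≤ C)
    (hB : ∀ x, c * ‖e x‖ ^ 2 ≤ (B.inner x x).re ∧ (B.inner x x).re ≤ C * ‖e x‖ ^ 2) :
    ∃ A : H →L[ℂ] H, (∀ x y, B.inner x y = inner ℂ (e x) (A (e y))) ∧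
      (∀ x y, inner ℂ x (A y) = inner ℂ (A x) y) ∧
      ∀ x, c * ‖x‖ ^ 2 ≤ (inner ℂ x (A x)).re ∧ (inner ℂ x (A x)).re ≤ C * ‖x‖ ^ 2 := by
  have hsymm (x y : X) : conj (B.inner y x) = B.inner x y := B.conj_inner_symm x y
  -- Cauchy–Schwarz for the form, then the upper bound on its diagonal.
  have hbound (x y : X) : ‖B.inner x y‖ ≤ C * ‖e x‖ * ‖e y‖ := by
    have h1 := @InnerProductSpace.Core.inner_mul_inner_self_le ℂ X _ _ _ B x y
    have h2 : ‖B.inner y x‖ = ‖B.inner x y‖ := by rw [← hsymm x y, Complex.norm_conj]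
    change ‖B.inner x y‖ * ‖B.inner y x‖ ≤ (B.inner x x).re * (B.inner y y).re at h1
    rw [h2] at h1
    refine abs_le_of_sq_le_sq' ?_ (by positivity) |>.2
    calc ‖B.inner x y‖ ^ 2 ≤ (B.inner x x).re * (B.inner y y).re := by rw [sq]; exact h1
      _ ≤ (C * ‖e x‖ ^ 2) * (C * ‖e y‖ ^ 2) :=
        mul_le_mul (hB x).2 (hB y).2 (B.re_inner_nonneg y) (by positivity)
      _ = _ := by ring
  have hadd (x y z : X) : B.inner x (y + z) = B.inner x y + B.inner x z := by
    rw [← hsymm x (y + z), B.add_left, map_add, hsymm, hsymm]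
  have hsmul (r : ℂ) (x y : X) : B.inner x (r • y) = r * B.inner x y := by
    rw [← hsymm x (r • y), B.smul_left, map_mul, Complex.conj_conj, hsymm]
  let ℓ (y : X) : X →ₗ[ℂ] ℂ :=
    { toFun := fun x => B.inner y x
      map_add' := hadd y
      map_smul' := fun r x => hsmul r y x }
  have hℓ (y : X) : ∀ x, ‖ℓ y x‖ ≤ (C * ‖e y‖) * ‖e x‖ := hbound y
  -- The Riesz vector of the functional B(y, ·), extended from the dense image of X to H. Since y ↦
  -- v₀ y is linear and bounded by the norm of e y, it extends in turn to the operator A.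
  let v₀ (y : X) : H := (InnerProductSpace.toDual ℂ H).symm ((ℓ y).extendOfNorm e)
  have hv₀ (y x : X) : inner ℂ (v₀ y) (e x) = B.inner y x := by
    rw [InnerProductSpace.toDual_symm_apply]
    exact LinearMap.extendOfNorm_eq he ⟨_, hℓ y⟩ x
  let v : X →ₗ[ℂ] H :=
    { toFun := v₀
      map_add' := fun y z => eq_of_inner_denseRange he fun x => by
        rw [inner_add_left, hv₀, hv₀, hv₀, B.add_left]
      map_smul' := fun r y => eq_of_inner_denseRange he fun x => by
        rw [RingHom.id_apply, inner_smul_left, hv₀, hv₀, B.smul_left] }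
  have hv (y : X) : ‖v y‖ ≤ C * ‖e y‖ := by
    change ‖(InnerProductSpace.toDual ℂ H).symm ((ℓ y).extendOfNorm e)‖ ≤ _
    rw [LinearIsometryEquiv.norm_map]
    exact ContinuousLinearMap.opNorm_le_bound _ (by positivity) fun x =>
      LinearMap.norm_extendOfNorm_apply_le he _ (hℓ y) x
  let A : H →L[ℂ] H := v.extendOfNorm e
  have hA (y : X) : A (e y) = v₀ y := LinearMap.extendOfNorm_eq he ⟨C, hv⟩ y
  have hAB (x y : X) : B.inner x y = inner ℂ (e x) (A (e y)) := by
    rw [hA, ← inner_conj_symm, hv₀, hsymm]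
  refine ⟨A, hAB, fun x y => ?_, fun x => ?_⟩
  · refine he.induction_on₂ (p := fun x y => inner ℂ x (A y) = inner ℂ (A x) y)
      (isClosed_eq (by fun_prop) (by fun_prop)) (fun x y => ?_) x y
    rw [← hAB, ← hsymm, hAB, inner_conj_symm]
  · refine he.induction_on (p := fun x => c * ‖x‖ ^ 2 ≤ (inner ℂ x (A x)).re ∧
      (inner ℂ x (A x)).re ≤ C * ‖x‖ ^ 2) x ?_ fun x => ?_
    · have h1 : Continuous fun x => (inner ℂ x (A x)).re :=
        Complex.continuous_re.comp (by fun_prop)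
      exact (isClosed_le (by fun_prop) h1).inter (isClosed_le h1 (by fun_prop))
    · rw [← hAB]
      exact hB x

end Form

/-! ### The form of R and its continuous extension. -/

section Kernel

variable {R : ℝ → ℝ → ℂ}

lemma integrable_kernel_mul (hR : LocallyIntegrable (fun z : ℝ × ℝ => R z.1 z.2)) {φ χ : ℝ → ℂ}
    (hφ : IsTest φ) (hχ : IsTest χ) :
    Integrable (fun z : ℝ × ℝ => R z.1 z.2 * φ z.2 * χ z.1) := by
  have hc : Continuous fun z : ℝ × ℝ => χ z.1 * φ z.2 :=
    (hχ.continuous.comp continuous_fst).mul (hφ.continuous.comp continuous_snd)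
  have hs : HasCompactSupport fun z : ℝ × ℝ => χ z.1 * φ z.2 := by
    refine HasCompactSupport.intro (hχ.2.isCompact.prod hφ.2.isCompact) fun z hz => ?_
    rw [mem_prod, not_and_or] at hz
    rcases hz with h | h <;> simp [image_eq_zero_of_notMem_tsupport h]
  refine (hR.integrable_smul_left_of_hasCompactSupport hc hs).congr
    (Eventually.of_forall fun z => ?_)
  simp only [smul_eq_mul]
  ring

lemma pairing_kernelOp (φ χ : ℝ → ℂ) :
    pairing (kernelOp R φ) χ = ∫ x, ∫ y, R x y * φ y * conj (χ x) := by
  simp only [pairing, kernelOp, integral_mul_const]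

/-- Fubini applies because φ and χ have compact support and R is locally integrable on the plane;
then the Hermitian symmetry of R is used. -/
lemma pairing_kernelOp_symm (hR : LocallyIntegrable (fun z : ℝ × ℝ => R z.1 z.2))
    (hRsymm : ∀ x y, R x y = conj (R y x)) {φ χ : ℝ → ℂ} (hφ : IsTest φ) (hχ : IsTest χ) :
    pairing (kernelOp R φ) χ = conj (pairing (kernelOp R χ) φ) := by
  rw [pairing_kernelOp, pairing_kernelOp,
    integral_integral_swap (f := fun x y => R x y * φ y * conj (χ x))
      (integrable_kernel_mul hR hφ hχ.conjugate), ← integral_conj]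
  refine integral_congr_ae (Eventually.of_forall fun y => ?_)
  simp only [← integral_conj]
  refine integral_congr_ae (Eventually.of_forall fun x => ?_)
  simp only [map_mul, Complex.conj_conj, ← hRsymm]
  ring

lemma pairing_kernelOp_add_left (hRL2 : ∀ φ, IsTest φ → MemLp (kernelOp R φ) 2 volume)
    {φ χ χ' : ℝ → ℂ} (hφ : IsTest φ) (hχ : IsTest χ) (hχ' : IsTest χ') :
    pairing (kernelOp R φ) (χ + χ') = pairing (kernelOp R φ) χ + pairing (kernelOp R φ) χ' := by
  have hl : LocallyIntegrable (kernelOp R φ) := (hRL2 φ hφ).locallyIntegrable (by norm_num)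
  simp only [pairing]
  rw [← integral_add (LocallyIntegrable.integrable_mul_isTest hl hχ.conjugate)
    (LocallyIntegrable.integrable_mul_isTest hl hχ'.conjugate)]
  simp [mul_add]

lemma pairing_smul_right (u χ : ℝ → ℂ) (c : ℂ) :
    pairing u (c • χ) = conj c * pairing u χ := by
  simp only [pairing, ← integral_const_mul, Pi.smul_apply, smul_eq_mul, map_mul]
  congr with x
  ring

variable {n : ℕ} {q : Fin (n + 1) → ℝ → ℂ}

/-- The operator `R` extends to a bounded selfadjoint coercive operator
`H^{-k}(ℝ) → H^k(ℝ)`. -/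
theorem exists_operator_of_kernel (hn : 0 < n) (hq : ∀ j, ContDiff ℝ ∞ (q j))
    (hq0 : ∀ x, q (Fin.last n) x ≠ 0)
    (hbot : l2Solutions q (Iio 0) ⊓ l2Solutions q (Ioi 0) = ⊥)
    (hR : LocallyIntegrable (fun z : ℝ × ℝ => R z.1 z.2))
    (hRsymm : ∀ x y, R x y = conj (R y x))
    (hRL2 : ∀ φ, IsTest φ → MemLp (kernelOp R φ) 2 volume) {k : ℕ} {c C : ℝ} (hc : 0 < c)
    (hC : 0 ≤ C)
    (hB : ∀ φ : testSpace univ, c * ‖besselTest (-k) (adjointOp q hq φ)‖ ^ 2 ≤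
        (pairing (kernelOp R (adjointOp q hq φ)) (adjointOp q hq φ)).re ∧
      (pairing (kernelOp R (adjointOp q hq φ)) (adjointOp q hq φ)).re ≤
        C * ‖besselTest (-k) (adjointOp q hq φ)‖ ^ 2) :
    ∃ A : L2Line →L[ℂ] L2Line, (∀ x y, inner ℂ x (A y) = inner ℂ (A x) y) ∧
      (∀ x, c * ‖x‖ ^ 2 ≤ (inner ℂ x (A x)).re ∧ (inner ℂ x (A x)).re ≤ C * ‖x‖ ^ 2) ∧
      ∀ ψ : testSpace univ,
        kernelOp R ψ =ᵐ[volume] sobolevDeriv k 0 (A (besselTest (-k) ψ)) := by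
  set e := (besselTest (-k)).comp (adjointOp q hq) with he
  have hdense : DenseRange e := denseRange_besselTest_adjointOp hn hq hq0 hbot k
  let B : PreInnerProductSpace.Core ℂ (testSpace univ) :=
    { inner := fun φ ψ => pairing (kernelOp R (adjointOp q hq ψ)) (adjointOp q hq φ)
      conj_inner_symm := fun φ ψ =>
        (pairing_kernelOp_symm hR hRsymm (adjointOp q hq ψ).2.1 (adjointOp q hq φ).2.1).symm
      re_inner_nonneg := fun φ => le_trans (by positivity) (hB φ).1
      add_left := fun φ φ' ψ => by
        rw [map_add]
        exact pairing_kernelOp_add_left hRL2 (adjointOp q hq ψ).2.1 (adjointOp q hq φ).2.1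
          (adjointOp q hq φ').2.1
      smul_left := fun φ ψ r => by
        rw [map_smul]
        exact pairing_smul_right _ _ r }
  obtain ⟨A, hAB, hAs, hAc⟩ := exists_operator_of_form B e hdense hC hB
  -- Testing against the range of Q^* is enough: the difference of the two sides is then a weak
  -- solution of Qg = 0 in L²(ℝ), hence zero.
  have hae {ψ : testSpace univ} {G : L2Line}
      (h : ∀ φ : testSpace univ, pairing (kernelOp R ψ) (adjointOp q hq φ) = inner ℂ (e φ) G) :
      kernelOp R ψ =ᵐ[volume] sobolevDeriv k 0 G := by
    have hm := (hRL2 ψ ψ.2.1).sub (Lp.memLp (sobolevDeriv k 0 G))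
    have h0 := ae_eq_zero_of_weak_solution hn hq hq0 hbot hm fun φ hφ => by
      have hQφ := (hφ.formalAdjoint hq).conjugate
      have h1 := h ⟨φ, hφ, subset_univ _⟩
      have h2 := integral_sobolevDeriv_zero_mul_conj k G
        (adjointOp q hq ⟨φ, hφ, subset_univ _⟩)
      simp only [Pi.sub_apply, sub_mul]
      rw [integral_sub (LocallyIntegrable.integrable_mul_isTest
          ((hRL2 ψ ψ.2.1).locallyIntegrable (by norm_num)) hQφ)
        (LocallyIntegrable.integrable_mul_isTest (locallyIntegrable_L2Line _) hQφ)]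
      exact sub_eq_zero.2 (h1.trans h2.symm)
    filter_upwards [h0] with x hx
    exact sub_eq_zero.1 hx
  -- The formula is first obtained for functions Q^*φ. For a general ψ, the symmetry of R transfers
  -- the pairing of Rψ with Q^*φ to this case, and the selfadjointness of A transfers it back.
  have hrange (φ : testSpace univ) := hae (ψ := adjointOp q hq φ) (G := A (e φ))
    fun χ => hAB χ φ
  refine ⟨A, hAs, hAc, fun ψ => hae fun φ => ?_⟩
  rw [pairing_kernelOp_symm hR hRsymm ψ.2.1 (adjointOp q hq φ).2.1]
  have : pairing (kernelOp R (adjointOp q hq φ)) ψ = inner ℂ (besselTest (-k) ψ) (A (e φ)) := by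
    rw [← integral_sobolevDeriv_zero_mul_conj]
    refine integral_congr_ae ?_
    filter_upwards [hrange φ] with x hx
    rw [hx]
  rw [this, inner_conj_symm, hAs]

end Kernel

/-! ### Weak derivatives and local membership in H^k(ℝ). -/

section WeakDerivative

/-- `g` is the weak derivative of `f` on `ℝ`. -/
def HasWeakDeriv (f g : ℝ → ℂ) : Prop :=
  ∀ φ : ℝ → ℂ, IsTest φ → ∫ x, f x * deriv φ x = -∫ x, g x * φ x

lemma IsTest.deriv {φ : ℝ → ℂ} (hφ : IsTest φ) : IsTest (deriv φ) := by
  simpa using hφ.iteratedDeriv 1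

lemma hasWeakDeriv_of_hasDerivAt {f g : ℝ → ℂ} (hd : ∀ x, HasDerivAt f (g x) x)
    (hg : Continuous g) : HasWeakDeriv f g := fun φ hφ => by
  have hf : Continuous f := continuous_iff_continuousAt.2 fun x => (hd x).continuousAt
  rw [integral_mul_deriv_eq_deriv_mul_of_integrable (u := f) (u' := g) (v := φ) (v' := deriv φ)]
  · exact fun x _ => hd x
  · exact fun x _ => ((hφ.1.differentiable (by simp)) x).hasDerivAt
  · exact (hf.mul hφ.deriv.continuous).integrable_of_hasCompactSupport hφ.deriv.2.mul_left
  · exact (hg.mul hφ.continuous).integrable_of_hasCompactSupport hφ.2.mul_left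
  · exact (hf.mul hφ.continuous).integrable_of_hasCompactSupport hφ.2.mul_left

/-- F is merely integrable, so in place of a pointwise derivative Fubini is applied on the region t
≤ x. -/
lemma hasWeakDeriv_integral_Iic {F : ℝ → ℂ} (hF : Integrable F) :
    HasWeakDeriv (fun x => ∫ t in Iic x, F t) F := fun φ hφ => by
  have hφ' : Integrable (deriv φ) := hφ.deriv.continuous.integrable_of_hasCompactSupport hφ.deriv.2
  let g (x t : ℝ) : ℂ := (Iic x).indicator F t * deriv φ x
  have hg : Integrable (Function.uncurry g) (volume.prod volume) := by
    have h1 : Integrable (fun z : ℝ × ℝ => deriv φ z.1 * F z.2) (volume.prod volume) :=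
      hφ'.mul_prod hF
    refine (h1.indicator (measurableSet_le measurable_snd measurable_fst)).congr
      (Eventually.of_forall fun z => ?_)
    by_cases hz : z.2 ≤ z.1
    · simp [g, Function.uncurry, indicator, hz, mul_comm]
    · simp [g, Function.uncurry, indicator, hz]
  calc ∫ x, (∫ t in Iic x, F t) * deriv φ x = ∫ x, ∫ t, g x t := by
        congr with x
        rw [integral_mul_const, integral_indicator measurableSet_Iic]
    _ = ∫ t, ∫ x, g x t := integral_integral_swap hg
    _ = ∫ t, -(F t * φ t) := by
        congr with t
        have h2 : (fun x => g x t) = (Ici t).indicator fun x => F t * deriv φ x := by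
          funext x
          by_cases h : t ≤ x <;> simp [g, indicator, h]
        rw [h2, integral_indicator measurableSet_Ici, integral_Ici_eq_integral_Ioi,
          integral_const_mul, hφ.2.integral_Ioi_deriv_eq (hφ.1.of_le (by exact_mod_cast le_top))]
        ring
    _ = -∫ t, F t * φ t := integral_neg _

/-- Iterated primitives of an integrable function. -/
def iteratedPrimitive (F : ℝ → ℂ) : ℕ → ℝ → ℂ
  | 0 => F
  | 1 => fun x => ∫ t in Iic x, F t
  | i + 2 => fun x => ∫ t in (0 : ℝ)..x, iteratedPrimitive F (i + 1) t

lemma continuous_iteratedPrimitive {F : ℝ → ℂ} (hF : Integrable F) (i : ℕ) :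
    Continuous (iteratedPrimitive F (i + 1)) := by
  induction i with
  | zero =>
    have h : iteratedPrimitive F 1 = fun x => (∫ t in (0 : ℝ)..x, F t) + ∫ t in Iic 0, F t := by
      funext x
      rw [← intervalIntegral.integral_Iic_sub_Iic hF.integrableOn hF.integrableOn, sub_add_cancel]
      rfl
    rw [zero_add, h]
    exact (intervalIntegral.continuous_primitive (fun a b => hF.intervalIntegrable) 0).add
      continuous_const
  | succ i ih => exact intervalIntegral.continuous_primitive (fun a b => ih.intervalIntegrable a b) 0

lemma hasWeakDeriv_iteratedPrimitive {F : ℝ → ℂ} (hF : Integrable F) (i : ℕ) :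
    HasWeakDeriv (iteratedPrimitive F (i + 1)) (iteratedPrimitive F i) := by
  cases i with
  | zero => exact hasWeakDeriv_integral_Iic hF
  | succ i =>
    have hc := continuous_iteratedPrimitive hF i
    exact hasWeakDeriv_of_hasDerivAt (fun x => intervalIntegral.integral_hasDerivAt_right
      (hc.intervalIntegrable _ _) (hc.stronglyMeasurableAtFilter _ _) hc.continuousAt) hc

lemma HasWeakDeriv.integral_mul_iteratedDeriv {f : ℕ → ℝ → ℂ} {i : ℕ}
    (hf : ∀ l < i, HasWeakDeriv (f l) (f (l + 1))) {φ : ℝ → ℂ} (hφ : IsTest φ) :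
    ∫ x, f 0 x * iteratedDeriv i φ x = (-1) ^ i * ∫ x, f i x * φ x := by
  induction i generalizing φ with
  | zero => simp
  | succ i ih =>
    rw [iteratedDeriv_succ', ih (fun l hl => hf l (by omega)) hφ.deriv, hf i (by omega) φ hφ]
    ring

/-- On the Fourier side, differentiation is multiplication by `2πiξ`. -/
lemma fourier_ae_eq_of_weakDeriv {U U' : L2Line}
    (h : ∀ ψ : SchwartzMap ℝ ℂ, ∫ x, U x * conj (deriv ψ x) = -∫ x, U' x * conj (ψ x)) :
    (𝓕 U' : L2Line) =ᵐ[volume] fun ξ => 2 * Real.pi * Complex.I * ξ * (𝓕 U : L2Line) ξ := by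
  have hinner (u : L2Line) (ψ : SchwartzMap ℝ ℂ) :
      inner ℂ (ψ.toLp 2) u = ∫ x, u x * conj (ψ x) := by
    rw [L2.inner_def]
    refine integral_congr_ae ?_
    filter_upwards [ψ.coeFn_toLp 2] with x hx
    rw [hx, RCLike.inner_apply]
  have hc : Continuous fun ξ : ℝ => (2 * Real.pi * Complex.I * ξ : ℂ) := by fun_prop
  have hU := locallyIntegrable_L2Line (𝓕 U)
  have hU' := locallyIntegrable_L2Line (𝓕 U')
  have hmul : LocallyIntegrable fun ξ : ℝ => 2 * Real.pi * Complex.I * ξ * (𝓕 U : L2Line) ξ := by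
    rw [← locallyIntegrableOn_univ] at hU ⊢
    exact hU.continuousOn_mul hc.continuousOn isOpen_univ.isLocallyClosed
  have h0 := ae_eq_zero_of_integral_mul_testSpace_eq_zero isOpen_univ
    (g := fun ξ => (𝓕 U' : L2Line) ξ - 2 * Real.pi * Complex.I * ξ * (𝓕 U : L2Line) ξ)
    ((hU'.sub hmul).locallyIntegrableOn _) fun χ' hχ' => ?_
  · filter_upwards [h0] with ξ hξ using sub_eq_zero.1 (hξ (mem_univ ξ))
  · let χ : testSpace univ := ⟨fun x => conj (χ' x), conj_mem_testSpace hχ'⟩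
    -- The test function lives on the frequency side, so its inverse transform is only a Schwartz
    -- function; hence the hypothesis for all Schwartz ψ.
    let η : SchwartzMap ℝ ℂ := 𝓕⁻ (testSchwartz χ)
    have hη : 𝓕 η = testSchwartz χ := FourierTransform.fourier_fourierInv_eq _
    have hη' (ξ : ℝ) : 𝓕 (SchwartzMap.derivCLM ℂ ℂ η) ξ =
        2 * Real.pi * Complex.I * ξ * (χ : ℝ → ℂ) ξ := by
      have h1 := Real.fourier_deriv (f := η) η.integrable η.differentiable
        (SchwartzMap.derivCLM ℂ ℂ η).integrable
      have h2 : 𝓕 (SchwartzMap.derivCLM ℂ ℂ η) ξ = 𝓕 (deriv η) ξ := rfl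
      rw [h2, h1]
      change (2 * Real.pi * Complex.I * ξ) • (𝓕 η) ξ = _
      rw [hη]
      rfl
    have e1 : ∫ ξ, (𝓕 U' : L2Line) ξ * χ' ξ = ∫ x, U' x * conj (η x) := by
      rw [← hinner, ← Lp.inner_fourier_eq, SchwartzMap.toLp_fourier_eq, hη, hinner]
      congr with ξ
      simp [testSchwartz_apply, χ]
    have e2 : ∫ ξ, 2 * Real.pi * Complex.I * ξ * (𝓕 U : L2Line) ξ * χ' ξ =
        -∫ x, U x * conj (deriv η x) := by
      have : ∫ x, U x * conj (deriv η x) = inner ℂ ((SchwartzMap.derivCLM ℂ ℂ η).toLp 2) U :=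
        (hinner U (SchwartzMap.derivCLM ℂ ℂ η)).symm
      rw [this, ← Lp.inner_fourier_eq, SchwartzMap.toLp_fourier_eq, hinner, ← integral_neg]
      congr with ξ
      rw [hη']
      have hconj : conj (2 : ℂ) = 2 := Complex.conj_ofNat 2
      simp only [χ, map_mul, hconj, Complex.conj_ofReal, Complex.conj_I, Complex.conj_conj]
      ring
    simp only [sub_mul]
    rw [integral_sub (LocallyIntegrable.integrable_mul_isTest hU' hχ'.1)
      (LocallyIntegrable.integrable_mul_isTest hmul hχ'.1), e1, e2, h η]
    ring

/-- `f` agrees almost everywhere with an element of `H^k(ℝ)`. -/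
def MemSobolevLine (k : ℕ) (f : ℝ → ℂ) : Prop :=
  ∃ G : L2Line, f =ᵐ[volume] sobolevDeriv k 0 G

lemma MemSobolevLine.add {k : ℕ} {f g : ℝ → ℂ} (hf : MemSobolevLine k f)
    (hg : MemSobolevLine k g) : MemSobolevLine k fun x => f x + g x := by
  obtain ⟨F, hF⟩ := hf
  obtain ⟨G, hG⟩ := hg
  refine ⟨F + G, ?_⟩
  rw [map_add]
  filter_upwards [hF, hG, Lp.coeFn_add (sobolevDeriv k 0 F) (sobolevDeriv k 0 G)] with x h1 h2 h3
  rw [h1, h2, h3, Pi.add_apply]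

lemma sobolevDeriv_zero_eq_of_fourier {k : ℕ} {G U : L2Line}
    (h : ∀ᵐ ξ, G ξ = weight k ξ * (𝓕 U : L2Line) ξ) : sobolevDeriv k 0 G = U := by
  refine (Lp.fourierTransformₗᵢ ℝ ℂ).injective ?_
  change 𝓕 (sobolevDeriv k 0 G) = 𝓕 U
  rw [fourier_sobolevDeriv]
  refine Lp.ext ?_
  filter_upwards [h, coeFn_mulOp (symbol k 0) G] with ξ h1 h2
  have h3 : ((weight (-k) ξ : ℝ) : ℂ) * weight k ξ = 1 := by
    rw [← Complex.ofReal_mul, weight_neg_mul_self, Complex.ofReal_one]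
  rw [h2, h1, symbol_apply, Fin.val_zero, pow_zero, one_mul, ← mul_assoc, h3, one_mul]

lemma IsTest.memSobolevLine {φ : ℝ → ℂ} (hφ : IsTest φ) (k : ℕ) : MemSobolevLine k φ := by
  let ψ : testSpace univ := ⟨φ, hφ, subset_univ _⟩
  refine ⟨besselTest k ψ, ?_⟩
  rw [sobolevDeriv_zero_eq_of_fourier (U := testL2 ψ)]
  · exact (coeFn_testL2 ψ).symm
  · rw [← besselTest_zero]
    filter_upwards [coeFn_besselTest k ψ, coeFn_besselTest 0 ψ] with ξ h1 h2
    rw [h1, h2, weight_zero, Complex.ofReal_one, one_mul]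

lemma weight_succ_le (k : ℕ) (ξ : ℝ) :
    weight (k + 1 : ℕ) ξ ≤ weight k ξ * (1 + |2 * Real.pi * ξ|) := by
  rw [Nat.cast_add, ← weight_mul]
  refine mul_le_mul_of_nonneg_left ?_ (weight_pos _ _).le
  rw [weight, Nat.cast_one, ← Real.sqrt_eq_rpow, Real.sqrt_le_left (by positivity)]
  nlinarith [sq_abs (2 * Real.pi * ξ), abs_nonneg (2 * Real.pi * ξ)]

/-- The weight of order k + 1 is at most the weight of order k times 1 + |2πξ|, and multiplication
of the transform by 2πiξ gives the transform of the derivative. So the new weighted transform is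
dominated by |F| + |G|. -/
lemma MemSobolevLine.succ {k : ℕ} {f g : ℝ → ℂ} (hf : MemSobolevLine k f)
    (hg : MemSobolevLine k g)
    (h : ∀ ψ : SchwartzMap ℝ ℂ, ∫ x, f x * conj (deriv ψ x) = -∫ x, g x * conj (ψ x)) :
    MemSobolevLine (k + 1) f := by
  obtain ⟨F, hF⟩ := hf
  obtain ⟨G, hG⟩ := hg
  set U := sobolevDeriv k 0 F with hU
  set U' := sobolevDeriv k 0 G with hU'
  have hfour : (𝓕 U' : L2Line) =ᵐ[volume]
      fun ξ => 2 * Real.pi * Complex.I * ξ * (𝓕 U : L2Line) ξ := by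
    refine fourier_ae_eq_of_weakDeriv fun ψ => ?_
    have h1 : ∫ x, U x * conj (deriv ψ x) = ∫ x, f x * conj (deriv ψ x) :=
      integral_congr_ae (by filter_upwards [hF] with x hx; rw [hx])
    have h2 : ∫ x, U' x * conj (ψ x) = ∫ x, g x * conj (ψ x) :=
      integral_congr_ae (by filter_upwards [hG] with x hx; rw [hx])
    rw [h1, h2, h ψ]
  have hfs (G : L2Line) : ∀ᵐ ξ, G ξ = weight k ξ * (𝓕 (sobolevDeriv k 0 G) : L2Line) ξ := by
    rw [fourier_sobolevDeriv]
    filter_upwards [coeFn_mulOp (symbol k 0) G] with ξ h2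
    have h3 : ((weight (-k) ξ : ℝ) : ℂ) * weight k ξ = 1 := by
      rw [← Complex.ofReal_mul, weight_neg_mul_self, Complex.ofReal_one]
    rw [h2, symbol_apply, Fin.val_zero, pow_zero, one_mul]
    linear_combination (-G ξ) * h3
  have hm : MemLp (fun ξ => (weight (k + 1 : ℕ) ξ : ℂ) * (𝓕 U : L2Line) ξ) 2 volume := by
    refine MemLp.of_le (g := fun ξ => ‖F ξ‖ + ‖G ξ‖) ((Lp.memLp F).norm.add (Lp.memLp G).norm)
      ((Complex.continuous_ofReal.comp (continuous_weight _)).aestronglyMeasurable.mul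
        (Lp.aestronglyMeasurable _)) ?_
    filter_upwards [hfs F, hfs G, hfour] with ξ h1 h2 h3
    rw [norm_mul, Complex.norm_real, Real.norm_of_nonneg (weight_pos _ _).le,
      Real.norm_of_nonneg (by positivity), h1, h2, h3]
    have h4 : ‖(2 * Real.pi * Complex.I * ξ : ℂ)‖ = |2 * Real.pi * ξ| := by simp [abs_mul]
    simp only [norm_mul (weight k ξ : ℂ), norm_mul _ ((𝓕 U : L2Line) ξ), h4, Complex.norm_real,
      Real.norm_of_nonneg (weight_pos _ _).le]
    have := mul_le_mul_of_nonneg_right (weight_succ_le k ξ) (norm_nonneg ((𝓕 U : L2Line) ξ))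
    linarith
  refine ⟨hm.toLp, ?_⟩
  rw [sobolevDeriv_zero_eq_of_fourier (U := U) hm.coeFn_toLp]
  exact hF

/-- A function with `k` locally square integrable weak derivatives is locally in `H^k(ℝ)`. -/
theorem memSobolevLine_mul {k : ℕ} {f : ℕ → ℝ → ℂ} (hm : ∀ l ≤ k, ∀ θ, IsTest θ →
      MemLp (fun x => θ x * f l x) 2 volume) (hl : ∀ l ≤ k, LocallyIntegrable (f l))
    (hd : ∀ l < k, HasWeakDeriv (f l) (f (l + 1))) {θ : ℝ → ℂ} (hθ : IsTest θ) :
    MemSobolevLine k fun x => θ x * f 0 x := by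
  induction k generalizing f θ with
  | zero =>
    have h := hm 0 le_rfl θ hθ
    refine ⟨𝓕 h.toLp, ?_⟩
    rw [sobolevDeriv_zero_eq_of_fourier (U := h.toLp)]
    · exact h.coeFn_toLp.symm
    · exact Eventually.of_forall fun ξ => by simp [weight_zero]
  | succ k ih =>
    have ih0 (θ : ℝ → ℂ) (hθ : IsTest θ) := ih (f := f) (fun l h => hm l (by omega))
      (fun l h => hl l (by omega)) (fun l h => hd l (by omega)) hθ
    have ih1 := ih (f := fun l => f (l + 1)) (fun l h => hm (l + 1) (by omega))
      (fun l h => hl (l + 1) (by omega)) (fun l h => hd (l + 1) (by omega)) hθ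
    -- By Leibniz the weak derivative of θ f₀ is θ' f₀ + θ f₁. Both summands lie in H^k, the second
    -- by induction applied to the shifted sequence.
    refine (ih0 θ hθ).succ ((ih0 _ hθ.deriv).add ih1) fun ψ => ?_
    have hψ : ContDiff ℝ ∞ fun x => conj (ψ x) := contDiff_conj ψ.smooth'
    have hψd (x : ℝ) : HasDerivAt (fun x => conj (ψ x)) (conj (deriv ψ x)) x :=
      (ψ.differentiable x).hasDerivAt.star
    have hψ' : ContDiff ℝ ∞ fun x => conj (deriv ψ x) := by
      have := contDiff_iteratedDeriv hψ 1
      rwa [iteratedDeriv_one, show deriv (fun x => conj (ψ x)) = fun x => conj (deriv ψ x) from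
        funext fun x => (hψd x).deriv] at this
    have h0 := hd 0 (by omega) _ (hθ.mul_right hψ)
    have hder (x : ℝ) : deriv (fun x => θ x * conj (ψ x)) x =
        deriv θ x * conj (ψ x) + θ x * conj (deriv ψ x) :=
      (((hθ.1.differentiable (by simp)) x).hasDerivAt.mul (hψd x)).deriv
    simp only [hder, mul_add] at h0
    rw [integral_add
      (LocallyIntegrable.integrable_mul_isTest (hl 0 (by omega)) (hθ.deriv.mul_right hψ))
      (LocallyIntegrable.integrable_mul_isTest (hl 0 (by omega)) (hθ.mul_right hψ'))] at h0
    have e1 : ∫ x, θ x * f 0 x * conj (deriv ψ x) = ∫ x, f 0 x * (θ x * conj (deriv ψ x)) := by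
      congr with x; ring
    have e2 : ∫ x, (deriv θ x * f 0 x + θ x * f (0 + 1) x) * conj (ψ x) =
        (∫ x, f 0 x * (deriv θ x * conj (ψ x))) + ∫ x, f (0 + 1) x * (θ x * conj (ψ x)) := by
      rw [← integral_add
        (LocallyIntegrable.integrable_mul_isTest (hl 0 (by omega)) (hθ.deriv.mul_right hψ))
        (LocallyIntegrable.integrable_mul_isTest (hl (0 + 1) (by omega)) (hθ.mul_right hψ))]
      congr with x; ring
    rw [e1, e2]
    linear_combination h0

end WeakDerivative

/-! ### The space H^k(0,L) and extension to the line. -/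

section Restriction

variable {k : ℕ} {L : ℝ}

lemma memLp_isTest {φ : ℝ → ℂ} (hφ : IsTest φ) (μ : Measure ℝ) [IsFiniteMeasureOnCompacts μ] :
    MemLp φ 2 μ :=
  hφ.continuous.memLp_of_hasCompactSupport hφ.2

lemma mem_sobolevInterval {u : PiLp 2 (fun _ : Fin (k + 1) => L2Interval L)} :
    u ∈ SobolevInterval k L ↔ ∀ j : Fin (k + 1), ∀ φ ∈ testSpace (Ioo 0 L),
      ∫ x in Ioo 0 L, (u 0 : ℝ → ℂ) x * iteratedDeriv (j : ℕ) φ x =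
        (-1 : ℂ) ^ (j : ℕ) * ∫ x in Ioo 0 L, (u j : ℝ → ℂ) x * φ x :=
  ⟨fun h j φ hφ => h j φ hφ.1 hφ.2, fun h j φ h1 h2 => h j φ ⟨h1, h2⟩⟩

lemma continuous_integral_mul_isTest {ψ : ℝ → ℂ} (hψ : IsTest ψ) :
    Continuous fun w : L2Interval L => ∫ x in Ioo 0 L, (w : ℝ → ℂ) x * ψ x := by
  have hm : MemLp (fun x => conj (ψ x)) 2 (volume.restrict (Ioo 0 L)) :=
    memLp_isTest hψ.conjugate _
  have : (fun w : L2Interval L => ∫ x in Ioo 0 L, (w : ℝ → ℂ) x * ψ x) =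
      fun w => inner ℂ (hm.toLp) w := by
    funext w
    rw [L2.inner_def]
    refine integral_congr_ae ?_
    filter_upwards [hm.coeFn_toLp] with x hx
    rw [hx, RCLike.inner_apply, Complex.conj_conj]
  rw [this]
  fun_prop

/-- Each defining condition equates two continuous functions of u. The completeness that follows
makes Riesz representation and adjoints available on H^k(0,L). -/
lemma isClosed_sobolevInterval (k : ℕ) (L : ℝ) :
    IsClosed (SobolevInterval k L : Set (PiLp 2 (fun _ : Fin (k + 1) => L2Interval L))) := by
  have : (SobolevInterval k L : Set (PiLp 2 (fun _ : Fin (k + 1) => L2Interval L))) =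
      ⋂ (j : Fin (k + 1)) (φ : testSpace (Ioo 0 L)),
        {u | ∫ x in Ioo 0 L, (u 0 : ℝ → ℂ) x * iteratedDeriv (j : ℕ) φ x =
          (-1 : ℂ) ^ (j : ℕ) * ∫ x in Ioo 0 L, (u j : ℝ → ℂ) x * (φ : ℝ → ℂ) x} := by
    ext u
    rw [SetLike.mem_coe, mem_sobolevInterval]
    simp
  rw [this]
  refine isClosed_iInter fun j => isClosed_iInter fun φ => isClosed_eq ?_ ?_
  · exact (continuous_integral_mul_isTest (φ.2.1.iteratedDeriv j)).comp
      (PiLp.continuous_apply 2 _ 0)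
  · exact continuous_const.mul ((continuous_integral_mul_isTest φ.2.1).comp
      (PiLp.continuous_apply 2 _ j))

instance completeSpace_sobolevInterval (k : ℕ) (L : ℝ) : CompleteSpace (SobolevInterval k L) :=
  (isClosed_sobolevInterval k L).completeSpace_coe

lemma toL2_apply (u : SobolevInterval k L) : SobolevInterval.toL2 k L u = u.1 0 := rfl

lemma ae_eq_of_integral_mul_testSpace_Ioo {f g : ℝ → ℂ}
    (hf : IntegrableOn f (Ioo 0 L)) (hg : IntegrableOn g (Ioo 0 L))
    (h : ∀ φ ∈ testSpace (Ioo 0 L), ∫ x in Ioo 0 L, f x * φ x = ∫ x in Ioo 0 L, g x * φ x) :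
    f =ᵐ[volume.restrict (Ioo 0 L)] g := by
  have h0 := ae_eq_zero_of_integral_mul_testSpace_eq_zero isOpen_Ioo (g := f - g)
    (hf.sub hg).locallyIntegrableOn fun φ hφ => by
      have hb : ∀ u : ℝ → ℂ, IntegrableOn u (Ioo 0 L) →
          Integrable (fun x => u x * φ x) (volume.restrict (Ioo 0 L)) := fun u hu => by
        obtain ⟨C, hC⟩ := hφ.1.continuous.bounded_above_of_compact_support hφ.1.2
        exact hu.mul_bdd hφ.1.continuous.aestronglyMeasurable (Eventually.of_forall hC)
      rw [← setIntegral_eq_integral_of_forall_compl_eq_zero (s := Ioo 0 L) fun x hx => by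
        rw [image_eq_zero_of_notMem_tsupport fun h => hx (hφ.2 h), mul_zero]]
      simp only [Pi.sub_apply, sub_mul]
      rw [integral_sub (hb f hf) (hb g hg), h φ hφ, sub_self]
  refine (ae_restrict_iff' measurableSet_Ioo).2 ?_
  filter_upwards [h0] with x hx hxI
  exact sub_eq_zero.1 (hx hxI)

lemma integrableOn_L2Interval (w : L2Interval L) : IntegrableOn w (Ioo 0 L) :=
  (Lp.memLp w).integrable (by norm_num)

/-- Weak derivatives are determined by the function itself, so equalities in H^k(0,L) may be checked
on the underlying functions. -/
lemma toL2_injective : Function.Injective (SobolevInterval.toL2 k L) := by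
  rw [injective_iff_map_eq_zero]
  intro u hu
  rw [toL2_apply] at hu
  ext1
  ext1 j
  refine Lp.ext ?_
  refine (ae_eq_of_integral_mul_testSpace_Ioo (integrableOn_L2Interval _)
    (integrableOn_zero) fun φ hφ => ?_).trans (Lp.coeFn_zero _ _ _).symm
  have h1 := mem_sobolevInterval.1 u.2 j φ hφ
  have h2 : ∫ x in Ioo 0 L, (u.1 0 : ℝ → ℂ) x * iteratedDeriv (j : ℕ) φ x = 0 := by
    rw [hu]
    refine integral_eq_zero_of_ae ?_
    filter_upwards [Lp.coeFn_zero ℂ 2 (volume.restrict (Ioo (0 : ℝ) L))] with x hx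
    rw [hx]
    simp
  rw [h2, eq_comm, mul_eq_zero] at h1
  simpa using h1.resolve_left (by simp)

/-- The derivatives of orders `j ≤ k` of an element of `H^k(ℝ)`, restricted to `(0,L)`. -/
def restrictTuple (k : ℕ) (L : ℝ) : L2Line →L[ℂ] PiLp 2 (fun _ : Fin (k + 1) => L2Interval L) :=
  ((PiLp.continuousLinearEquiv 2 ℂ (fun _ : Fin (k + 1) => L2Interval L)).symm :
    (Fin (k + 1) → L2Interval L) →L[ℂ] PiLp 2 (fun _ : Fin (k + 1) => L2Interval L)).comp
    (ContinuousLinearMap.pi fun j =>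
      (LpToLpRestrictCLM ℝ ℂ ℂ volume 2 (Ioo 0 L)).comp (sobolevDeriv k j))

lemma coeFn_restrictTuple (G : L2Line) (j : Fin (k + 1)) :
    (restrictTuple k L G j : ℝ → ℂ) =ᵐ[volume.restrict (Ioo 0 L)] sobolevDeriv k j G :=
  LpToLpRestrictCLM_coeFn ℂ (Ioo 0 L) (sobolevDeriv k j G)

lemma setIntegral_mul_testSpace {u : ℝ → ℂ} {I : Set ℝ} {φ : ℝ → ℂ} (hφ : φ ∈ testSpace I) :
    ∫ x in I, u x * φ x = ∫ x, u x * φ x :=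
  setIntegral_eq_integral_of_forall_compl_eq_zero fun x hx => by
    rw [image_eq_zero_of_notMem_tsupport fun h => hx (hφ.2 h), mul_zero]

lemma iteratedDeriv_mem_testSpace {I : Set ℝ} {φ : ℝ → ℂ} (hφ : φ ∈ testSpace I) (j : ℕ) :
    iteratedDeriv j φ ∈ testSpace I :=
  ⟨hφ.1.iteratedDeriv j, (tsupport_iteratedDeriv_subset φ j).trans hφ.2⟩

lemma restrictTuple_mem (G : L2Line) : restrictTuple k L G ∈ SobolevInterval k L := by
  rw [mem_sobolevInterval]
  intro j φ hφ
  have key (i : Fin (k + 1)) (ψ : ℝ → ℂ) (hψ : ψ ∈ testSpace (Ioo 0 L)) :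
      ∫ x in Ioo 0 L, (restrictTuple k L G i : ℝ → ℂ) x * ψ x =
        ∫ x, sobolevDeriv k i G x * ψ x := by
    rw [← setIntegral_mul_testSpace hψ]
    refine integral_congr_ae ?_
    filter_upwards [coeFn_restrictTuple G i] with x hx
    rw [hx]
  rw [key 0 _ (iteratedDeriv_mem_testSpace hφ j), key j φ hφ]
  let ψ : testSpace univ := ⟨fun x => conj (φ x), coe_mem_testSpace_univ (conj_mem_testSpace hφ)⟩
  have h1 := integral_mul_conj_eq_inner (sobolevDeriv k j G) ψ
  have h2 := integral_sobolevDeriv_zero_mul_conj k G (testDeriv j ψ)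
  rw [inner_sobolevDeriv, ← h2] at h1
  have h3 (x : ℝ) : conj ((testDeriv j ψ : ℝ → ℂ) x) = iteratedDeriv j φ x := by
    change conj (iteratedDeriv j (fun x => conj (φ x)) x) = _
    rw [iteratedDeriv_conj, Complex.conj_conj]
  simp only [h3, ψ, Complex.conj_conj] at h1
  rw [h1, ← mul_assoc, ← mul_pow]
  simp

/-- Restriction of elements of `H^k(ℝ)` to `(0,L)`. -/
def restriction (k : ℕ) (L : ℝ) : L2Line →L[ℂ] SobolevInterval k L :=
  (restrictTuple k L).codRestrict _ restrictTuple_mem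

lemma coeFn_toL2_restriction (G : L2Line) :
    SobolevInterval.toL2 k L (restriction k L G) =ᵐ[volume.restrict (Ioo 0 L)]
      sobolevDeriv k 0 G :=
  coeFn_restrictTuple G 0

/-- The coefficients of the operator `(d/dx)^k`. -/
def powCoeff (k : ℕ) (j : Fin (k + 1)) (_ : ℝ) : ℂ := if j = Fin.last k then 1 else 0

lemma formalAdjoint_powCoeff (φ : ℝ → ℂ) (x : ℝ) :
    formalAdjoint (powCoeff k) φ x = (-1) ^ k * iteratedDeriv k φ x := by
  rw [formalAdjoint, Finset.sum_eq_single (Fin.last k)]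
  · simp [powCoeff]
  · intro j _ hj
    simp [powCoeff, hj]
  · simp

/-- Every element of `H^k(0,L)` extends to an element of `H^k(ℝ)`. -/
theorem restriction_surjective (hk : 0 < k) (hL : 0 < L) :
    Function.Surjective (restriction k L) := by
  intro u
  set F : ℝ → ℂ := (Ioo 0 L).indicator (u.1 (Fin.last k)) with hF
  have hFi : Integrable F := (integrableOn_L2Interval _).integrable_indicator measurableSet_Ioo
  have hF2 : MemLp F 2 volume := (memLp_indicator_iff_restrict measurableSet_Ioo).2 (Lp.memLp _)
  -- With F the top derivative of u extended by zero, f l is the (k - l)-fold primitive of F. So f 0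
  -- is a function on ℝ with k locally square integrable weak derivatives, the last one being F.
  set f : ℕ → ℝ → ℂ := fun l => iteratedPrimitive F (k - l) with hf
  have hfk : f k = F := by simp [hf, iteratedPrimitive]
  have hfc (l : ℕ) (hl : l < k) : Continuous (f l) := by
    simp only [hf]
    rw [show k - l = k - l - 1 + 1 by omega]
    exact continuous_iteratedPrimitive hFi _
  have hd (l : ℕ) (hl : l < k) : HasWeakDeriv (f l) (f (l + 1)) := by
    simp only [hf]
    rw [show k - l = k - (l + 1) + 1 by omega]
    exact hasWeakDeriv_iteratedPrimitive hFi _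
  have hfl (l : ℕ) (hl : l ≤ k) : LocallyIntegrable (f l) := by
    rcases hl.lt_or_eq with h | rfl
    · exact (hfc l h).locallyIntegrable
    · rw [hfk]; exact hFi.locallyIntegrable
  have hfm (l : ℕ) (hl : l ≤ k) (θ : ℝ → ℂ) (hθ : IsTest θ) :
      MemLp (fun x => θ x * f l x) 2 volume := by
    rcases hl.lt_or_eq with h | rfl
    · exact (hθ.continuous.mul (hfc l h)).memLp_of_hasCompactSupport hθ.2.mul_right
    · rw [hfk]
      obtain ⟨C, hC⟩ := hθ.continuous.bounded_above_of_compact_support hθ.2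
      refine hF2.of_le_mul (c := C) (hθ.continuous.aestronglyMeasurable.mul hF2.1)
        (Eventually.of_forall fun x => ?_)
      rw [norm_mul]
      exact mul_le_mul_of_nonneg_right (hC x) (norm_nonneg _)
  set g : ℝ → ℂ := (Ioo 0 L).indicator (u.1 0) with hg
  have hgi : LocallyIntegrable g :=
    ((integrableOn_L2Interval _).integrable_indicator measurableSet_Ioo).locallyIntegrable
  have hind (w : ℝ → ℂ) {φ : ℝ → ℂ} (hφ : φ ∈ testSpace (Ioo 0 L)) :
      ∫ x, (Ioo 0 L).indicator w x * φ x = ∫ x in Ioo 0 L, w x * φ x := by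
    rw [← integral_indicator measurableSet_Ioo]
    congr with x
    by_cases hx : x ∈ Ioo 0 L <;> simp [hx]
  -- On (0,L) the functions u and f 0 have the same k-th weak derivative, so u - f 0 is a smooth
  -- solution s of s^{(k)} = 0, that is, of the equation with coefficients `powCoeff k`.
  obtain ⟨s, hs, hgs⟩ := exists_solution_ae_eq (q := powCoeff k) hk (fun j => contDiff_const)
    (fun x => by simp [powCoeff]) (isOpen_Ioo (a := (0 : ℝ)) (b := L)) ordConnected_Ioo
    (nonempty_Ioo.2 hL) (hgi.sub (hfl 0 (by omega))) fun φ hφ => by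
      have hφc := conj_mem_testSpace hφ
      have hφk := iteratedDeriv_mem_testSpace hφc k
      have h1 := mem_sobolevInterval.1 u.2 (Fin.last k) _ hφc
      rw [Fin.val_last, ← hind _ hφk, ← hind _ hφc] at h1
      have h2 := HasWeakDeriv.integral_mul_iteratedDeriv hd hφc.1
      rw [hfk] at h2
      have h3 (x : ℝ) : conj (formalAdjoint (powCoeff k) φ x) =
          (-1) ^ k * iteratedDeriv k (fun x => conj (φ x)) x := by
        rw [formalAdjoint_powCoeff, iteratedDeriv_conj]
        simp
      simp only [h3, Pi.sub_apply]
      have h4 (x : ℝ) : (g x - f 0 x) * ((-1) ^ k * iteratedDeriv k (fun x => conj (φ x)) x) =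
          (-1) ^ k * (g x * iteratedDeriv k (fun x => conj (φ x)) x -
            f 0 x * iteratedDeriv k (fun x => conj (φ x)) x) := by ring
      simp only [h4]
      rw [integral_const_mul, integral_sub (LocallyIntegrable.integrable_mul_isTest hgi hφk.1)
        (LocallyIntegrable.integrable_mul_isTest (hfl 0 (by omega)) hφk.1), h1, h2, sub_self,
        mul_zero]
  -- The extension of u is θ (f 0 + s).
  obtain ⟨θ, hθ, hθ1⟩ := exists_isTest_eq_one 0 L
  obtain ⟨G, hG⟩ := (memSobolevLine_mul hfm hfl hd hθ).add
    ((hθ.mul_right (mem_l2Solutions_empty.1 hs).1).memSobolevLine k)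
  refine ⟨G, toL2_injective (Lp.ext ((coeFn_toL2_restriction G).trans ?_))⟩
  refine (ae_restrict_iff' measurableSet_Ioo).2 ?_
  filter_upwards [hG, hgs] with x h1 h2 hx
  rw [← h1, hθ1 x (Ioo_subset_Icc_self hx), one_mul, one_mul, ← h2 hx, Pi.sub_apply, hg,
    indicator_of_mem hx, add_sub_cancel]
  rfl

end Restriction

/-! ### Essential boundedness of a kernel whose form is bounded on L¹. -/

section BoundedKernel

variable {R : ℝ → ℝ → ℂ}

/-- A smooth approximation from above of the indicator function of `[a - δ, a + δ]`. -/
def ballApprox (a δ : ℝ) (hδ : 0 < δ) (j : ℕ) : ContDiffBump a where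
  rIn := δ
  rOut := δ + 1 / ((j : ℝ) + 1)
  rIn_pos := hδ
  rIn_lt_rOut := lt_add_of_pos_right _ Nat.one_div_pos_of_nat

lemma ballApprox_isTest (a δ : ℝ) (hδ : 0 < δ) (j : ℕ) :
    IsTest fun x => (ballApprox a δ hδ j x : ℂ) :=
  IsTest.ofReal (ballApprox a δ hδ j).contDiff (ballApprox a δ hδ j).hasCompactSupport

lemma tendsto_ballApprox (a δ : ℝ) (hδ : 0 < δ) (x : ℝ) :
    Tendsto (fun j => (ballApprox a δ hδ j x : ℂ)) atTop
      (𝓝 ((Metric.closedBall a δ).indicator (fun _ => 1) x)) := by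
  by_cases hx : x ∈ Metric.closedBall a δ
  · rw [indicator_of_mem hx]
    refine tendsto_const_nhds.congr fun j => ?_
    rw [(ballApprox a δ hδ j).one_of_mem_closedBall hx, Complex.ofReal_one]
  · rw [indicator_of_notMem hx]
    rw [Metric.mem_closedBall, not_le, ← sub_pos] at hx
    refine tendsto_const_nhds.congr' ?_
    filter_upwards [(tendsto_one_div_add_atTop_nhds_zero_nat (𝕜 := ℝ)).eventually_lt_const hx]
      with j hj
    rw [(ballApprox a δ hδ j).zero_of_le_dist, Complex.ofReal_zero]
    change δ + 1 / ((j : ℝ) + 1) ≤ dist x a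
    linarith

lemma integral_norm_ballApprox_le (a δ : ℝ) (hδ : 0 < δ) (j : ℕ) :
    ∫ x, ‖(ballApprox a δ hδ j x : ℂ)‖ ≤ 2 * (δ + 1 / ((j : ℝ) + 1)) := by
  have h := (ballApprox a δ hδ j).integral_le_measure_closedBall volume
  rw [Real.volume_real_closedBall (ballApprox a δ hδ j).rOut_pos.le] at h
  refine le_of_eq_of_le (integral_congr_ae (Eventually.of_forall fun x => ?_)) h
  simp only [Complex.norm_real]
  exact Real.norm_of_nonneg (ballApprox a δ hδ j).nonneg

/-- A ball of ℝ × ℝ in the sup metric is a square, and its indicator is a limit of products of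
one-dimensional bump functions. These are admissible in `hC`, and dominated convergence passes to
the limit. -/
lemma norm_setIntegral_kernel_le (hR : LocallyIntegrable (fun z : ℝ × ℝ => R z.1 z.2)) {C : ℝ}
    (hC0 : 0 ≤ C) (hC : ∀ φ χ : ℝ → ℂ, IsTest φ → IsTest χ →
      ‖∫ z : ℝ × ℝ, R z.1 z.2 * φ z.2 * χ z.1‖ ≤ C * (∫ x, ‖φ x‖) * ∫ x, ‖χ x‖)
    (z : ℝ × ℝ) {δ : ℝ} (hδ : 0 < δ) :
    ‖∫ w in Metric.closedBall z δ, R w.1 w.2‖ ≤ C * (2 * δ) * (2 * δ) := by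
  obtain ⟨a, b⟩ := z
  let f (j : ℕ) (w : ℝ × ℝ) : ℂ :=
    R w.1 w.2 * (ballApprox b δ hδ j w.2 : ℂ) * (ballApprox a δ hδ j w.1 : ℂ)
  have hlim : Tendsto (fun j => ∫ w, f j w) atTop
      (𝓝 (∫ w, (Metric.closedBall (a, b) δ).indicator (fun w => R w.1 w.2) w)) := by
    refine tendsto_integral_of_dominated_convergence
      ((Metric.closedBall (a, b) (δ + 1)).indicator fun w => ‖R w.1 w.2‖) (fun j => ?_)
      (IntegrableOn.integrable_indicator
        (hR.integrableOn_isCompact (isCompact_closedBall _ _)).norm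
        Metric.isClosed_closedBall.measurableSet) (fun j => Eventually.of_forall fun w => ?_)
      (Eventually.of_forall fun w => ?_)
    · exact (integrable_kernel_mul hR (ballApprox_isTest b δ hδ j)
        (ballApprox_isTest a δ hδ j)).aestronglyMeasurable
    · have h1 : 1 / ((j : ℝ) + 1) ≤ 1 := by
        rw [div_le_one (by positivity)]
        linarith [(Nat.cast_nonneg j : (0 : ℝ) ≤ j)]
      by_cases hw : w ∈ Metric.closedBall (a, b) (δ + 1)
      · rw [indicator_of_mem hw, norm_mul, norm_mul, Complex.norm_real, Complex.norm_real,
          Real.norm_of_nonneg (ballApprox b δ hδ j).nonneg,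
          Real.norm_of_nonneg (ballApprox a δ hδ j).nonneg, mul_assoc]
        exact mul_le_of_le_one_right (norm_nonneg _)
          (mul_le_one₀ (ballApprox b δ hδ j).le_one (ballApprox a δ hδ j).nonneg
            (ballApprox a δ hδ j).le_one)
      · rw [indicator_of_notMem hw, norm_le_zero_iff]
        rw [← closedBall_prod_same, mem_prod, not_and_or, Metric.mem_closedBall,
          Metric.mem_closedBall, not_le, not_le] at hw
        rcases hw with hw | hw
        · have : ballApprox a δ hδ j w.1 = 0 := (ballApprox a δ hδ j).zero_of_le_dist
            (show δ + 1 / ((j : ℝ) + 1) ≤ _ by linarith)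
          simp [f, this]
        · have : ballApprox b δ hδ j w.2 = 0 := (ballApprox b δ hδ j).zero_of_le_dist
            (show δ + 1 / ((j : ℝ) + 1) ≤ _ by linarith)
          simp [f, this]
    · have h := (tendsto_const_nhds (x := R w.1 w.2)).mul (tendsto_ballApprox b δ hδ w.2) |>.mul
        (tendsto_ballApprox a δ hδ w.1)
      convert h using 2
      rw [← closedBall_prod_same]
      by_cases h1 : w.1 ∈ Metric.closedBall a δ <;> by_cases h2 : w.2 ∈ Metric.closedBall b δ <;>
        simp only [indicator, mem_prod, h1, h2] <;> simp
  rw [integral_indicator Metric.isClosed_closedBall.measurableSet] at hlim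
  have hlim2 : Tendsto (fun j : ℕ => C * (2 * (δ + 1 / ((j : ℝ) + 1))) *
      (2 * (δ + 1 / ((j : ℝ) + 1)))) atTop (𝓝 (C * (2 * (δ + 0)) * (2 * (δ + 0)))) := by
    have h := (tendsto_one_div_add_atTop_nhds_zero_nat (𝕜 := ℝ)).const_add δ |>.const_mul 2
    exact (h.const_mul C).mul h
  rw [add_zero] at hlim2
  refine le_of_tendsto_of_tendsto' hlim.norm hlim2 fun j => ?_
  refine (hC _ _ (ballApprox_isTest b δ hδ j) (ballApprox_isTest a δ hδ j)).trans ?_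
  gcongr
  · exact integral_norm_ballApprox_le b δ hδ j
  · exact integral_norm_ballApprox_le a δ hδ j

/-- A kernel whose form is bounded on `L¹` is essentially bounded. -/
theorem ae_norm_kernel_le (hR : LocallyIntegrable (fun z : ℝ × ℝ => R z.1 z.2)) {C : ℝ}
    (hC0 : 0 ≤ C) (hC : ∀ φ χ : ℝ → ℂ, IsTest φ → IsTest χ →
      ‖∫ z : ℝ × ℝ, R z.1 z.2 * φ z.2 * χ z.1‖ ≤ C * (∫ x, ‖φ x‖) * ∫ x, ‖χ x‖) :
    ∀ᵐ z : ℝ × ℝ, ‖R z.1 z.2‖ ≤ C := by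
  -- Lebesgue differentiation: almost every value of R is a limit of averages over squares, each of
  -- norm at most C.
  filter_upwards [IsUnifLocDoublingMeasure.ae_tendsto_average volume hR 1] with z hz
  have h := hz (ι := ℝ) (l := 𝓝[>] 0) (fun _ => z) id tendsto_id
    (eventually_mem_nhdsWithin.mono fun δ hδ => Metric.mem_closedBall_self
      (by rw [one_mul]; exact le_of_lt hδ))
  refine le_of_tendsto h.norm (eventually_mem_nhdsWithin.mono fun δ (hδ : 0 < δ) => ?_)
  have hvol : volume.real (Metric.closedBall z δ) = (2 * δ) * (2 * δ) := by
    rw [← closedBall_prod_same (x := z.1) (y := z.2), Measure.volume_eq_prod,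
      measureReal_prod_prod, Real.volume_real_closedBall hδ.le, Real.volume_real_closedBall hδ.le]
  rw [id, setAverage_eq, hvol, norm_smul, Real.norm_of_nonneg (by positivity),
    inv_mul_le_iff₀ (by positivity)]
  refine (norm_setIntegral_kernel_le hR hC0 hC z hδ).trans (le_of_eq ?_)
  ring

end BoundedKernel

/-! ### Coercive operators and surjections. -/

section Congruence

variable {H V : Type*} [NormedAddCommGroup H] [InnerProductSpace ℂ H] [CompleteSpace H]
  [NormedAddCommGroup V] [InnerProductSpace ℂ V] [CompleteSpace V]

/-- The identification of a Hilbert space with the bounded antilinear functionals on it. -/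
def antidualEquiv (V : Type*) [NormedAddCommGroup V] [InnerProductSpace ℂ V] [CompleteSpace V] :
    V ≃L[ℂ] (V →L⋆[ℂ] ℂ) :=
  ContinuousLinearEquiv.ofBijective (innerSL ℂ (E := V)).flip
    (LinearMap.ker_eq_bot'.2 fun v hv => by
      have h : inner ℂ v v = 0 := DFunLike.congr_fun hv v
      exact inner_self_eq_zero.1 h)
    (LinearMap.range_eq_top.2 fun ℓ => by
      let ℓ' : V →L[ℂ] ℂ := (starL ℂ : ℂ ≃L⋆[ℂ] ℂ).toContinuousLinearMap.comp ℓ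
      refine ⟨(InnerProductSpace.toDual ℂ V).symm ℓ', ContinuousLinearMap.ext fun g => ?_⟩
      change inner ℂ g ((InnerProductSpace.toDual ℂ V).symm ℓ') = ℓ g
      rw [← inner_conj_symm, InnerProductSpace.toDual_symm_apply]
      exact Complex.conj_conj _)

lemma antidualEquiv_apply (v g : V) : antidualEquiv V v g = inner ℂ g v := rfl

/-- The compression of a coercive operator to a quotient is an isomorphism. -/
theorem exists_equiv_of_coercive {A : H →L[ℂ] H} {c : ℝ} (hc : 0 < c)
    (hA : ∀ x, c * ‖x‖ ^ 2 ≤ (inner ℂ x (A x)).re) {r : H →L[ℂ] V}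
    (hr : Function.Surjective r) :
    ∃ T : V ≃L[ℂ] V, ∀ v, T v = r (A (r.adjoint v)) := by
  -- By the open mapping theorem r has preimages with norm bound K, which makes the adjoint of r
  -- bounded below by 1/K. Then rAr^* is coercive with constant c / K², and Lax–Milgram applies.
  obtain ⟨K, hK, hpre⟩ := r.exists_preimage_norm_le hr
  have hbelow (v : V) : ‖v‖ ≤ K * ‖r.adjoint v‖ := by
    obtain ⟨x, hx, hxK⟩ := hpre v
    rcases (norm_nonneg v).eq_or_lt with h0 | h0
    · rw [← h0]; positivity
    refine le_of_mul_le_mul_right ?_ h0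
    calc ‖v‖ * ‖v‖ = ‖inner ℂ v (r x)‖ := by
          rw [hx, inner_self_eq_norm_sq_to_K]
          simp [sq]
      _ = ‖inner ℂ (r.adjoint v) x‖ := by rw [ContinuousLinearMap.adjoint_inner_left]
      _ ≤ ‖r.adjoint v‖ * ‖x‖ := norm_inner_le_norm _ _
      _ ≤ ‖r.adjoint v‖ * (K * ‖v‖) := by gcongr
      _ = K * ‖r.adjoint v‖ * ‖v‖ := by ring
  have hunit : IsUnit (r.comp (A.comp r.adjoint)) := by
    refine ContinuousLinearMap.isUnit_of_forall_le_norm_inner_map _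
      (c := ⟨c / K ^ 2, by positivity⟩) (show 0 < c / K ^ 2 by positivity) fun v => ?_
    change ‖v‖ ^ 2 * (c / K ^ 2) ≤ ‖inner ℂ (r (A (r.adjoint v))) v‖
    rw [norm_inner_symm, ← ContinuousLinearMap.adjoint_inner_left]
    refine le_trans ?_ ((hA (r.adjoint v)).trans (Complex.re_le_norm _))
    rw [mul_div_assoc', div_le_iff₀ (by positivity)]
    have := pow_le_pow_left₀ (norm_nonneg v) (hbelow v) 2
    nlinarith
  obtain ⟨u, hu⟩ := hunit
  exact ⟨ContinuousLinearEquiv.unitsEquiv ℂ V u, fun v => DFunLike.congr_fun hu v⟩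

end Congruence

/-! ### The isomorphism over (0,L) and its integral kernel. -/

section Isomorphism

variable {R : ℝ → ℝ → ℂ} {k : ℕ} {A : L2Line →L[ℂ] L2Line}

lemma pairing_kernelOp_eq_inner
    (hRA : ∀ ψ : testSpace univ, kernelOp R ψ =ᵐ[volume] sobolevDeriv k 0 (A (besselTest (-k) ψ)))
    (φ χ : testSpace univ) :
    pairing (kernelOp R φ) χ = inner ℂ (besselTest (-k) χ) (A (besselTest (-k) φ)) := by
  rw [← integral_sobolevDeriv_zero_mul_conj]
  refine integral_congr_ae ?_
  filter_upwards [hRA φ] with x hx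
  rw [hx]

/-- L¹ embeds in H^{-k} for k ≥ 1 and A is bounded, so the form of R is bounded on L¹ × L¹. The
resulting bound on R makes the integrals over (0,L) absolutely convergent for h in L²(0,L). -/
lemma exists_ae_norm_kernel_le (hk : 1 ≤ k)
    (hR : LocallyIntegrable (fun z : ℝ × ℝ => R z.1 z.2))
    (hRA : ∀ ψ : testSpace univ,
      kernelOp R ψ =ᵐ[volume] sobolevDeriv k 0 (A (besselTest (-k) ψ))) :
    ∃ C, ∀ᵐ z : ℝ × ℝ, ‖R z.1 z.2‖ ≤ C := by
  obtain ⟨K, hK, hb⟩ := exists_norm_besselTest_neg_le_integral hk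
  refine ⟨‖A‖ * K * K, ae_norm_kernel_le hR (by positivity) fun φ χ hφ hχ => ?_⟩
  let φ' : testSpace univ := ⟨φ, hφ, subset_univ _⟩
  let χ' : testSpace univ := ⟨fun x => conj (χ x), hχ.conjugate, subset_univ _⟩
  have h1 : ∫ z : ℝ × ℝ, R z.1 z.2 * φ z.2 * χ z.1 =
      inner ℂ (besselTest (-k) χ') (A (besselTest (-k) φ')) := by
    rw [← pairing_kernelOp_eq_inner hRA, pairing_kernelOp, Measure.volume_eq_prod,
      integral_prod _ (integrable_kernel_mul hR hφ hχ)]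
    simp only [χ', φ', Complex.conj_conj]
  have hφ' := hb φ'
  have hχ' : ‖besselTest (-k) χ'‖ ≤ K * ∫ x, ‖χ x‖ := by
    simpa only [χ', Complex.norm_conj] using hb χ'
  have hi1 : 0 ≤ ∫ x, ‖χ x‖ := integral_nonneg fun x => norm_nonneg _
  rw [h1]
  calc ‖inner ℂ (besselTest (-k) χ') (A (besselTest (-k) φ'))‖
      ≤ ‖besselTest (-k) χ'‖ * (‖A‖ * ‖besselTest (-k) φ'‖) :=
        (norm_inner_le_norm _ _).trans (by gcongr; exact A.le_opNorm _)
    _ ≤ (K * ∫ x, ‖χ x‖) * (‖A‖ * (K * ∫ x, ‖φ x‖)) := by gcongr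
    _ = _ := by ring

lemma integral_toL2_restriction_mul_conj {L : ℝ} (G : L2Line) {χ : ℝ → ℂ}
    (hχ : χ ∈ testSpace (Ioo 0 L)) :
    ∫ x in Ioo 0 L, (SobolevInterval.toL2 k L (restriction k L G) : ℝ → ℂ) x * conj (χ x) =
      inner ℂ (besselTest (-k) ⟨χ, coe_mem_testSpace_univ hχ⟩) G := by
  rw [← integral_sobolevDeriv_zero_mul_conj, ← setIntegral_mul_testSpace (conj_mem_testSpace hχ)]
  refine integral_congr_ae ?_
  filter_upwards [coeFn_toL2_restriction (k := k) (L := L) G] with x hx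
  rw [hx]

lemma integrable_kernel_mul_restrict (hR : LocallyIntegrable (fun z : ℝ × ℝ => R z.1 z.2)) {C : ℝ}
    (hC : ∀ᵐ z : ℝ × ℝ, ‖R z.1 z.2‖ ≤ C) {I : Set ℝ} {f g : ℝ → ℂ} (hf : IntegrableOn f I)
    (hg : IntegrableOn g I) :
    Integrable (fun z : ℝ × ℝ => R z.1 z.2 * (f z.1 * g z.2))
      ((volume.restrict I).prod (volume.restrict I)) := by
  rw [Measure.prod_restrict]
  refine Integrable.bdd_mul ?_ (hR.aestronglyMeasurable.restrict) (ae_restrict_of_ae hC)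
  rw [← Measure.prod_restrict]
  exact hf.mul_prod hg

/-- A coercive operator from `H^{-k}(ℝ)` to `H^k(ℝ)` with Hermitian kernel `R` induces an
isomorphism between the spaces over `(0,L)`. -/
theorem isSobolevIsomorphism_of_operator (hk : 1 ≤ k)
    (hR : LocallyIntegrable (fun z : ℝ × ℝ => R z.1 z.2))
    (hRsymm : ∀ x y, R x y = conj (R y x))
    (hA : ∀ x y, inner ℂ x (A y) = inner ℂ (A x) y) {c : ℝ} (hc : 0 < c)
    (hAc : ∀ x, c * ‖x‖ ^ 2 ≤ (inner ℂ x (A x)).re)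
    (hRA : ∀ ψ : testSpace univ,
      kernelOp R ψ =ᵐ[volume] sobolevDeriv k 0 (A (besselTest (-k) ψ)))
    {L : ℝ} (hL : 0 < L) : IsSobolevIsomorphism R k L := by
  obtain ⟨C, hC⟩ := exists_ae_norm_kernel_le hk hR hRA
  obtain ⟨S, hS⟩ := exists_equiv_of_coercive hc hAc (restriction_surjective hk hL)
  -- A functional is first represented by an element of H^k(0,L) through Riesz, then rAr^* is
  -- applied.
  refine ⟨(antidualEquiv (SobolevInterval k L)).symm.trans S, fun h => ?_⟩
  -- The vector w stands for h extended by zero, viewed in H^{-k}(ℝ), although h is not a test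
  -- function.
  set w : L2Line := ((SobolevInterval.toL2 k L).comp (restriction k L)).adjoint h with hw
  have hT : (antidualEquiv (SobolevInterval k L)).symm.trans S (SobolevDual.ofL2 k L h) =
      restriction k L (A w) := by
    have h1 : (antidualEquiv (SobolevInterval k L)).symm (SobolevDual.ofL2 k L h) =
        (SobolevInterval.toL2 k L).adjoint h := by
      rw [ContinuousLinearEquiv.symm_apply_eq]
      refine ContinuousLinearMap.ext fun g => ?_
      rw [antidualEquiv_apply, ContinuousLinearMap.adjoint_inner_right]
      rfl
    rw [ContinuousLinearEquiv.trans_apply, h1, hS, hw, ContinuousLinearMap.adjoint_comp]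
    rfl
  have hh := integrableOn_L2Interval h
  have hone : IntegrableOn (fun _ => (1 : ℂ)) (Ioo 0 L) := by simp
  have hprod := integrable_kernel_mul_restrict hR hC hone hh
  simp only [one_mul] at hprod
  have hae : SobolevInterval.toL2 k L (restriction k L (A w)) =ᵐ[volume.restrict (Ioo 0 L)]
      fun x => ∫ y in Ioo 0 L, R x y * (h : ℝ → ℂ) y := by
    refine ae_eq_of_integral_mul_testSpace_Ioo (integrableOn_L2Interval _)
      hprod.integral_prod_left fun χ' hχ' => ?_
    obtain ⟨χ, hχ, rfl⟩ : ∃ χ ∈ testSpace (Ioo 0 L), (fun x => conj (χ x)) = χ' :=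
      ⟨_, conj_mem_testSpace hχ', by simp⟩
    set ψ : testSpace univ := ⟨χ, coe_mem_testSpace_univ hχ⟩ with hψ
    have hχi : IntegrableOn (fun x => conj (χ x)) (Ioo 0 L) :=
      (memLp_isTest hχ.1.conjugate (volume.restrict (Ioo 0 L))).integrable (by norm_num)
    have hswap := integrable_kernel_mul_restrict hR hC hχi hh
    -- Selfadjointness moves A from w to the test function ψ, where the kernel formula is known;
    -- Fubini and the Hermitian symmetry of R then return the integral to h.
    calc ∫ x in Ioo 0 L, (SobolevInterval.toL2 k L (restriction k L (A w)) : ℝ → ℂ) x * conj (χ x)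
        = inner ℂ (SobolevInterval.toL2 k L (restriction k L (A (besselTest (-k) ψ)))) h := by
          rw [integral_toL2_restriction_mul_conj _ hχ, hA, hw,
            ContinuousLinearMap.adjoint_inner_right]
          rfl
      _ = ∫ y in Ioo 0 L, ∫ x in Ioo 0 L, R x y * (conj (χ x) * (h : ℝ → ℂ) y) := by
          rw [L2.inner_def]
          refine integral_congr_ae ?_
          filter_upwards [coeFn_toL2_restriction (k := k) (L := L) (A (besselTest (-k) ψ)),
            ae_restrict_of_ae (hRA ψ)] with y h1 h2
          rw [h1, ← h2, RCLike.inner_apply, kernelOp, ← setIntegral_mul_testSpace hχ,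
            ← integral_conj, ← integral_const_mul]
          refine integral_congr_ae (Eventually.of_forall fun x => ?_)
          simp only [map_mul, ← hRsymm]
          ring
      _ = ∫ x in Ioo 0 L, ∫ y in Ioo 0 L, R x y * (conj (χ x) * (h : ℝ → ℂ) y) :=
          (integral_integral_swap hswap).symm
      _ = ∫ x in Ioo 0 L, (∫ y in Ioo 0 L, R x y * (h : ℝ → ℂ) y) * conj (χ x) := by
          refine integral_congr_ae (Eventually.of_forall fun x => ?_)
          simp only [← integral_mul_const]
          congr with y
          ring
  filter_upwards [hprod.prod_right_ae, hae] with x h1 h2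
  exact ⟨h1, by rw [hT, h2]⟩

end Isomorphism

end

end RammEstimation

/-! ### Assembly of the theorem. -/

theorem theorem1p2
    (n m : ℕ) (hn : Even n) (hm : Even m) (hmn : m < n)
    -- the operator `Q` of order `n`
    (q : Fin (n + 1) → ℝ → ℂ) (hq : ∀ j, ContDiff ℝ ∞ (q j))
    (c : ℝ) (hc : 0 < c) (hqn : ∀ x, c ≤ ‖q (Fin.last n) x‖)
    -- the operator `P` of order `m`
    (p : Fin (m + 1) → ℝ → ℂ) (hp : ∀ j, ContDiff ℝ ∞ (p j))
    (hpm : ∀ x, p (Fin.last m) x = 1)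
    -- square integrable solutions of `Qu = 0` on the half-lines
    (hneg : Module.finrank ℂ (RammEstimation.l2Solutions q (Iio 0)) = n / 2)
    (hpos : Module.finrank ℂ (RammEstimation.l2Solutions q (Ioi 0)) = n / 2)
    -- the selfadjoint kernel `R`, which maps test functions to `L²(ℝ)`
    (R : ℝ → ℝ → ℂ) (hR : LocallyIntegrable (fun z : ℝ × ℝ => R z.1 z.2))
    (hRsymm : ∀ x y, R x y = conj (R y x))
    (hRL2 : ∀ φ, RammEstimation.IsTest φ → MemLp (RammEstimation.kernelOp R φ) 2 volume)
    (hQR : RammEstimation.KernelEquation q p R)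
    -- the two-sided estimate for `Q^*`
    (c₃ c₄ : ℝ) (hc₃ : 0 < c₃) (hc₄ : 0 < c₄)
    (hQ : ∀ φ, RammEstimation.IsTest φ →
      c₃ * RammEstimation.sobolevNorm (-(((n : ℝ) - m) / 2) + n) φ ≤
          RammEstimation.sobolevNorm (-(((n : ℝ) - m) / 2)) (RammEstimation.formalAdjoint q φ) ∧
        RammEstimation.sobolevNorm (-(((n : ℝ) - m) / 2)) (RammEstimation.formalAdjoint q φ) ≤
          c₄ * RammEstimation.sobolevNorm (-(((n : ℝ) - m) / 2) + n) φ)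
    -- the coercivity of `PQ^*`
    (c₅ c₆ : ℝ) (hc₅ : 0 < c₅) (hc₆ : 0 < c₆)
    (hPQ : ∀ φ, RammEstimation.IsTest φ →
      c₅ * RammEstimation.sobolevNorm (((n : ℝ) + m) / 2) φ ^ 2 ≤
          (RammEstimation.pairing
            (RammEstimation.diffOp p (RammEstimation.formalAdjoint q φ)) φ).re ∧
        (RammEstimation.pairing
            (RammEstimation.diffOp p (RammEstimation.formalAdjoint q φ)) φ).re ≤
          c₆ * RammEstimation.sobolevNorm (((n : ℝ) + m) / 2) φ ^ 2) :
    (∃ c₁ c₂ : ℝ, 0 < c₁ ∧ 0 < c₂ ∧ ∀ φ, RammEstimation.IsTest φ →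
      (RammEstimation.pairing (RammEstimation.kernelOp R φ) φ).im = 0 ∧
      c₁ * RammEstimation.sobolevNorm (-(((n : ℝ) - m) / 2)) φ ^ 2 ≤
          (RammEstimation.pairing (RammEstimation.kernelOp R φ) φ).re ∧
        (RammEstimation.pairing (RammEstimation.kernelOp R φ) φ).re ≤
          c₂ * RammEstimation.sobolevNorm (-(((n : ℝ) - m) / 2)) φ ^ 2) ∧
    ∀ L : ℝ, 0 < L → RammEstimation.IsSobolevIsomorphism R ((n - m) / 2) L := by
  obtain ⟨α, hα⟩ : ∃ α : ℕ, n - m = 2 * α := by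
    obtain ⟨a, rfl⟩ := hn
    obtain ⟨b, rfl⟩ := hm
    exact ⟨a - b, by omega⟩
  have hα1 : 1 ≤ α := by
    obtain ⟨a, rfl⟩ := hn
    obtain ⟨b, rfl⟩ := hm
    omega
  have hnm : n = m + 2 * α := by omega
  have hdiv : (n - m) / 2 = α := by omega
  have hcast : ((n : ℝ) - m) / 2 = α := by
    rw [hnm]
    push_cast
    ring
  have hexp : ((n : ℝ) + m) / 2 = -(α : ℝ) + n := by
    rw [hnm]
    push_cast
    ring
  have hs : (0 : ℝ) ≤ -(α : ℝ) + n := by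
    rw [← hexp]
    positivity
  rw [hcast] at hQ ⊢
  rw [hexp] at hPQ
  rw [hdiv]
  have hq0 (x : ℝ) : q (Fin.last n) x ≠ 0 := norm_pos_iff.1 (hc.trans_le (hqn x))
  have hn0 : 0 < n := by omega
  have hQ' (φ : RammEstimation.testSpace univ) :
      c₃ * ‖RammEstimation.besselTest (-(α : ℝ) + n) φ‖ ≤
          ‖RammEstimation.besselTest (-(α : ℝ)) (RammEstimation.adjointOp q hq φ)‖ ∧
        ‖RammEstimation.besselTest (-(α : ℝ)) (RammEstimation.adjointOp q hq φ)‖ ≤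
          c₄ * ‖RammEstimation.besselTest (-(α : ℝ) + n) φ‖ := by
    rw [RammEstimation.norm_besselTest, RammEstimation.norm_besselTest]
    exact hQ φ φ.2.1
  have hbot := RammEstimation.l2Solutions_inf_eq_bot hn0 hn hq hq0 hneg hpos hs hc₃
    fun φ => (hQ' φ).1
  -- The form at Q^*φ equals (PQ^*φ, φ), which lies between c₅ and c₆ times the squared norm of φ of
  -- order n - α. Replacing that norm by the norm of Q^*φ of order -α costs a factor c₄² below and
  -- c₃² above.
  obtain ⟨A, hA, hAc, hRA⟩ := RammEstimation.exists_operator_of_kernel hn0 hq hq0 hbot hR hRsymm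
    hRL2 (k := α) (c := c₅ / c₄ ^ 2) (C := c₆ / c₃ ^ 2) (by positivity) (by positivity) fun φ => by
      have h1 := hPQ φ φ.2.1
      rw [← RammEstimation.norm_besselTest] at h1
      have h2 : RammEstimation.pairing (RammEstimation.kernelOp R
          (RammEstimation.adjointOp q hq φ)) (RammEstimation.adjointOp q hq φ) =
          RammEstimation.pairing (RammEstimation.diffOp p
            (RammEstimation.formalAdjoint q φ)) φ :=
        hQR _ _ (φ.2.1.formalAdjoint hq) φ.2.1
      rw [h2]
      obtain ⟨h3, h4⟩ := hQ' φ
      refine ⟨le_trans ?_ h1.1, h1.2.trans ?_⟩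
      · rw [div_mul_eq_mul_div, div_le_iff₀ (by positivity), mul_assoc, ← mul_pow, mul_comm _ c₄]
        gcongr
      · rw [div_mul_eq_mul_div, le_div_iff₀ (by positivity), mul_assoc, ← mul_pow, mul_comm _ c₃]
        gcongr
  refine ⟨⟨c₅ / c₄ ^ 2, c₆ / c₃ ^ 2, by positivity, by positivity, fun φ hφ => ?_⟩, fun L hL =>
    RammEstimation.isSobolevIsomorphism_of_operator hα1 hR hRsymm hA (by positivity)
      (fun x => (hAc x).1) hRA hL⟩
  have h1 := RammEstimation.pairing_kernelOp_eq_inner hRA ⟨φ, hφ, subset_univ _⟩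
    ⟨φ, hφ, subset_univ _⟩
  have h2 := RammEstimation.norm_besselTest (-(α : ℝ)) ⟨φ, hφ, subset_univ _⟩
  refine ⟨Complex.conj_eq_iff_im.1
    (RammEstimation.pairing_kernelOp_symm hR hRsymm hφ hφ).symm, ?_⟩
  dsimp only at h1 h2
  rw [h1, ← h2]
  exact hAc _
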